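/- Let $L_{1/2}(\mathbb{R}^3)$ be the set of $v\in L^1_{\mathrm{loc}}(\mathbb{R}^3)$ with $\int_{\mathbb{R}^3}\frac{|v(x)|}{1+|x|^4}\,dx<\infty$, and for a Schwartz function $\varphi$ let $(-\Delta)^{1/2}\varphi$ be the Fourier multiplier of $\varphi$ with symbol $|\xi|$. Let $u\in C^\infty(\mathbb{R}^3)$ be a solution of $$(-\Delta)^{3/2}u=2e^{3u}\ \text{ in }\mathbb{R}^3,\qquad \int_{\mathbb{R}^3}e^{3u}\,dx<\infty,$$ which means that $e^{3u}\in L^1(\mathbb{R}^3)$, $\Delta u\in L_{1/2}(\mathbb{R}^3)$ and $$\int_{\mathbb{R}^3}(-\Delta u)\,(-\Delta)^{1/2}\varphi\,dx=\int_{\mathbb{R}^3}2e^{3u}\varphi\,dx\quad\text{for every }\varphi\in\mathcal{S}(\mathbb{R}^3).$$ Set $$v(x)=\frac1{\pi^2}\int_{\mathbb{R}^3}\log\left(\frac{|y|}{|x-y|}\right)e^{3u(y)}\,dy .$$ Then $u=v+p$ for a polynomial $p$ on $\mathbb{R}^3$, and the following are equivalent: (i) $u$ is spherical, i.e. there are $x_0\in\mathbb{R}^3$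 and $\lambda>0$ with $u(x)=\log\frac{2\lambda}{1+\lambda^2|x-x_0|^2}$ for all $x\in\mathbb{R}^3$; (ii) $\deg p=0$, i.e. $p$ is constant (possibly zero); (iii) $\lim_{|x|\to\infty}\Delta u(x)=0$; (iv) $u(x)=o(|x|^2)$ as $|x|\to\infty$; (v) $\liminf_{|x|\to\infty}R_{g_u}(x)>-\infty$, where $R_{g_u}$ is the scalar curvature of the metric $g_u=e^{2u}|dx|^2$; (vi) the metric $\pi^*g_u$ extends to a (smooth) Riemannian metric on $\mathbb{S}^3=\{x\in\mathbb{R}^4:|x|=1\}$, where $\pi:\mathbb{S}^3\setminus\{(0,0,0,-1)\}\to\mathbb{R}^3$, $\pi(x',x_4)=\frac{x'}{1+x_4}$, is the stereographic projection. Moreover, if $u$ is not spherical, then there is a constant $a>0$ such that $\Delta u(x)\to-a$ as $|x|\to\infty$. -/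

import Mathlib

open scoped Manifold ContDiff Laplacian SchwartzMap FourierTransform Topology RealInnerProductSpace

noncomputable section

/-- Euclidean three-space, with its Euclidean norm and Lebesgue measure. -/
abbrev R3 : Type := EuclideanSpace ℝ (Fin 3)

/-- The unit sphere of `ℝ⁴`, with Mathlib's smooth structure. -/
abbrev S3 : Type := Metric.sphere (0 : EuclideanSpace ℝ (Fin 4)) 1

/-! ### The equation -/

/-- The space `L_{1/2}(ℝ³)` of locally integrable `v` with `∫ |v| / (1 + |x|⁴) dx < ∞`. -/
def MemLHalf (v : R3 → ℝ) : Prop :=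
  MeasureTheory.LocallyIntegrable v ∧
    MeasureTheory.Integrable (fun x : R3 => |v x| / (1 + ‖x‖ ^ 4))

/-- `(-Δ)^{1/2} φ` for a Schwartz function `φ`, as a Fourier multiplier. Mathlib's transform is
`𝓕 φ ξ = ∫ φ x exp (-2πi ⟨x, ξ⟩) dx`, for which `-Δ` has symbol `(2π|ξ|)²`, so that the symbol of
`(-Δ)^{1/2}` is `2π|ξ|`. -/
def halfLaplacian (φ : 𝓢(R3, ℂ)) : R3 → ℂ :=
  𝓕⁻ (fun ξ : R3 => ((2 * Real.pi * ‖ξ‖ : ℝ) : ℂ) * 𝓕 (φ : R3 → ℂ) ξ)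

/-- `u` is a smooth solution of `(-Δ)^{3/2} u = f` on `ℝ³`, where `f` is a function acting on
Schwartz functions by integration: `Δ u ∈ L_{1/2}` and `(-Δ)^{1/2} (-Δ u) = f` by duality.
As `u` is smooth, it lies in `W^{2,1}_loc` and its weak Laplacian is the classical one. -/
structure IsSmoothSolution (u f : R3 → ℝ) : Prop where
  smooth : ContDiff ℝ ∞ u
  laplacian_mem : MemLHalf (Δ u)
  weak : ∀ φ : 𝓢(R3, ℂ),
    ∫ x, ((-(Δ u x) : ℝ) : ℂ) * halfLaplacian φ x = ∫ x, ((f x : ℝ) : ℂ) * φ x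

/-- `u = w_{x₀,λ}` for some `x₀ ∈ ℝ³` and `λ > 0`. -/
def IsSpherical (u : R3 → ℝ) : Prop :=
  ∃ (x₀ : R3) (l : ℝ), 0 < l ∧ ∀ x, u x = Real.log (2 * l / (1 + l ^ 2 * ‖x - x₀‖ ^ 2))

/-- `v(x) = π⁻² ∫ log (|y| / |x - y|) e^{3u(y)} dy`. -/
def logPotential (u : R3 → ℝ) (x : R3) : ℝ :=
  1 / Real.pi ^ 2 * ∫ y : R3, Real.log (‖y‖ / ‖x - y‖) * Real.exp (3 * u y)

/-! ### Scalar curvature of a metric on `ℝ³`, in the standard coordinates -/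

/-- A field of bilinear forms on `ℝ³`. -/
abbrev MetricField : Type := R3 → R3 →L[ℝ] R3 →L[ℝ] ℝ

/-- The partial derivative `∂ᵢ f`. -/
def partialDeriv (i : Fin 3) (f : R3 → ℝ) (x : R3) : ℝ :=
  fderiv ℝ f x (EuclideanSpace.single i 1)

/-- The matrix of coefficients `g_{ij} = g(∂ᵢ, ∂ⱼ)`. -/
def metricMatrix (g : MetricField) (x : R3) : Matrix (Fin 3) (Fin 3) ℝ :=
  Matrix.of fun i j => g x (EuclideanSpace.single i 1) (EuclideanSpace.single j 1)

/-- `Γᵏᵢⱼ = ½ ∑ₗ gᵏˡ (∂ᵢ gⱼₗ + ∂ⱼ gᵢₗ - ∂ₗ gᵢⱼ)`. -/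
def christoffel (g : MetricField) (k i j : Fin 3) (x : R3) : ℝ :=
  1 / 2 * ∑ l, (metricMatrix g x)⁻¹ k l *
    (partialDeriv i (fun y => metricMatrix g y j l) x
      + partialDeriv j (fun y => metricMatrix g y i l) x
      - partialDeriv l (fun y => metricMatrix g y i j) x)

/-- `Ricᵢⱼ = ∑ₖ (∂ₖ Γᵏᵢⱼ - ∂ⱼ Γᵏᵢₖ + ∑ₗ (Γᵏₖₗ Γˡᵢⱼ - Γᵏⱼₗ Γˡᵢₖ))`. -/
def ricci (g : MetricField) (i j : Fin 3) (x : R3) : ℝ :=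
  ∑ k, (partialDeriv k (christoffel g k i j) x - partialDeriv j (christoffel g k i k) x
    + ∑ l, (christoffel g k k l x * christoffel g l i j x
      - christoffel g k j l x * christoffel g l i k x))

/-- `R_g = ∑ᵢⱼ gⁱʲ Ricᵢⱼ`. -/
def scalarCurvature (g : MetricField) (x : R3) : ℝ :=
  ∑ i, ∑ j, (metricMatrix g x)⁻¹ i j * ricci g i j x

/-- The metric `g_u = e^{2u} |dx|²`. -/
def conformalMetric (u : R3 → ℝ) : MetricField :=
  fun x => Real.exp (2 * u x) • innerSL ℝ

/-! ### Pullback to the sphere -/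

/-- The south pole `(0, 0, 0, -1)`. -/
def southPole : S3 :=
  ⟨EuclideanSpace.single (Fin.last 3) (-1), by simp⟩

/-- The stereographic projection `π(x', x₄) = x' / (1 + x₄)`. Only its values away from the south
pole are meaningful. -/
def stereo (q : S3) : R3 :=
  WithLp.toLp 2 fun i : Fin 3 => (q : EuclideanSpace ℝ (Fin 4)) i.castSucc /
    (1 + (q : EuclideanSpace ℝ (Fin 4)) (Fin.last 3))

/-- `π^* g`, a metric on `S³` minus the south pole, extends to a smooth Riemannian metric on
`S³`. -/
def PullbackExtends (g : MetricField) : Prop :=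
  ∃ G : Bundle.ContMDiffRiemannianMetric (𝓡 3) ∞ R3 (fun q : S3 => TangentSpace (𝓡 3) q),
    ∀ q : S3, q ≠ southPole → ∀ X Y : TangentSpace (𝓡 3) q,
      G.inner q X Y =
        g (stereo q) (mfderiv (𝓡 3) 𝓘(ℝ, R3) stereo q X) (mfderiv (𝓡 3) 𝓘(ℝ, R3) stereo q Y)

end

/-!
The solution `u` is compared with the logarithmic potential `v` of its own density `e^{3u}`.

*Structure of the solution.* The Fourier transform of `|x|⁻²` on `ℝ³` is `π / |ξ|`
(`integral_riesz_fourierInv`), so the equation says that `Δu + π⁻² ∫ e^{3u(y)} / |x - y|² dy`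
annihilates every band-limited function with spectrum away from the origin
(`integral_band_eq_zero`). Its averages against dilations of a fixed Schwartz function therefore do
not depend on the scale, and it is constant (`exists_const_of_band`). As the integral is `-π² Δv`,
the difference `p = u - v` has constant Laplacian. From `u ≤ e^{3u}` and `v ≥ -C log (1 + |x|) - C`
it follows that `p` is bounded above by an integrable function plus a logarithm; the mean value
property with a smooth radial weight then makes the third differences of `p` vanish
(`exists_quadratic_of_laplacian_eq_const`), and `p(x) = q + ½ ⟪T (x - x₀), x - x₀⟫` with `T` symmetric
and negative semidefinite (`exists_decomposition`). So `p` is constant if and only if `T = 0`, if and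
only if `tr T = 0`.

*Behaviour at infinity.* Only `u ≤ v + q` is needed to bound `u` above (`exists_le_of_le_logPot`).
Then `e^{3u}`, the Riesz potential and the gradient of `v` vanish at infinity, and `Δu → tr T`. This
gives the last claim of the theorem and the criterion in terms of `Δu`. If `T ≠ 0`, then along a ray
from `x₀` in a direction `e` with `T e ≠ 0` the solution tends to `-∞` at a quadratic rate
(`eq_zero_of_isLittleO`), and the scalar curvature `-e^{-2u} (4 Δu + 2 |∇u|²)` tends to `-∞`
(`exists_scalarCurvature_lt`).

*Classification for `T = 0`.* The Pohozaev identity gives `∫ e^{3u} = 2π²`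
(`normalizedMass_eq_two`). For exactly this mass the difference between `u` and its transform under
an inversion is a potential over the ball with a positive kernel (`sub_sphereReflect`), so the method
of moving spheres applies, and `u` is invariant under an inversion about every point
(`exists_eq_sphereReflect`). Comparing the expansions at infinity that these inversions produce
shows that `e^{-u}` is a quadratic polynomial, and `u` is spherical
(`isSpherical_of_sphereReflect`).

*The sphere.* The stereographic projection is conformal with factor `1 / (1 + x₄)`. The metric of a
spherical solution is a smooth positive multiple of the round metric
(`IsSpherical.pullbackExtends`). Conversely, if the metric extends over the pole, the conformal factor
has a positive limit there, and `u + 2 log |x|` stays bounded at infinity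
(`isLittleO_of_pullbackExtends`).
-/

section

noncomputable section

open MeasureTheory Filter Set Metric

/-! ### Singular kernels on three-space -/

theorem integrableOn_ball_norm_rpow {s : ℝ} (hs : s < 3) (r : ℝ) :
    IntegrableOn (fun z : R3 => ‖z‖ ^ (-s)) (ball 0 r) := by
  rw [integrableOn_fun_norm_addHaar volume (f := fun t : ℝ => t ^ (-s))]
  rcases le_or_gt r 0 with hr | hr
  · simp [Ioo_eq_empty (not_lt.2 hr)]
  have h : IntegrableOn (fun t : ℝ => t ^ (2 - s)) (Ioo 0 r) :=
    (intervalIntegral.integrableOn_Ioo_rpow_iff hr).2 (by linarith)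
  refine h.congr_fun (fun t ht => ?_) measurableSet_Ioo
  simp [sub_eq_add_neg, Real.rpow_add ht.1]

/-- The mass `∫_{|z| < 1} |z|^{-s} dz` of a singular kernel near its pole. -/
def poleMass (s : ℝ) : ℝ := ∫ z in ball (0 : R3) 1, ‖z‖ ^ (-s)

theorem poleMass_nonneg (s : ℝ) : 0 ≤ poleMass s :=
  integral_nonneg fun _ => by positivity

theorem aestronglyMeasurable_comp_sub {E : Type*} [NormedAddCommGroup E]
    {k : R3 → E} (hk : ContinuousOn k {0}ᶜ) (x : R3) :
    AEStronglyMeasurable (fun y => k (x - y)) := by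
  have h : AEStronglyMeasurable k (volume : Measure R3) := by
    have := hk.aestronglyMeasurable (μ := volume) (measurableSet_singleton 0).compl
    rwa [restrict_compl_singleton] at this
  exact h.comp_quasiMeasurePreserving (quasiMeasurePreserving_sub_left volume x)

theorem continuousOn_norm_rpow (s : ℝ) : ContinuousOn (fun z : R3 => ‖z‖ ^ s) {0}ᶜ :=
  fun z hz => ((continuous_norm.continuousAt).rpow_const
    (Or.inl (by simpa using hz))).continuousWithinAt

/-- A potential with kernel `|z|^{-s}`, `0 ≤ s < 3`, of an integrable density `f` is controlled by
a local bound of `f` near the pole and by the total mass. -/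
theorem rieszPotential_bound {s : ℝ} (hs0 : 0 ≤ s) (hs : s < 3) {f : R3 → ℝ} (hf : Integrable f)
    (hf0 : ∀ y, 0 ≤ f y) {x : R3} {S : ℝ} (hS : ∀ y ∈ ball x 1, f y ≤ S) :
    Integrable (fun y => ‖x - y‖ ^ (-s) * f y) ∧
      ∫ y, ‖x - y‖ ^ (-s) * f y ≤ S * poleMass s + ∫ y, f y := by
  set g : R3 → ℝ := (ball (0 : R3) 1).indicator fun z => ‖z‖ ^ (-s) with hg
  have hS0 : 0 ≤ S := (hf0 x).trans (hS x (mem_ball_self one_pos))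
  have hgi : Integrable g := (integrableOn_ball_norm_rpow hs 1).integrable_indicator
    measurableSet_ball
  have hgx : Integrable (fun y => g (x - y)) := hgi.comp_sub_left x
  have hB : Integrable (fun y => S * g (x - y) + f y) := (hgx.const_mul S).add hf
  have hle : ∀ y, ‖x - y‖ ^ (-s) * f y ≤ S * g (x - y) + f y := by
    intro y
    by_cases hy : x - y ∈ ball (0 : R3) 1
    · have hy' : y ∈ ball x 1 := by
        rw [mem_ball, dist_comm, dist_eq_norm]; simpa using hy
      have : g (x - y) = ‖x - y‖ ^ (-s) := by simp only [hg]; exact indicator_of_mem hy _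
      rw [this, mul_comm S]
      have := mul_le_mul_of_nonneg_left (hS y hy') (by positivity : 0 ≤ ‖x - y‖ ^ (-s))
      linarith [hf0 y]
    · have : g (x - y) = 0 := by simp only [hg]; exact indicator_of_notMem hy _
      rw [this, mul_zero, zero_add]
      refine mul_le_of_le_one_left (hf0 y) (Real.rpow_le_one_of_one_le_of_nonpos ?_ (by linarith))
      simpa using hy
  have hm : AEStronglyMeasurable (fun y => ‖x - y‖ ^ (-s) * f y) :=
    (aestronglyMeasurable_comp_sub (continuousOn_norm_rpow (-s)) x).mul hf.1
  have hi : Integrable (fun y => ‖x - y‖ ^ (-s) * f y) := by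
    refine hB.mono' hm (Eventually.of_forall fun y => ?_)
    rw [Real.norm_of_nonneg (mul_nonneg (by positivity) (hf0 y))]
    exact hle y
  refine ⟨hi, (integral_mono hi hB hle).trans_eq ?_⟩
  rw [integral_add (hgx.const_mul S) hf, integral_const_mul,
    integral_sub_left_eq_self g volume x, hg, integral_indicator measurableSet_ball]
  rfl

theorem exists_bound_on_ball {f : R3 → ℝ} (hf : Continuous f) (M : ℝ) :
    ∃ S, ∀ x ∈ ball (0 : R3) M, ∀ y ∈ ball x 1, f y ≤ S := by
  obtain ⟨S, hS⟩ := (isCompact_closedBall (0 : R3) (M + 1)).bddAbove_image hf.continuousOn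
  refine ⟨S, fun x hx y hy => hS ⟨y, ?_, rfl⟩⟩
  rw [mem_closedBall]
  have := dist_triangle y x 0
  rw [mem_ball] at hx hy
  linarith

theorem continuousOn_of_tendsto_kernel {E : Type*} [NormedAddCommGroup E]
    {C : ℝ} {k : R3 → E} {K : ℕ → R3 → E} (hK : ∀ n, Continuous (K n))
    (h : ∀ n : ℕ, ∀ z, z ≠ 0 → ‖K n z - k z‖ ≤ C * (1 / ((n : ℝ) + 1)) * (1 + ‖z‖ ^ (-(5 / 2) : ℝ))) :
    ContinuousOn k {0}ᶜ := by
  have : TendstoLocallyUniformlyOn K k atTop {0}ᶜ := by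
    rw [tendstoLocallyUniformlyOn_iff_forall_isCompact isOpen_compl_singleton]
    intro Q hQ0 hQ
    obtain ⟨B, hB⟩ := hQ.bddAbove_image
      ((continuousOn_const (c := (1 : ℝ))).add ((continuousOn_norm_rpow (-(5 / 2))).mono hQ0))
    have hlim : Tendsto (fun n : ℕ => |C| * (1 / ((n : ℝ) + 1)) * |B|) atTop (𝓝 0) := by
      simpa using (tendsto_one_div_add_atTop_nhds_zero_nat.const_mul |C|).mul_const |B|
    rw [Metric.tendstoUniformlyOn_iff]
    intro ε hε
    filter_upwards [hlim.eventually_lt_const hε] with n hn z hz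
    rw [dist_comm, dist_eq_norm]
    refine (h n z (hQ0 hz)).trans_lt (lt_of_le_of_lt ?_ hn)
    have h1 : 1 + ‖z‖ ^ (-(5 / 2) : ℝ) ≤ |B| := (hB ⟨z, hz, rfl⟩).trans (le_abs_self B)
    gcongr
    exact le_abs_self C
  exact this.continuousOn (Eventually.of_forall fun n => (hK n).continuousOn).frequently

/-- Differentiation of a potential `x ↦ ∫ f(y) (k(x - y) - g(y)) dy` whose kernel `k` is singular at
the origin, with `k` and its derivative `k'` approximated by `C¹` kernels `K n` at the rate
`(1 + |z|^{-5/2}) / n`. -/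
theorem hasFDerivAt_potential {E : Type*} [NormedAddCommGroup E] [NormedSpace ℝ E]
    {f : R3 → ℝ} (hf : Continuous f) (hfi : Integrable f) (hf0 : ∀ y, 0 ≤ f y)
    {C : ℝ} {k g : R3 → E} {k' : R3 → R3 →L[ℝ] E} {K : ℕ → R3 → E} {K' : ℕ → R3 → R3 →L[ℝ] E}
    (hK : ∀ n z, HasFDerivAt (K n) (K' n z) z) (hK'c : ∀ n, Continuous (K' n))
    (hK'b : ∀ n, ∃ B, ∀ z, ‖K' n z‖ ≤ B)
    (h1 : ∀ n : ℕ, ∀ z, z ≠ 0 → ‖K n z - k z‖ ≤ C * (1 / ((n : ℝ) + 1)) * (1 + ‖z‖ ^ (-(5 / 2) : ℝ)))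
    (h2 : ∀ n : ℕ, ∀ z, z ≠ 0 →
      ‖K' n z - k' z‖ ≤ C * (1 / ((n : ℝ) + 1)) * (1 + ‖z‖ ^ (-(5 / 2) : ℝ)))
    (hgi : ∀ x, Integrable fun y => f y • (k (x - y) - g y)) :
    (∀ x, Integrable fun y => f y • k' (x - y)) ∧
      (∀ x, HasFDerivAt (fun x => ∫ y, f y • (k (x - y) - g y)) (∫ y, f y • k' (x - y)) x) ∧
      Continuous fun x => ∫ y, f y • k' (x - y) := by
  have hKc : ∀ n, Continuous (K n) := fun n =>
    continuous_iff_continuousAt.2 fun z => (hK n z).continuousAt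
  have hkc := continuousOn_of_tendsto_kernel hKc h1
  have hk'c := continuousOn_of_tendsto_kernel hK'c h2
  have hw : ∀ x, Integrable (fun y => f y * (1 + ‖x - y‖ ^ (-(5 / 2) : ℝ))) := by
    intro x
    obtain ⟨S, hS⟩ := exists_bound_on_ball hf (‖x‖ + 1)
    have := (rieszPotential_bound (s := 5 / 2) (by norm_num) (by norm_num) hfi hf0
      (hS x (by simp))).1
    refine (hfi.add this).congr (Eventually.of_forall fun y => ?_)
    simp only [Pi.add_apply]; ring
  have hne : ∀ x : R3, ∀ᵐ y, x - y ≠ 0 := by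
    intro x
    filter_upwards [(measure_eq_zero_iff_ae_notMem.1 (measure_singleton x) : ∀ᵐ y, y ∉ ({x} : Set R3))]
      with y hy
    simpa [sub_eq_zero, eq_comm] using hy
  -- the error of the `n`-th approximation, in integrated form
  have herr : ∀ {E' : Type _} [NormedAddCommGroup E'] [NormedSpace ℝ E'] {j : R3 → E'}
      {J : ℕ → R3 → E'} (hj : ContinuousOn j {0}ᶜ) (hJ : ∀ n, Continuous (J n))
      (h : ∀ n : ℕ, ∀ z, z ≠ 0 →
        ‖J n z - j z‖ ≤ C * (1 / ((n : ℝ) + 1)) * (1 + ‖z‖ ^ (-(5 / 2) : ℝ))) (n : ℕ) (x : R3),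
      Integrable (fun y => f y • (J n (x - y) - j (x - y))) ∧
      ‖∫ y, f y • (J n (x - y) - j (x - y))‖ ≤
        C * (1 / ((n : ℝ) + 1)) * ∫ y, f y * (1 + ‖x - y‖ ^ (-(5 / 2) : ℝ)) := by
    intro E' _ _ j J hj hJ h n x
    have hm : AEStronglyMeasurable (fun y => f y • (J n (x - y) - j (x - y))) :=
      hfi.1.smul (((hJ n).comp (continuous_const.sub continuous_id)).aestronglyMeasurable.sub
        (aestronglyMeasurable_comp_sub hj x))
    have hb : ∀ᵐ y, ‖f y • (J n (x - y) - j (x - y))‖ ≤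
        C * (1 / ((n : ℝ) + 1)) * (f y * (1 + ‖x - y‖ ^ (-(5 / 2) : ℝ))) := by
      filter_upwards [hne x] with y hy
      rw [norm_smul, Real.norm_of_nonneg (hf0 y)]
      have := mul_le_mul_of_nonneg_left (h n (x - y) hy) (hf0 y)
      linarith
    have hi := (hw x).const_mul (C * (1 / ((n : ℝ) + 1)))
    refine ⟨hi.mono' hm hb, ?_⟩
    rw [← integral_const_mul]
    exact norm_integral_le_of_norm_le hi hb
  -- convergence is uniform on balls
  have hunif : ∀ {E' : Type _} [NormedAddCommGroup E'] [NormedSpace ℝ E'] {u : R3 → E'}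
      {U : ℕ → R3 → E'} (h : ∀ n x, ‖U n x - u x‖ ≤
        C * (1 / ((n : ℝ) + 1)) * ∫ y, f y * (1 + ‖x - y‖ ^ (-(5 / 2) : ℝ))) (M : ℝ),
      TendstoUniformlyOn U u atTop (ball 0 M) := by
    intro E' _ _ u U h M
    obtain ⟨S, hS⟩ := exists_bound_on_ball hf M
    set W := |(∫ y, f y) + (S * poleMass (5 / 2) + ∫ y, f y)|
    have hlim : Tendsto (fun n : ℕ => |C| * (1 / ((n : ℝ) + 1)) * W) atTop (𝓝 0) := by
      simpa using (tendsto_one_div_add_atTop_nhds_zero_nat.const_mul |C|).mul_const W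
    rw [Metric.tendstoUniformlyOn_iff]
    intro ε hε
    filter_upwards [hlim.eventually_lt_const hε] with n hn x hx
    rw [dist_comm, dist_eq_norm]
    refine (h n x).trans_lt (lt_of_le_of_lt ?_ hn)
    have hr := rieszPotential_bound (s := 5 / 2) (by norm_num) (by norm_num) hfi hf0 (hS x hx)
    have h0 : 0 ≤ ∫ y, f y * (1 + ‖x - y‖ ^ (-(5 / 2) : ℝ)) :=
      integral_nonneg fun y => mul_nonneg (hf0 y) (by positivity)
    have hle : ∫ y, f y * (1 + ‖x - y‖ ^ (-(5 / 2) : ℝ)) ≤ W := by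
      refine le_trans ?_ (le_abs_self _)
      rw [show (fun y => f y * (1 + ‖x - y‖ ^ (-(5 / 2) : ℝ))) =
        fun y => f y + ‖x - y‖ ^ (-(5 / 2) : ℝ) * f y from by ext y; ring, integral_add hfi hr.1]
      linarith [hr.2]
    gcongr
    exact le_abs_self C
  have hKi : ∀ n x, Integrable fun y => f y • (K n (x - y) - g y) := by
    intro n x
    refine ((herr hkc hKc h1 n x).1.add (hgi x)).congr (Eventually.of_forall fun y => ?_)
    simp only [Pi.add_apply, ← smul_add]; congr 1; abel
  have hK'i : ∀ n x, Integrable fun y => f y • K' n (x - y) := by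
    intro n x
    obtain ⟨B, hB⟩ := hK'b n
    refine (hfi.mul_const B).mono' (hfi.1.smul
      ((hK'c n).comp (continuous_const.sub continuous_id)).aestronglyMeasurable)
      (Eventually.of_forall fun y => ?_)
    rw [norm_smul, Real.norm_of_nonneg (hf0 y)]
    exact mul_le_mul_of_nonneg_left (hB _) (hf0 y)
  have hk'i : ∀ x, Integrable fun y => f y • k' (x - y) := by
    intro x
    refine ((hK'i 0 x).sub (herr hk'c hK'c h2 0 x).1).congr (Eventually.of_forall fun y => ?_)
    simp only [Pi.sub_apply, ← smul_sub]; congr 1; abel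
  have hderiv : ∀ n x, HasFDerivAt (fun x => ∫ y, f y • (K n (x - y) - g y))
      (∫ y, f y • K' n (x - y)) x := by
    intro n x
    obtain ⟨B, hB⟩ := hK'b n
    refine hasFDerivAt_integral_of_dominated_of_fderiv_le (bound := fun y => f y * B)
      (F' := fun x y => f y • K' n (x - y)) univ_mem
      (Eventually.of_forall fun z => (hKi n z).1) (hKi n x) (hK'i n x).1
      (Eventually.of_forall fun y z _ => ?_) (hfi.mul_const B)
      (Eventually.of_forall fun y z _ => ?_)
    · rw [norm_smul, Real.norm_of_nonneg (hf0 y)]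
      exact mul_le_mul_of_nonneg_left (hB _) (hf0 y)
    · have : HasFDerivAt (fun x => K n (x - y) - g y) (K' n (z - y)) z := by
        simpa using ((hK n (z - y)).comp z ((hasFDerivAt_id z).sub_const y)).sub_const (g y)
      exact this.const_smul (f y)
  have hU' : ∀ M, TendstoUniformlyOn (fun n x => ∫ y, f y • K' n (x - y))
      (fun x => ∫ y, f y • k' (x - y)) atTop (ball 0 M) := by
    refine hunif fun n x => ?_
    rw [← integral_sub (hK'i n x) (hk'i x)]
    simp_rw [← smul_sub]
    exact (herr hk'c hK'c h2 n x).2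
  have hU : ∀ M, TendstoUniformlyOn (fun n x => ∫ y, f y • (K n (x - y) - g y))
      (fun x => ∫ y, f y • (k (x - y) - g y)) atTop (ball 0 M) := by
    refine hunif fun n x => ?_
    rw [← integral_sub (hKi n x) (hgi x)]
    simp_rw [← smul_sub, sub_sub_sub_cancel_right]
    exact (herr hkc hKc h1 n x).2
  refine ⟨hk'i, fun x => ?_, ?_⟩
  · exact hasFDerivAt_of_tendstoUniformlyOn isOpen_ball (hU' (‖x‖ + 1)) (fun n z _ => hderiv n z)
      (fun z hz => (hU (‖x‖ + 1)).tendsto_at hz) (by simp)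
  · have : TendstoLocallyUniformly (fun n x => ∫ y, f y • K' n (x - y))
        (fun x => ∫ y, f y • k' (x - y)) atTop := by
      rw [tendstoLocallyUniformly_iff_forall_isCompact]
      intro Q hQ
      obtain ⟨M, hM⟩ := hQ.isBounded.subset_ball 0
      exact (hU' M).mono hM
    refine this.continuous (Eventually.of_forall fun n => ?_).frequently
    obtain ⟨B, hB⟩ := hK'b n
    refine continuous_of_dominated (bound := fun y => f y * B) (fun x => (hK'i n x).1)
      (fun x => Eventually.of_forall fun y => ?_) (hfi.mul_const B)
      (Eventually.of_forall fun y => ?_)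
    · rw [norm_smul, Real.norm_of_nonneg (hf0 y)]
      exact mul_le_mul_of_nonneg_left (hB _) (hf0 y)
    · exact ((hK'c n).comp (continuous_id.sub continuous_const)).const_smul (f y)

/-! ### Logarithmic potentials -/

/-- The regularized logarithm `½ log (|z|² + e)`, equal to `log |z|` for `e = 0`. -/
def logKer (e : ℝ) (z : R3) : ℝ := 1 / 2 * Real.log (‖z‖ ^ 2 + e)

/-- The gradient of `logKer e`. -/
def gradKer (e : ℝ) (z : R3) : R3 := (‖z‖ ^ 2 + e)⁻¹ • z

/-- The differential of `gradKer e`. -/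
def hessKer (e : ℝ) (z : R3) : R3 →L[ℝ] R3 :=
  (‖z‖ ^ 2 + e)⁻¹ • ContinuousLinearMap.id ℝ R3 -
    (2 * ((‖z‖ ^ 2 + e)⁻¹) ^ 2) • (innerSL ℝ z).smulRight z

theorem logKer_zero (z : R3) : logKer 0 z = Real.log ‖z‖ := by
  simp [logKer, Real.log_pow]

theorem hasFDerivAt_norm_sq_add (e : ℝ) (z : R3) :
    HasFDerivAt (fun z : R3 => ‖z‖ ^ 2 + e) ((2 : ℝ) • innerSL ℝ z) z :=
  ((hasStrictFDerivAt_norm_sq z).hasFDerivAt.add_const e).congr_fderiv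
    (by ext; simp)

theorem hasFDerivAt_logKer {e : ℝ} (he : 0 < e) (z : R3) :
    HasFDerivAt (logKer e) (innerSL ℝ (gradKer e z)) z := by
  have h2 := ((hasFDerivAt_norm_sq_add e z).log (by positivity)).const_mul (1 / 2 : ℝ)
  refine h2.congr_fderiv ?_
  ext a
  simp [gradKer]
  ring

theorem hasFDerivAt_gradKer {e : ℝ} (he : 0 < e) (z : R3) :
    HasFDerivAt (gradKer e) (hessKer e z) z := by
  have h0 : ‖z‖ ^ 2 + e ≠ 0 := by positivity
  have h2 : HasFDerivAt (fun z : R3 => (‖z‖ ^ 2 + e)⁻¹)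
      (-((‖z‖ ^ 2 + e) ^ 2)⁻¹ • ((2 : ℝ) • innerSL ℝ z)) z :=
    (hasDerivAt_inv h0).comp_hasFDerivAt z (hasFDerivAt_norm_sq_add e z)
  refine (h2.smul (hasFDerivAt_id z)).congr_fderiv ?_
  ext a b
  simp [hessKer]
  ring

theorem norm_gradKer (e : ℝ) (z : R3) : ‖gradKer e z‖ = |(‖z‖ ^ 2 + e)⁻¹| * ‖z‖ := by
  rw [gradKer, norm_smul, Real.norm_eq_abs]

theorem norm_smulRight_inner (z : R3) : ‖(innerSL ℝ z).smulRight z‖ = ‖z‖ ^ 2 := by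
  rw [ContinuousLinearMap.norm_smulRight_apply, innerSL_apply_norm, sq]

theorem norm_id_le_one : ‖ContinuousLinearMap.id ℝ R3‖ ≤ 1 :=
  ContinuousLinearMap.norm_id_le

theorem continuous_gradKer {e : ℝ} (he : 0 < e) : Continuous (gradKer e) :=
  continuous_iff_continuousAt.2 fun z => (hasFDerivAt_gradKer he z).continuousAt

theorem continuous_hessKer {e : ℝ} (he : 0 < e) : Continuous (hessKer e) := by
  unfold hessKer
  have h : Continuous fun z : R3 => (‖z‖ ^ 2 + e)⁻¹ :=
    Continuous.inv₀ (by fun_prop) fun z => by positivity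
  refine (h.smul continuous_const).sub ((continuous_const.mul (h.pow 2)).smul ?_)
  exact ((ContinuousLinearMap.smulRightL ℝ R3 R3).continuous.comp
    (innerSL ℝ).continuous).clm_apply continuous_id

theorem norm_gradKer_le {e : ℝ} (he : 0 < e) (z : R3) : ‖gradKer e z‖ ≤ 1 + 1 / e := by
  rw [norm_gradKer, abs_of_pos (by positivity), inv_mul_eq_div, div_le_iff₀ (by positivity)]
  have : (1 + 1 / e) * (‖z‖ ^ 2 + e) = ‖z‖ ^ 2 + e + ‖z‖ ^ 2 / e + 1 := by field_simp; ring
  rw [this]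
  have h1 : 0 ≤ ‖z‖ ^ 2 / e := by positivity
  nlinarith [sq_nonneg (‖z‖ - 1)]

theorem norm_hessKer_le {e : ℝ} (he : 0 < e) (z : R3) : ‖hessKer e z‖ ≤ 3 / e := by
  rw [hessKer]
  refine (norm_sub_le _ _).trans ?_
  rw [norm_smul, norm_smul, norm_smulRight_inner, Real.norm_of_nonneg (by positivity),
    Real.norm_of_nonneg (by positivity)]
  have h1 : (‖z‖ ^ 2 + e)⁻¹ ≤ 1 / e := by
    rw [one_div]; exact inv_anti₀ he (by nlinarith [sq_nonneg ‖z‖])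
  have h2 : (‖z‖ ^ 2 + e)⁻¹ * ‖z‖ ^ 2 ≤ 1 := by
    rw [inv_mul_le_iff₀ (by positivity)]; linarith
  have h3 : 0 < (‖z‖ ^ 2 + e)⁻¹ := by positivity
  have h4 : 2 * (‖z‖ ^ 2 + e)⁻¹ ^ 2 * ‖z‖ ^ 2 ≤ 2 * (1 / e) := by
    calc 2 * (‖z‖ ^ 2 + e)⁻¹ ^ 2 * ‖z‖ ^ 2
        = 2 * ((‖z‖ ^ 2 + e)⁻¹ * ((‖z‖ ^ 2 + e)⁻¹ * ‖z‖ ^ 2)) := by ring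
      _ ≤ 2 * (1 / e * 1) := by gcongr
      _ = _ := by ring
  have h5 : (‖z‖ ^ 2 + e)⁻¹ * ‖ContinuousLinearMap.id ℝ R3‖ ≤ 1 / e * 1 := by
    gcongr; exact norm_id_le_one
  calc _ ≤ 1 / e * 1 + 2 * (1 / e) := add_le_add h5 h4
    _ = _ := by ring

theorem rpow_weight_bounds {t : ℝ} (ht : 0 < t) :
    t⁻¹ ≤ 1 + t ^ (-(5 / 2) : ℝ) ∧ (t ^ 2)⁻¹ ≤ 1 + t ^ (-(5 / 2) : ℝ) := by
  have h0 : 0 < t ^ (-(5 / 2) : ℝ) := by positivity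
  have e1 : t⁻¹ = t ^ (-1 : ℝ) := by rw [Real.rpow_neg ht.le, Real.rpow_one]
  have e2 : (t ^ 2)⁻¹ = t ^ (-2 : ℝ) := by
    rw [Real.rpow_neg ht.le, ← Real.rpow_natCast]; norm_num
  rcases le_total t 1 with h | h
  · rw [e1, e2]
    have a1 := Real.rpow_le_rpow_of_exponent_ge ht h (by norm_num : (-(5 / 2) : ℝ) ≤ -1)
    have a2 := Real.rpow_le_rpow_of_exponent_ge ht h (by norm_num : (-(5 / 2) : ℝ) ≤ -2)
    constructor <;> linarith
  · have a1 : t⁻¹ ≤ 1 := inv_le_one_of_one_le₀ h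
    have a2 : (t ^ 2)⁻¹ ≤ 1 := inv_le_one_of_one_le₀ (one_le_pow₀ h)
    constructor <;> linarith

theorem logKer_sub_le {d : ℝ} (hd : 0 < d) (hd1 : d ≤ 1) {z : R3} (hz : z ≠ 0) :
    ‖logKer (d ^ 4) z - logKer 0 z‖ ≤ 6 * d * (1 + ‖z‖ ^ (-(5 / 2) : ℝ)) := by
  have hz' : 0 < ‖z‖ := norm_pos_iff.2 hz
  have hq : 0 < 1 + (d ^ 2 / ‖z‖) ^ 2 := by positivity
  have h1 : logKer (d ^ 4) z - logKer 0 z = 1 / 2 * Real.log (1 + (d ^ 2 / ‖z‖) ^ 2) := by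
    rw [logKer, logKer, add_zero, ← mul_sub, ← Real.log_div (by positivity) (by positivity)]
    congr 2; field_simp
  have h2 : Real.log (1 + (d ^ 2 / ‖z‖) ^ 2) ≤ 2 * (d ^ 2 / ‖z‖) := by
    have h3 : 1 + (d ^ 2 / ‖z‖) ^ 2 ≤ (1 + d ^ 2 / ‖z‖) ^ 2 := by
      have : 0 ≤ d ^ 2 / ‖z‖ := by positivity
      nlinarith
    have h4 := Real.log_le_log hq h3
    rw [Real.log_pow] at h4
    have h5 := Real.log_le_sub_one_of_pos (by positivity : 0 < 1 + d ^ 2 / ‖z‖)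
    push_cast at h4; linarith
  rw [h1, Real.norm_of_nonneg (by
    have := Real.log_nonneg (by nlinarith [sq_nonneg (d ^ 2 / ‖z‖)] : 1 ≤ 1 + (d ^ 2 / ‖z‖) ^ 2)
    positivity)]
  have h6 := (rpow_weight_bounds hz').1
  have h7 : d ^ 2 / ‖z‖ ≤ d * (1 + ‖z‖ ^ (-(5 / 2) : ℝ)) := by
    rw [div_eq_mul_inv]; gcongr; nlinarith
  have : 0 ≤ d * (1 + ‖z‖ ^ (-(5 / 2) : ℝ)) := by positivity
  linarith

theorem inv_sub_inv_reg {d t : ℝ} (hd : 0 < d) (ht : 0 < t) :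
    0 ≤ (t ^ 2)⁻¹ - (t ^ 2 + d ^ 4)⁻¹ ∧
    t * ((t ^ 2)⁻¹ - (t ^ 2 + d ^ 4)⁻¹) ≤ d ^ 2 * (t ^ 2)⁻¹ ∧
    (t ^ 2)⁻¹ - (t ^ 2 + d ^ 4)⁻¹ ≤ d * t ^ (-(5 / 2) : ℝ) := by
  have e : (t ^ 2)⁻¹ - (t ^ 2 + d ^ 4)⁻¹ = d ^ 4 / (t ^ 2 * (t ^ 2 + d ^ 4)) := by field_simp; ring
  have k1 : d ^ 4 / (t ^ 2 + d ^ 4) ≤ 1 := by rw [div_le_one (by positivity)]; nlinarith [sq_nonneg t]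
  have k2 : d ^ 4 / (t ^ 2 + d ^ 4) ≤ d ^ 2 / t := by
    rw [div_le_div_iff₀ (by positivity) ht]
    nlinarith [mul_nonneg (sq_nonneg d) (sq_nonneg (t - d ^ 2)), mul_pos (pow_pos hd 4) ht]
  have e' : d ^ 4 / (t ^ 2 * (t ^ 2 + d ^ 4)) = (t ^ 2)⁻¹ * (d ^ 4 / (t ^ 2 + d ^ 4)) := by
    field_simp
  refine ⟨by rw [e]; positivity, ?_, ?_⟩
  · rw [e, e']
    calc t * ((t ^ 2)⁻¹ * (d ^ 4 / (t ^ 2 + d ^ 4))) ≤ t * ((t ^ 2)⁻¹ * (d ^ 2 / t)) := by gcongr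
      _ = _ := by field_simp
  · rw [e, e']
    -- `min (1, a) ≤ √a` with `a = d² / t`
    have k3 : d ^ 4 / (t ^ 2 + d ^ 4) ≤ d * t ^ (-(1 / 2) : ℝ) := by
      have h0 : 0 ≤ d ^ 4 / (t ^ 2 + d ^ 4) := by positivity
      refine le_of_sq_le_sq ?_ (by positivity)
      have : (d * t ^ (-(1 / 2) : ℝ)) ^ 2 = d ^ 2 / t := by
        rw [mul_pow, ← Real.rpow_natCast (t ^ (-(1 / 2) : ℝ)), ← Real.rpow_mul ht.le]
        norm_num [Real.rpow_neg ht.le]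
        rfl
      rw [this]
      nlinarith
    have : t ^ (-(5 / 2) : ℝ) = (t ^ 2)⁻¹ * t ^ (-(1 / 2) : ℝ) := by
      rw [← Real.rpow_natCast, ← Real.rpow_neg ht.le, ← Real.rpow_add ht]; norm_num
    rw [this]
    calc _ ≤ (t ^ 2)⁻¹ * (d * t ^ (-(1 / 2) : ℝ)) := by gcongr
      _ = _ := by ring

theorem gradKer_sub_le {d : ℝ} (hd : 0 < d) (hd1 : d ≤ 1) {z : R3} (hz : z ≠ 0) :
    ‖gradKer (d ^ 4) z - gradKer 0 z‖ ≤ 6 * d * (1 + ‖z‖ ^ (-(5 / 2) : ℝ)) := by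
  have hz' : 0 < ‖z‖ := norm_pos_iff.2 hz
  obtain ⟨h0, h1, -⟩ := inv_sub_inv_reg hd hz'
  have h6 := (rpow_weight_bounds hz').2
  rw [norm_sub_rev, gradKer, gradKer, ← sub_smul, norm_smul, add_zero,
    Real.norm_of_nonneg h0]
  have h7 : d ^ 2 * (‖z‖ ^ 2)⁻¹ ≤ d * (1 + ‖z‖ ^ (-(5 / 2) : ℝ)) := by gcongr; nlinarith
  have : 0 ≤ d * (1 + ‖z‖ ^ (-(5 / 2) : ℝ)) := by positivity
  linarith

theorem hessKer_sub_le {d : ℝ} (hd : 0 < d) {z : R3} (hz : z ≠ 0) :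
    ‖hessKer (d ^ 4) z - hessKer 0 z‖ ≤ 6 * d * (1 + ‖z‖ ^ (-(5 / 2) : ℝ)) := by
  have hz' : 0 < ‖z‖ := norm_pos_iff.2 hz
  obtain ⟨h0, -, h2⟩ := inv_sub_inv_reg hd hz'
  set a := (‖z‖ ^ 2)⁻¹
  set b := (‖z‖ ^ 2 + d ^ 4)⁻¹
  have ha : 0 < a := by positivity
  have hb : 0 < b := by positivity
  have e : hessKer (d ^ 4) z - hessKer 0 z =
      (2 * (a ^ 2 - b ^ 2)) • (innerSL ℝ z).smulRight z - (a - b) • ContinuousLinearMap.id ℝ R3 := by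
    simp only [hessKer, add_zero]
    module
  rw [e]
  refine (norm_sub_le _ _).trans ?_
  have hab : 0 ≤ a ^ 2 - b ^ 2 := by nlinarith
  rw [norm_smul, norm_smul, norm_smulRight_inner, Real.norm_of_nonneg (by positivity),
    Real.norm_of_nonneg h0]
  have h3 : (a - b) * ‖ContinuousLinearMap.id ℝ R3‖ ≤ (a - b) * 1 := by
    gcongr; exact norm_id_le_one
  have h4 : (a ^ 2 - b ^ 2) * ‖z‖ ^ 2 ≤ 2 * (a - b) := by
    have : a * ‖z‖ ^ 2 = 1 := inv_mul_cancel₀ (by positivity)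
    have h5 : a ^ 2 - b ^ 2 ≤ 2 * a * (a - b) := by nlinarith
    calc (a ^ 2 - b ^ 2) * ‖z‖ ^ 2 ≤ 2 * a * (a - b) * ‖z‖ ^ 2 := by gcongr
      _ = 2 * (a - b) * (a * ‖z‖ ^ 2) := by ring
      _ = _ := by rw [this, mul_one]
  have h5 : d * ‖z‖ ^ (-(5 / 2) : ℝ) ≤ d * (1 + ‖z‖ ^ (-(5 / 2) : ℝ)) := by
    gcongr; linarith
  linarith

/-- The logarithmic potential `∫ log (|y| / |x - y|) f(y) dy`. -/
def logPot (f : R3 → ℝ) (x : R3) : ℝ := ∫ y, Real.log (‖y‖ / ‖x - y‖) * f y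

theorem ae_ne (x : R3) : ∀ᵐ y : R3, y ≠ x :=
  measure_eq_zero_iff_ae_notMem.1 (measure_singleton x)

theorem abs_log_div_le {x y : R3} (hy : y ≠ 0) (hxy : y ≠ x) :
    |Real.log (‖y‖ / ‖x - y‖)| ≤ ‖x‖ * ‖y‖⁻¹ + ‖x‖ * ‖x - y‖⁻¹ := by
  have h1 : 0 < ‖y‖ := norm_pos_iff.2 hy
  have h2 : 0 < ‖x - y‖ := norm_pos_iff.2 (sub_ne_zero.2 hxy.symm)
  have key : ∀ a b : ℝ, 0 < a → 0 < b → a ≤ b + ‖x‖ → Real.log (a / b) ≤ ‖x‖ * b⁻¹ := by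
    intro a b ha hb hab
    have := Real.log_le_sub_one_of_pos (div_pos ha hb)
    have h3 : a / b ≤ 1 + ‖x‖ * b⁻¹ := by
      rw [div_le_iff₀ hb, add_mul, mul_assoc, inv_mul_cancel₀ hb.ne']; linarith
    linarith
  have k1 := key ‖y‖ ‖x - y‖ h1 h2 (by
    have := norm_sub_le x (x - y); rw [sub_sub_cancel] at this; linarith)
  have k2 := key ‖x - y‖ ‖y‖ h2 h1 (by have := norm_sub_le x y; linarith)
  have p1 : 0 ≤ ‖x‖ * ‖y‖⁻¹ := by positivity
  have p2 : 0 ≤ ‖x‖ * ‖x - y‖⁻¹ := by positivity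
  rw [abs_le]
  refine ⟨?_, by linarith⟩
  rw [← inv_div, Real.log_inv]
  linarith

section Potential

variable {f : R3 → ℝ} (hf : Continuous f) (hfi : Integrable f) (hf0 : ∀ y, 0 ≤ f y)
include hf hfi hf0

theorem integrable_inv_norm_mul (x : R3) : Integrable fun y => ‖x - y‖⁻¹ * f y := by
  obtain ⟨S, hS⟩ := exists_bound_on_ball hf (‖x‖ + 1)
  have := (rieszPotential_bound (s := 1) (by norm_num) (by norm_num) hfi hf0 (hS x (by simp))).1
  simpa [Real.rpow_neg_one] using this

theorem integrable_log_mul (x : R3) : Integrable fun y => Real.log (‖y‖ / ‖x - y‖) * f y := by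
  have h1 := (integrable_inv_norm_mul hf hfi hf0 0).const_mul ‖x‖
  have h2 := (integrable_inv_norm_mul hf hfi hf0 x).const_mul ‖x‖
  refine (h1.add h2).mono' ?_ ?_
  · refine AEStronglyMeasurable.mul ?_ hfi.1
    exact (Real.measurable_log.comp (measurable_norm.div
      (measurable_norm.comp (measurable_const.sub measurable_id)))).aestronglyMeasurable
  · filter_upwards [ae_ne 0, ae_ne x] with y hy hxy
    rw [norm_mul, Real.norm_eq_abs, Real.norm_of_nonneg (hf0 y)]
    have := mul_le_mul_of_nonneg_right (abs_log_div_le hy hxy) (hf0 y)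
    simp only [Pi.add_apply, zero_sub, norm_neg]
    linarith

omit hf hfi hf0 in
theorem log_mul_ae_eq (x : R3) : (fun y => Real.log (‖y‖ / ‖x - y‖) * f y) =ᵐ[volume]
    fun y => -(f y • (logKer 0 (x - y) - Real.log ‖y‖)) := by
  filter_upwards [ae_ne 0, ae_ne x] with y hy hxy
  rw [Real.log_div (norm_ne_zero_iff.2 hy) (norm_ne_zero_iff.2 (sub_ne_zero.2 hxy.symm)),
    logKer_zero, smul_eq_mul]
  ring

theorem integrable_smul_gradKer (x : R3) : Integrable fun y => f y • gradKer 0 (x - y) := by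
  refine (integrable_inv_norm_mul hf hfi hf0 x).mono' ?_ ?_
  · refine hfi.1.smul ?_
    have : Measurable (gradKer 0) :=
      ((measurable_norm.pow_const 2).add_const 0).inv.smul measurable_id
    exact (this.comp (measurable_const.sub measurable_id)).aestronglyMeasurable
  · filter_upwards [ae_ne x] with y hy
    have : 0 < ‖x - y‖ := norm_pos_iff.2 (sub_ne_zero.2 hy.symm)
    rw [norm_smul, norm_gradKer, Real.norm_of_nonneg (hf0 y), add_zero, abs_of_pos (by positivity)]
    refine le_of_eq ?_
    field_simp

theorem hasFDerivAt_logPot (x : R3) :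
    HasFDerivAt (logPot f) (-innerSL ℝ (∫ y, f y • gradKer 0 (x - y))) x := by
  have hd : ∀ n : ℕ, 0 < 1 / ((n : ℝ) + 1) := fun n => by positivity
  have hd1 : ∀ n : ℕ, 1 / ((n : ℝ) + 1) ≤ 1 := fun n => by
    rw [div_le_one (by positivity)]; linarith [n.cast_nonneg (α := ℝ)]
  have := hasFDerivAt_potential hf hfi hf0 (C := 6) (k := logKer 0)
    (k' := fun z => innerSL ℝ (gradKer 0 z)) (g := fun y => Real.log ‖y‖)
    (K := fun n => logKer ((1 / ((n : ℝ) + 1)) ^ 4))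
    (K' := fun n z => innerSL ℝ (gradKer ((1 / ((n : ℝ) + 1)) ^ 4) z))
    (fun n z => hasFDerivAt_logKer (by positivity) z)
    (fun n => (innerSL ℝ).continuous.comp (continuous_gradKer (by positivity)))
    (fun n => ⟨_, fun z => (innerSL_apply_norm (𝕜 := ℝ) _).le.trans
      (norm_gradKer_le (by positivity) z)⟩)
    (fun n z hz => logKer_sub_le (hd n) (hd1 n) hz)
    (fun n z hz => by
      rw [← map_sub, innerSL_apply_norm]
      exact gradKer_sub_le (hd n) (hd1 n) hz)
    (fun x => by
      have := ((integrable_log_mul hf hfi hf0 x).congr (log_mul_ae_eq x)).neg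
      simpa using this)
  have e : logPot f = fun x => -∫ y, f y • (logKer 0 (x - y) - Real.log ‖y‖) := by
    ext x
    rw [logPot, integral_congr_ae (log_mul_ae_eq x), integral_neg]
  rw [e]
  refine (this.2.1 x).neg.congr_fderiv ?_
  rw [← ContinuousLinearMap.integral_comp_comm _ (integrable_smul_gradKer hf hfi hf0 x)]
  simp

theorem hasFDerivAt_gradPot :
    (∀ x, Integrable fun y => f y • hessKer 0 (x - y)) ∧
    (∀ x, HasFDerivAt (fun x => ∫ y, f y • gradKer 0 (x - y)) (∫ y, f y • hessKer 0 (x - y)) x) ∧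
    Continuous fun x => ∫ y, f y • hessKer 0 (x - y) := by
  have hd : ∀ n : ℕ, 0 < 1 / ((n : ℝ) + 1) := fun n => by positivity
  have hd1 : ∀ n : ℕ, 1 / ((n : ℝ) + 1) ≤ 1 := fun n => by
    rw [div_le_one (by positivity)]; linarith [n.cast_nonneg (α := ℝ)]
  have := hasFDerivAt_potential hf hfi hf0 (C := 6) (k := gradKer 0) (k' := hessKer 0)
    (g := fun y => 0)
    (K := fun n => gradKer ((1 / ((n : ℝ) + 1)) ^ 4))
    (K' := fun n => hessKer ((1 / ((n : ℝ) + 1)) ^ 4))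
    (fun n z => hasFDerivAt_gradKer (by positivity) z)
    (fun n => continuous_hessKer (by positivity))
    (fun n => ⟨_, norm_hessKer_le (by positivity)⟩)
    (fun n z hz => gradKer_sub_le (hd n) (hd1 n) hz)
    (fun n z hz => hessKer_sub_le (hd n) hz)
    (fun x => by simpa using integrable_smul_gradKer hf hfi hf0 x)
  simpa using this

theorem contDiff_logPot : ContDiff ℝ 2 (logPot f) := by
  obtain ⟨-, h2, h3⟩ := hasFDerivAt_gradPot hf hfi hf0
  rw [show (2 : WithTop ℕ∞) = ((1 : ℕ) : WithTop ℕ∞) + 1 from by norm_num,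
    contDiff_succ_iff_hasFDerivAt]
  refine ⟨_, ?_, hasFDerivAt_logPot hf hfi hf0⟩
  refine ((innerSL ℝ).contDiff.comp ?_).neg
  rw [show ((1 : ℕ) : WithTop ℕ∞) = ((0 : ℕ) : WithTop ℕ∞) + 1 from by norm_num,
    contDiff_succ_iff_hasFDerivAt]
  exact ⟨_, by simpa using (contDiff_zero (𝕜 := ℝ)).2 h3, h2⟩

end Potential

theorem laplacian_eq_sum {g : R3 → ℝ} {G : R3 → R3} {G' : R3 →L[ℝ] R3} {x : R3}
    (h : ∀ z, HasFDerivAt g (innerSL ℝ (G z)) z) (h' : HasFDerivAt G G' x) :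
    Δ g x = ∑ i, G' (EuclideanSpace.single i 1) i := by
  rw [InnerProductSpace.laplacian_eq_iteratedFDeriv_orthonormalBasis g
    (EuclideanSpace.basisFun (Fin 3) ℝ)]
  have e : fderiv ℝ g = fun z => innerSL ℝ (G z) := funext fun z => (h z).fderiv
  have h2 := ((innerSL ℝ : R3 →L[ℝ] R3 →L[ℝ] ℝ).hasFDerivAt.comp x h')
  have h3 : fderiv ℝ (fun z => innerSL ℝ (G z)) x = _ := h2.fderiv
  refine Finset.sum_congr rfl fun i _ => ?_
  rw [iteratedFDeriv_two_apply, e, h3]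
  simp only [Matrix.cons_val_zero, Matrix.cons_val_one, EuclideanSpace.basisFun_apply]
  change inner ℝ (G' (EuclideanSpace.single i 1)) (EuclideanSpace.single i (1 : ℝ)) = _
  simp [EuclideanSpace.inner_single_right]

/-- The potential `∫ f(y) / |x - y|² dy`, a multiple of the Riesz potential of order one. -/
def rieszPot (f : R3 → ℝ) (x : R3) : ℝ := ∫ y, (‖x - y‖ ^ 2)⁻¹ * f y

theorem sum_hessKer {z : R3} (hz : z ≠ 0) :
    ∑ i, hessKer 0 z (EuclideanSpace.single i 1) i = (‖z‖ ^ 2)⁻¹ := by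
  have hz' : 0 < ‖z‖ := norm_pos_iff.2 hz
  have h : ‖z‖ ^ 2 = z 0 ^ 2 + z 1 ^ 2 + z 2 ^ 2 := by
    rw [EuclideanSpace.norm_sq_eq, Fin.sum_univ_three]; simp
  have hne : ‖z‖ ^ 2 ≠ 0 := by positivity
  simp only [hessKer, Fin.sum_univ_three, add_zero]
  simp [EuclideanSpace.inner_single_right]
  field_simp
  linear_combination (2 : ℝ) * h

theorem laplacian_logPot {f : R3 → ℝ} (hf : Continuous f) (hfi : Integrable f)
    (hf0 : ∀ y, 0 ≤ f y) (x : R3) : Δ (logPot f) x = -rieszPot f x := by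
  obtain ⟨h0, h2, -⟩ := hasFDerivAt_gradPot hf hfi hf0
  rw [laplacian_eq_sum (fun z => by simpa using hasFDerivAt_logPot hf hfi hf0 z) (h2 x).neg]
  have e : ∀ (a : R3) (i : Fin 3), (-∫ y, f y • hessKer 0 (x - y)) a i =
      -∫ y, f y * hessKer 0 (x - y) a i := by
    intro a i
    rw [neg_apply, ContinuousLinearMap.integral_apply (h0 x), PiLp.neg_apply]
    congr 1
    have := (EuclideanSpace.proj (𝕜 := ℝ) i).integral_comp_comm
      ((h0 x).apply_continuousLinearMap a)
    simpa using this.symm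
  simp_rw [e]
  rw [Finset.sum_neg_distrib, ← integral_finsetSum]
  · rw [rieszPot]
    congr 1
    refine integral_congr_ae ?_
    filter_upwards [ae_ne x] with y hy
    rw [← Finset.mul_sum, sum_hessKer (sub_ne_zero.2 hy.symm), mul_comm]
  · intro i _
    simpa using (EuclideanSpace.proj (𝕜 := ℝ) i).integrable_comp
      ((h0 x).apply_continuousLinearMap (EuclideanSpace.single i 1))

/-! ### The Fourier transform of the Riesz kernel -/

/-- Pairing with a weight `m = ∫₀^∞ k b db` that is a superposition of nonnegative kernels `k b`: by
Fubini the pairings with the kernels superpose in the same way. -/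
theorem integrable_weight_mul_swap {k : ℝ → R3 → ℝ} {m : R3 → ℝ} {G : R3 → ℂ}
    (hk : Measurable (Function.uncurry k)) (hk0 : ∀ b x, 0 < b → 0 ≤ k b x)
    (hki : ∀ᵐ x, IntegrableOn (fun b => k b x) (Ioi 0))
    (hkm : ∀ᵐ x, ∫ b in Ioi 0, k b x = m x)
    (hG : AEStronglyMeasurable G) (hm : Integrable fun x => m x * ‖G x‖) :
    ∫ b in Ioi 0, ∫ x, (k b x : ℂ) * G x = ∫ x, (m x : ℂ) * G x := by
  have hi : Integrable (Function.uncurry fun (b : ℝ) (x : R3) => (k b x : ℂ) * G x)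
      ((volume.restrict (Ioi 0)).prod volume) := by
    rw [integrable_prod_iff']
    · constructor
      · filter_upwards [hki] with x hx
        exact (hx.ofReal (𝕜 := ℂ)).mul_const (G x)
      · refine hm.congr ?_
        filter_upwards [hkm] with x hx
        rw [← hx, ← integral_mul_const]
        refine setIntegral_congr_fun measurableSet_Ioi fun b hb => ?_
        simp [abs_of_nonneg (hk0 b x hb)]
    · exact (Complex.measurable_ofReal.comp hk).aestronglyMeasurable.mul
        (hG.comp_snd)
  rw [integral_integral_swap hi]
  refine integral_congr_ae ?_
  filter_upwards [hkm] with x hx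
  rw [integral_mul_const, integral_complex_ofReal, hx]

/-- `1 / r`, with `r = |ξ|`, as a superposition of the Gaussians `exp (-b r²)`. -/
theorem integral_rpow_neg_half_mul_exp {r : ℝ} (hr : 0 < r) :
    IntegrableOn (fun b : ℝ => b ^ (-(1 / 2) : ℝ) * Real.exp (-(r ^ 2 * b))) (Ioi 0) ∧
    ∫ b in Ioi 0, b ^ (-(1 / 2) : ℝ) * Real.exp (-(r ^ 2 * b)) = √Real.pi * r⁻¹ := by
  have h2 : 0 < r ^ 2 := by positivity
  have e := Real.integral_rpow_mul_exp_neg_mul_Ioi (a := 1 / 2) (by norm_num) h2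
  have : ((1 : ℝ) / 2 - 1) = -(1 / 2) := by norm_num
  have e4 : (1 / r ^ 2) ^ (1 / 2 : ℝ) = r⁻¹ := by
    rw [← Real.sqrt_eq_rpow, one_div, Real.sqrt_inv, Real.sqrt_sq hr.le]
  rw [this, Real.Gamma_one_half_eq, e4] at e
  refine ⟨?_, by rw [e, mul_comm]⟩
  by_contra h
  rw [integral_undef h] at e
  exact (mul_pos (inv_pos.2 hr) (Real.sqrt_pos.2 Real.pi_pos)).ne e

/-- `1 / a`, with `a = π²|x|²`, as a superposition of the Gaussians `exp (-a / b)`, the Fourier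
transforms of the Gaussians in `integral_rpow_neg_half_mul_exp` up to the factor `(π / b)^{3/2}`. -/
theorem integral_rpow_neg_two_mul_exp {a : ℝ} (ha : 0 < a) :
    IntegrableOn (fun b : ℝ => b ^ (-2 : ℝ) * Real.exp (-a * b ^ (-1 : ℝ))) (Ioi 0) ∧
    ∫ b in Ioi 0, b ^ (-2 : ℝ) * Real.exp (-a * b ^ (-1 : ℝ)) = a⁻¹ := by
  constructor
  · have := (integrableOn_Ioi_comp_rpow_iff' (fun t => Real.exp (-a * t))
      (p := -1) (by norm_num)).2 (integrableOn_exp_mul_Ioi (by linarith) 0)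
    norm_num at this ⊢
    exact this
  · have := integral_comp_rpow_Ioi (fun t => Real.exp (-a * t)) (p := -1) (by norm_num)
    rw [integral_exp_mul_Ioi (by linarith)] at this
    norm_num at this ⊢
    exact this

theorem integrable_norm_inv_mul {s : ℝ} (hs0 : 0 ≤ s) (hs : s < 3) (y : R3) {G : R3 → ℂ}
    (hG : Integrable G) {B : ℝ} (hB : ∀ x, ‖G x‖ ≤ B) :
    Integrable fun x => ‖y - x‖ ^ (-s) * ‖G x‖ :=
  (rieszPotential_bound hs0 hs hG.norm (fun _ => norm_nonneg _) (x := y) (S := B)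
    fun _ _ => hB _).1

/-- The Fourier transform of `|x|^{-2}` on `ℝ³` is `π / |ξ|`, in the form of a duality with
translates of the inverse transform of a Schwartz function. -/
theorem integral_riesz_fourierInv (g : 𝓢(R3, ℂ)) (y : R3) :
    ∫ x, (((‖y - x‖ ^ 2)⁻¹ : ℝ) : ℂ) * 𝓕⁻ (g : R3 → ℂ) x =
      Real.pi * 𝓕⁻ (fun ξ => ((‖ξ‖⁻¹ : ℝ) : ℂ) * g ξ) y := by
  set ψ : 𝓢(R3, ℂ) := 𝓕⁻ g with hψ
  have hψc : 𝓕⁻ (g : R3 → ℂ) = ψ := (SchwartzMap.fourierInv_coe g).symm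
  have hψg : 𝓕 (ψ : R3 → ℂ) = g := by
    rw [← SchwartzMap.fourier_coe, hψ, FourierTransform.fourier_fourierInv_eq]
  obtain ⟨B, -, hB⟩ := ψ.decay 0 0
  obtain ⟨B', -, hB'⟩ := g.decay 0 0
  simp only [pow_zero, one_mul, norm_iteratedFDeriv_zero] at hB hB'
  set ph : R3 → ℂ := fun ξ => Complex.exp (2 * Real.pi * Complex.I * ((inner ℝ y ξ : ℝ) : ℂ))
  have hph : ∀ ξ, ‖ph ξ‖ = 1 := by
    intro ξ
    have : ph ξ = Complex.exp (((2 * Real.pi * inner ℝ y ξ : ℝ) : ℂ) * Complex.I) := by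
      simp only [ph]; congr 1; push_cast; ring
    rw [this, Complex.norm_exp_ofReal_mul_I]
  have hphc : Continuous ph := by
    simp only [ph]
    fun_prop
  have hG : Integrable fun ξ => ph ξ * g ξ := by
    refine g.integrable.norm.mono' (hphc.mul g.continuous).aestronglyMeasurable
      (Eventually.of_forall fun ξ => ?_)
    rw [norm_mul, hph, one_mul]
  have hne : ∀ᵐ x : R3, x ≠ y := ae_ne y
  -- the two superpositions of Gaussians
  have h1 := integrable_weight_mul_swap (G := fun ξ => ph ξ * g ξ)
    (k := fun b ξ => b ^ (-(1 / 2) : ℝ) * Real.exp (-(‖ξ‖ ^ 2 * b)))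
    (m := fun ξ => √Real.pi * ‖ξ‖⁻¹) (by fun_prop) (fun b x hb => by positivity)
    ((ae_ne 0).mono fun ξ hξ => (integral_rpow_neg_half_mul_exp (norm_pos_iff.2 hξ)).1)
    ((ae_ne 0).mono fun ξ hξ => (integral_rpow_neg_half_mul_exp (norm_pos_iff.2 hξ)).2)
    hG.1 (by
      have := (integrable_norm_inv_mul (s := 1) (by norm_num) (by norm_num) 0 hG
        (B := B') (fun x => by rw [norm_mul, hph, one_mul]; exact hB' x)).const_mul (√Real.pi)
      simpa [Real.rpow_neg_one, mul_assoc] using this)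
  have h2 := integrable_weight_mul_swap (G := ψ)
    (k := fun b x => Real.pi ^ (3 / 2 : ℝ) * (b ^ (-2 : ℝ) *
      Real.exp (-(Real.pi ^ 2 * ‖y - x‖ ^ 2) * b ^ (-1 : ℝ))))
    (m := fun x => Real.pi ^ (3 / 2 : ℝ) * (Real.pi ^ 2 * ‖y - x‖ ^ 2)⁻¹)
    (by fun_prop) (fun b x hb => by positivity)
    (hne.mono fun x hx => by
      have : 0 < ‖y - x‖ := norm_pos_iff.2 (sub_ne_zero.2 hx.symm)
      exact (integral_rpow_neg_two_mul_exp (by positivity)).1.const_mul _)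
    (hne.mono fun x hx => by
      have : 0 < ‖y - x‖ := norm_pos_iff.2 (sub_ne_zero.2 hx.symm)
      rw [integral_const_mul, (integral_rpow_neg_two_mul_exp (by positivity)).2])
    ψ.integrable.1 (by
      have := (integrable_norm_inv_mul (s := 2) (by norm_num) (by norm_num) y ψ.integrable
        hB).const_mul (Real.pi ^ (3 / 2 : ℝ) * (Real.pi ^ 2)⁻¹)
      refine this.congr (Eventually.of_forall fun x => ?_)
      simp only [Real.rpow_neg (norm_nonneg _), mul_inv, Real.rpow_two]
      ring)
  -- Parseval's identity for each Gaussian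
  have h3 : ∀ b ∈ Ioi (0 : ℝ),
      ∫ x, ((Real.pi ^ (3 / 2 : ℝ) * (b ^ (-2 : ℝ) *
        Real.exp (-(Real.pi ^ 2 * ‖y - x‖ ^ 2) * b ^ (-1 : ℝ))) : ℝ) : ℂ) * ψ x =
      ∫ ξ, ((b ^ (-(1 / 2) : ℝ) * Real.exp (-(‖ξ‖ ^ 2 * b)) : ℝ) : ℂ) * (ph ξ * g ξ) := by
    intro b hb
    rw [mem_Ioi] at hb
    have hb' : 0 < (b : ℂ).re := by simpa using hb
    have hE : Integrable fun v : R3 =>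
        Complex.exp (-(b : ℂ) * (‖v‖ : ℂ) ^ 2 + 2 * Real.pi * Complex.I * ((inner ℝ y v : ℝ) : ℂ)) :=
      GaussianFourier.integrable_cexp_neg_mul_sq_norm_add hb' _ _
    have hP := VectorFourier.integral_fourierIntegral_smul_eq_flip (μ := (volume : Measure R3))
      (ν := (volume : Measure R3)) (e := Real.fourierChar) (L := innerₗ R3)
      Real.continuous_fourierChar continuous_inner hE ψ.integrable
    rw [flip_innerₗ] at hP
    change ∫ ξ, 𝓕 (fun v : R3 => Complex.exp (-(b : ℂ) * (‖v‖ : ℂ) ^ 2 +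
      2 * Real.pi * Complex.I * ((inner ℝ y v : ℝ) : ℂ))) ξ • ψ ξ =
      ∫ x, _ • 𝓕 (ψ : R3 → ℂ) x at hP
    rw [hψg] at hP
    have hc : ((b ^ (-(1 / 2) : ℝ) : ℝ) : ℂ) ≠ 0 := by
      exact_mod_cast (Real.rpow_pos_of_pos hb _).ne'
    rw [← mul_right_inj' (inv_ne_zero hc), ← integral_const_mul, ← integral_const_mul]
    convert hP using 1
    · refine integral_congr_ae (Eventually.of_forall fun x => ?_)
      simp only [smul_eq_mul]
      rw [fourier_gaussian_innerProductSpace' hb']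
      have e1 : ((Real.pi : ℂ) / b) ^ (Module.finrank ℝ R3 / 2 : ℂ) =
          (((Real.pi / b) ^ (3 / 2 : ℝ) : ℝ) : ℂ) := by
        rw [Complex.ofReal_cpow (by positivity)]
        simp
      have e2 : Complex.exp (-(Real.pi : ℂ) ^ 2 * ‖y - x‖ ^ 2 / b) =
          ((Real.exp (-(Real.pi ^ 2 * ‖y - x‖ ^ 2) * b ^ (-1 : ℝ)) : ℝ) : ℂ) := by
        rw [Complex.ofReal_exp, Real.rpow_neg_one]
        congr 1; push_cast; rw [div_eq_mul_inv]; ring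
      rw [e1, e2, ← mul_assoc]
      congr 1
      rw [← Complex.ofReal_inv, ← Complex.ofReal_mul, ← Complex.ofReal_mul]
      congr 1
      rw [← Real.rpow_neg hb.le, neg_neg, Real.div_rpow Real.pi_pos.le hb.le,
        div_eq_mul_inv (Real.pi ^ (3 / 2 : ℝ)), ← Real.rpow_neg hb.le]
      have e3 : b ^ (-(3 / 2) : ℝ) = b ^ (1 / 2 : ℝ) * b ^ (-2 : ℝ) := by
        rw [← Real.rpow_add hb]; norm_num
      rw [e3]; ring
    · refine integral_congr_ae (Eventually.of_forall fun ξ => ?_)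
      simp only [smul_eq_mul]
      rw [Complex.exp_add]
      push_cast
      rw [show (-(b : ℂ) * (‖ξ‖ : ℂ) ^ 2) = -((‖ξ‖ : ℂ) ^ 2 * b) by ring]
      field_simp
      exact mul_comm _ _
  rw [setIntegral_congr_fun measurableSet_Ioi h3, h1] at h2
  have h4 : 𝓕⁻ (fun ξ => ((‖ξ‖⁻¹ : ℝ) : ℂ) * g ξ) y = ∫ ξ, ((‖ξ‖⁻¹ : ℝ) : ℂ) * (ph ξ * g ξ) := by
    rw [Real.fourierInv_eq']
    refine integral_congr_ae (Eventually.of_forall fun ξ => ?_)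
    simp only [smul_eq_mul, ph]
    rw [real_inner_comm]
    push_cast
    ring_nf
  have hpi : (Real.pi : ℂ) ^ 2 * (√Real.pi : ℂ) = ((Real.pi ^ (3 / 2 : ℝ) : ℝ) : ℂ) * Real.pi := by
    have : Real.pi ^ (3 / 2 : ℝ) = Real.pi * √Real.pi := by
      rw [Real.sqrt_eq_rpow, ← Real.rpow_one_add' Real.pi_pos.le (by norm_num)]; norm_num
    rw [this]; push_cast; ring
  have hp0 : ((Real.pi ^ (3 / 2 : ℝ) : ℝ) : ℂ) ≠ 0 := by
    exact_mod_cast (Real.rpow_pos_of_pos Real.pi_pos _).ne'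
  have hp1 : (Real.pi : ℂ) ≠ 0 := by exact_mod_cast Real.pi_ne_zero
  rw [hψc, h4]
  have l : ∀ ξ, ((√Real.pi * ‖ξ‖⁻¹ : ℝ) : ℂ) * (ph ξ * g ξ) =
      (√Real.pi : ℂ) * (((‖ξ‖⁻¹ : ℝ) : ℂ) * (ph ξ * g ξ)) := by intro ξ; push_cast; ring
  have r : ∀ x, ((Real.pi ^ (3 / 2 : ℝ) * (Real.pi ^ 2 * ‖y - x‖ ^ 2)⁻¹ : ℝ) : ℂ) * ψ x =
      (((Real.pi ^ (3 / 2 : ℝ) : ℝ) : ℂ) * ((Real.pi : ℂ) ^ 2)⁻¹) *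
        ((((‖y - x‖ ^ 2)⁻¹ : ℝ) : ℂ) * ψ x) := by
    intro x; push_cast; rw [mul_inv]; ring
  simp_rw [l, r] at h2
  rw [integral_const_mul, integral_const_mul] at h2
  refine mul_left_cancel₀ hp0 ?_
  rw [← mul_assoc, ← hpi, mul_assoc, h2]
  field_simp

/-! ### The equation in terms of the Riesz potential -/

/-- The Riesz potential is symmetric: it may be moved from the density `f` to the test function. -/
theorem rieszPot_mul_integral {f : R3 → ℝ} (hfi : Integrable f)
    (hf0 : ∀ y, 0 ≤ f y) {ψ : R3 → ℂ} (hψ : Integrable ψ) {B : ℝ} (hB : ∀ x, ‖ψ x‖ ≤ B) :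
    Integrable (fun x => (rieszPot f x : ℂ) * ψ x) ∧
    ∫ x, (rieszPot f x : ℂ) * ψ x =
      ∫ y, (f y : ℂ) * ∫ x, (((‖y - x‖ ^ 2)⁻¹ : ℝ) : ℂ) * ψ x := by
  have hb := fun y : R3 => rieszPotential_bound (s := 2) (by norm_num) (by norm_num) hψ.norm
    (fun _ => norm_nonneg _) (x := y) (S := B) fun z _ => hB z
  simp only [Real.rpow_neg (norm_nonneg _), Real.rpow_two] at hb
  have hm : AEStronglyMeasurable (Function.uncurry fun (y x : R3) =>
      (f y : ℂ) * ((((‖y - x‖ ^ 2)⁻¹ : ℝ) : ℂ) * ψ x)) (volume.prod volume) := by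
    refine (Complex.continuous_ofReal.comp_aestronglyMeasurable hfi.1.comp_fst).mul
      (AEStronglyMeasurable.mul ?_ hψ.1.comp_snd)
    exact (by fun_prop : Measurable fun p : R3 × R3 => (((‖p.1 - p.2‖ ^ 2)⁻¹ : ℝ) : ℂ)).aestronglyMeasurable
  have hn : ∀ y x : R3, ‖(((‖y - x‖ ^ 2)⁻¹ : ℝ) : ℂ) * ψ x‖ = (‖y - x‖ ^ 2)⁻¹ * ‖ψ x‖ := by
    intro y x
    rw [norm_mul, Complex.norm_real, Real.norm_of_nonneg (by positivity)]
  have hn' : ∀ y : R3, ∫ x, ‖(f y : ℂ) * ((((‖y - x‖ ^ 2)⁻¹ : ℝ) : ℂ) * ψ x)‖ =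
      f y * ∫ x, (‖y - x‖ ^ 2)⁻¹ * ‖ψ x‖ := by
    intro y
    simp_rw [norm_mul (f y : ℂ), hn, Complex.norm_real, Real.norm_of_nonneg (hf0 y)]
    rw [integral_const_mul]
  have hi : Integrable (Function.uncurry fun (y x : R3) =>
      (f y : ℂ) * ((((‖y - x‖ ^ 2)⁻¹ : ℝ) : ℂ) * ψ x)) (volume.prod volume) := by
    rw [integrable_prod_iff hm]
    refine ⟨Eventually.of_forall fun y => ?_, ?_⟩
    · have : Integrable fun x => (((‖y - x‖ ^ 2)⁻¹ : ℝ) : ℂ) * ψ x :=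
        (hb y).1.mono' ((by fun_prop : Measurable fun x : R3 =>
          (((‖y - x‖ ^ 2)⁻¹ : ℝ) : ℂ)).aestronglyMeasurable.mul hψ.1)
          (Eventually.of_forall fun x => (hn y x).le)
      exact this.const_mul (f y : ℂ)
    · refine (hfi.mul_const (B * poleMass 2 + ∫ x, ‖ψ x‖)).mono' ?_ (Eventually.of_forall fun y => ?_)
      · exact hm.norm.integral_prod_right'
      · simp only [Function.uncurry]
        rw [hn', norm_mul, Real.norm_of_nonneg (hf0 y), Real.norm_of_nonneg
          (integral_nonneg fun x => by positivity)]
        exact mul_le_mul_of_nonneg_left (hb y).2 (hf0 y)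
  have hr : ∀ x, ∫ y, (f y : ℂ) * ((((‖y - x‖ ^ 2)⁻¹ : ℝ) : ℂ) * ψ x) = (rieszPot f x : ℂ) * ψ x := by
    intro x
    rw [rieszPot, ← integral_complex_ofReal, ← integral_mul_const]
    refine integral_congr_ae (Eventually.of_forall fun y => ?_)
    simp only [norm_sub_rev x y]
    push_cast; ring
  constructor
  · refine hi.integral_prod_right.congr (Eventually.of_forall fun x => ?_)
    exact hr x
  · have := integral_integral_swap hi
    simp_rw [hr, integral_const_mul] at this
    exact this.symm

theorem continuous_laplacian {g : R3 → ℝ} (hg : ContDiff ℝ 2 g) : Continuous (Δ g) := by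
  rw [InnerProductSpace.laplacian_eq_iteratedFDeriv_orthonormalBasis g
    (EuclideanSpace.basisFun (Fin 3) ℝ)]
  refine continuous_finsetSum _ fun i _ => ?_
  have := hg.continuous_iteratedFDeriv (m := 2) le_rfl
  fun_prop

theorem continuous_rieszPot {f : R3 → ℝ} (hf : Continuous f) (hfi : Integrable f)
    (hf0 : ∀ y, 0 ≤ f y) : Continuous (rieszPot f) := by
  have h := (continuous_laplacian (contDiff_logPot hf hfi hf0)).neg
  have e : -Δ (logPot f) = rieszPot f := by
    ext x; rw [Pi.neg_apply, laplacian_logPot hf hfi hf0, neg_neg]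
  rwa [e] at h

/-- A smooth compactly supported symbol `g` that vanishes near the origin has `𝓕⁻ g` in the range
of `(-Δ)^{1/2}` on Schwartz functions. -/
theorem exists_halfLaplacian_eq {g : R3 → ℂ} (hg : ContDiff ℝ ∞ g) (hc : HasCompactSupport g)
    (h0 : ∀ᶠ ξ in 𝓝 0, g ξ = 0) :
    ∃ φ : 𝓢(R3, ℂ), halfLaplacian φ = 𝓕⁻ g ∧
      ∀ y, (φ y : ℂ) = (2 * Real.pi : ℂ)⁻¹ * 𝓕⁻ (fun ξ => ((‖ξ‖⁻¹ : ℝ) : ℂ) * g ξ) y := by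
  -- the symbol `|2πξ|⁻¹ g(ξ)` of the preimage is smooth, since `g` vanishes near the origin
  set h : R3 → ℂ := fun ξ => (((2 * Real.pi * ‖ξ‖)⁻¹ : ℝ) : ℂ) * g ξ with hh
  have hhs : ContDiff ℝ ∞ h := by
    rw [contDiff_iff_contDiffAt]
    intro ξ
    rcases eq_or_ne ξ 0 with rfl | hξ
    · refine (contDiffAt_const (c := (0 : ℂ))).congr_of_eventuallyEq ?_
      filter_upwards [h0] with ξ hξ
      simp [hh, hξ]
    · refine ContDiffAt.mul ?_ hg.contDiffAt
      refine Complex.ofRealCLM.contDiff.contDiffAt.comp ξ (ContDiffAt.inv ?_ ?_)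
      · exact contDiffAt_const.mul (contDiffAt_norm ℝ hξ)
      · have := norm_pos_iff.2 hξ
        positivity
  have hhc : HasCompactSupport h := hc.mul_left
  set hS : 𝓢(R3, ℂ) := hhc.toSchwartzMap hhs
  refine ⟨𝓕⁻ hS, ?_, fun y => ?_⟩
  · rw [halfLaplacian, ← SchwartzMap.fourier_coe, FourierTransform.fourier_fourierInv_eq]
    congr 1
    ext ξ
    change _ * h ξ = _
    rcases eq_or_ne ξ 0 with rfl | hξ
    · simp [h0.self_of_nhds]
    · have : (‖ξ‖ : ℂ) ≠ 0 := by exact_mod_cast norm_ne_zero_iff.2 hξ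
      have hp : (Real.pi : ℂ) ≠ 0 := by exact_mod_cast Real.pi_ne_zero
      simp only [hh]; push_cast
      field_simp
  · rw [SchwartzMap.fourierInv_coe]
    rw [Real.fourierInv_eq, Real.fourierInv_eq, ← integral_const_mul]
    refine integral_congr_ae (Eventually.of_forall fun ξ => ?_)
    change _ • h ξ = _
    simp only [hh, Circle.smul_def, smul_eq_mul]
    push_cast; rw [mul_inv, mul_inv]; ring

theorem schwartz_bounded (φ : 𝓢(R3, ℂ)) : ∃ B, ∀ x, ‖φ x‖ ≤ B := by
  obtain ⟨B, -, hB⟩ := φ.decay 0 0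
  exact ⟨B, fun x => by simpa using hB x⟩

theorem one_add_pow_four_pos (x : R3) : 0 < 1 + ‖x‖ ^ 4 := by positivity

theorem integrable_mul_of_decay {H : R3 → ℝ} (hH : Continuous H)
    (hi : Integrable fun x : R3 => |H x| / (1 + ‖x‖ ^ 4)) {ψ : R3 → ℂ} (hψ : Continuous ψ) {C : ℝ}
    (hC : ∀ x, ‖ψ x‖ ≤ C / (1 + ‖x‖ ^ 4)) : Integrable fun x => (H x : ℂ) * ψ x := by
  refine (hi.mul_const C).mono'
    ((Complex.continuous_ofReal.comp hH).mul hψ).aestronglyMeasurable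
    (Eventually.of_forall fun x => ?_)
  rw [norm_mul, Complex.norm_real, Real.norm_eq_abs]
  calc |H x| * ‖ψ x‖ ≤ |H x| * (C / (1 + ‖x‖ ^ 4)) := by gcongr; exact hC x
    _ = _ := by ring

theorem one_add_pow_four_le {t : ℝ} (ht : 0 ≤ t) : 1 + t ^ 4 ≤ (1 + t) ^ 4 := by
  nlinarith [pow_nonneg ht 2, pow_nonneg ht 3]

theorem schwartz_decay (φ : 𝓢(R3, ℂ)) (k n : ℕ) :
    ∃ C, 0 ≤ C ∧ ∀ x, ‖iteratedFDeriv ℝ n φ x‖ ≤ C / (1 + ‖x‖) ^ k := by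
  refine ⟨2 ^ k * (Finset.Iic (k, n)).sup (fun m => SchwartzMap.seminorm ℝ m.1 m.2) φ,
    by positivity, fun x => ?_⟩
  have := SchwartzMap.one_add_le_sup_seminorm_apply (𝕜 := ℝ) (m := (k, n)) le_rfl le_rfl φ x
  rw [le_div_iff₀ (by positivity), mul_comm]
  exact this

theorem schwartz_decay_four (φ : 𝓢(R3, ℂ)) : ∃ C, ∀ x, ‖φ x‖ ≤ C / (1 + ‖x‖ ^ 4) := by
  obtain ⟨C, h0, hC⟩ := schwartz_decay φ 4 0
  refine ⟨C, fun x => ?_⟩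
  have h := hC x
  rw [norm_iteratedFDeriv_zero] at h
  exact h.trans (div_le_div_of_nonneg_left h0 (one_add_pow_four_pos x)
    (one_add_pow_four_le (norm_nonneg x)))

theorem integrable_inv_one_add_pow_four : Integrable fun x : R3 => 1 / (1 + ‖x‖ ^ 4) := by
  have h := (integrable_one_add_norm (E := R3) (μ := volume) (r := 4) (by simp; norm_num)).const_mul 8
  refine h.mono' ?_ (Eventually.of_forall fun x => ?_)
  · exact (by fun_prop : Measurable fun x : R3 => 1 / (1 + ‖x‖ ^ 4)).aestronglyMeasurable
  · rw [Real.norm_of_nonneg (by positivity), Real.rpow_neg (by positivity),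
      show (4 : ℝ) = ((4 : ℕ) : ℝ) by norm_num, Real.rpow_natCast, ← div_eq_mul_inv,
      div_le_div_iff₀ (by positivity) (by positivity)]
    have := norm_nonneg x
    -- convexity of the fourth power
    nlinarith [sq_nonneg (‖x‖ - 1), sq_nonneg (‖x‖ ^ 2 - 1), sq_nonneg (‖x‖ ^ 2 - ‖x‖),
      mul_nonneg this (sq_nonneg (‖x‖ - 1))]

theorem integrable_rieszPot_div {f : R3 → ℝ} (hfi : Integrable f) (hf0 : ∀ y, 0 ≤ f y) :
    Integrable fun x => rieszPot f x / (1 + ‖x‖ ^ 4) := by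
  have h := (rieszPot_mul_integral hfi hf0 (ψ := fun x => ((1 / (1 + ‖x‖ ^ 4) : ℝ) : ℂ))
    (B := 1) (integrable_inv_one_add_pow_four.ofReal) (fun x => by
      rw [Complex.norm_real, Real.norm_of_nonneg (by positivity), div_le_one (by positivity)]
      have : 0 ≤ ‖x‖ ^ 4 := by positivity
      linarith)).1
  refine (Complex.reCLM.integrable_comp h).congr (Eventually.of_forall fun x => ?_)
  beta_reduce
  rw [← Complex.ofReal_mul, Complex.reCLM_apply, Complex.ofReal_re, mul_one_div]

/-- The function `Δ u + π⁻² ∫ f(y) / |x - y|² dy` annihilates all band-limited functions whose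
spectrum avoids the origin. -/
theorem integral_band_eq_zero {u f : R3 → ℝ} (hu : IsSmoothSolution u (fun x => 2 * f x))
    (hfi : Integrable f) (hf0 : ∀ y, 0 ≤ f y) {g : R3 → ℂ}
    (hg : ContDiff ℝ ∞ g) (hc : HasCompactSupport g) (h0 : ∀ᶠ ξ in 𝓝 0, g ξ = 0) :
    ∫ x, ((Δ u x + 1 / Real.pi ^ 2 * rieszPot f x : ℝ) : ℂ) * 𝓕⁻ g x = 0 := by
  obtain ⟨φ, h1, h2⟩ := exists_halfLaplacian_eq hg hc h0
  set gS : 𝓢(R3, ℂ) := hc.toSchwartzMap hg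
  set ψ : 𝓢(R3, ℂ) := 𝓕⁻ gS with hψ
  have hψc : 𝓕⁻ g = ψ := (SchwartzMap.fourierInv_coe gS).symm
  have hw := hu.weak φ
  rw [h1, hψc] at hw
  obtain ⟨B, hB⟩ := schwartz_bounded ψ
  obtain ⟨hi1, hi2⟩ := rieszPot_mul_integral hfi hf0 ψ.integrable hB
  obtain ⟨C, hC⟩ := schwartz_decay_four ψ
  have hi3 := integrable_mul_of_decay
    (continuous_laplacian (contDiff_infty.1 hu.smooth 2)) hu.laplacian_mem.2
    ψ.continuous hC
  have hp : (Real.pi : ℂ) ≠ 0 := by exact_mod_cast Real.pi_ne_zero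
  -- the Riesz potential of `(-Δ)^{1/2} φ` is `2π² φ`
  have hr : ∀ y, ∫ x, (((‖y - x‖ ^ 2)⁻¹ : ℝ) : ℂ) * ψ x = 2 * Real.pi ^ 2 * φ y := by
    intro y
    rw [← hψc, h2 y]
    have := integral_riesz_fourierInv gS y
    change ∫ x, (((‖y - x‖ ^ 2)⁻¹ : ℝ) : ℂ) * 𝓕⁻ g x = _ at this
    rw [this]
    change _ * 𝓕⁻ (fun ξ => ((‖ξ‖⁻¹ : ℝ) : ℂ) * g ξ) y = _
    field_simp
  simp_rw [hr] at hi2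
  have e : ∀ x, ((Δ u x + 1 / Real.pi ^ 2 * rieszPot f x : ℝ) : ℂ) * ψ x =
      (Δ u x : ℂ) * ψ x + ((1 / Real.pi ^ 2 : ℝ) : ℂ) * ((rieszPot f x : ℂ) * ψ x) := by
    intro x; push_cast; ring
  rw [hψc]
  simp_rw [e]
  rw [integral_add hi3 (hi1.const_mul _), integral_const_mul, hi2]
  have e2 : ∫ x, (Δ u x : ℂ) * ψ x = -∫ y, ((2 * f y : ℝ) : ℂ) * φ y := by
    rw [← hw, ← integral_neg]
    refine integral_congr_ae (Eventually.of_forall fun x => ?_)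
    simp
  rw [e2, neg_add_eq_zero, ← integral_const_mul]
  refine integral_congr_ae (Eventually.of_forall fun x => ?_)
  push_cast
  field_simp

/-! ### A Liouville theorem for functions with spectrum at the origin -/

/-- The `L¹`-normalized dilation `t⁻³ η((y - x) / t)` of `η`, centred at `x`. -/
def dilate (η : R3 → ℂ) (x : R3) (t : ℝ) (y : R3) : ℂ :=
  ((t⁻¹ ^ 3 : ℝ) : ℂ) * η (t⁻¹ • (y - x))

/-- Dilating and modulating a symbol `X` dilates and recentres its inverse transform. -/
theorem fourierInv_modulate_dilate (X : R3 → ℂ) (x : R3) {t : ℝ} (ht : 0 < t) (y : R3) :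
    𝓕⁻ (fun ξ => Complex.exp (-(2 * Real.pi * (inner ℝ ξ x : ℝ) * Complex.I)) * X (t • ξ)) y =
      dilate (𝓕⁻ X) x t y := by
  rw [dilate, Real.fourierInv_eq', Real.fourierInv_eq']
  have := Measure.integral_comp_smul (volume : Measure R3)
    (fun ζ => Complex.exp (↑(2 * Real.pi * inner ℝ ζ (t⁻¹ • (y - x))) * Complex.I) • X ζ) t
  rw [finrank_euclideanSpace_fin, abs_of_pos (by positivity)] at this
  rw [inv_pow, ← Complex.real_smul, ← this]
  refine integral_congr_ae (Eventually.of_forall fun ξ => ?_)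
  simp only [smul_eq_mul]
  rw [← mul_assoc, ← Complex.exp_add]
  congr 2
  rw [real_inner_smul_left, real_inner_smul_right, inner_sub_right]
  push_cast
  have : (t : ℂ) ≠ 0 := by exact_mod_cast ht.ne'
  field_simp
  ring

/-- A cutoff in frequency, equal to one near the origin. -/
theorem exists_spectral_bump : ∃ X : 𝓢(R3, ℂ), HasCompactSupport X ∧ ∀ ξ : R3, ‖ξ‖ ≤ 1 → X ξ = 1 := by
  let b : ContDiffBump (0 : R3) := ⟨1, 2, one_pos, one_lt_two⟩
  have hc : HasCompactSupport fun ξ : R3 => (b ξ : ℂ) :=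
    b.hasCompactSupport.comp_left (g := fun r : ℝ => (r : ℂ)) (by simp)
  have hs : ContDiff ℝ ∞ fun ξ : R3 => (b ξ : ℂ) := Complex.ofRealCLM.contDiff.comp b.contDiff
  refine ⟨hc.toSchwartzMap hs, hc, fun ξ hξ => ?_⟩
  change ((b ξ : ℝ) : ℂ) = 1
  rw [b.one_of_mem_closedBall (by simpa using hξ)]
  simp

theorem dilate_continuous {η : R3 → ℂ} (hη : Continuous η) (x : R3) (t : ℝ) :
    Continuous (dilate η x t) := by
  unfold dilate
  fun_prop

section Liouville

variable {H : R3 → ℝ} (hH : Continuous H) (hi : Integrable fun x : R3 => |H x| / (1 + ‖x‖ ^ 4))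
include hH hi

theorem integrable_mul_dilate (η : 𝓢(R3, ℂ)) (x : R3) {t : ℝ} (ht : 0 < t) :
    Integrable fun y => (H y : ℂ) * dilate η x t y := by
  obtain ⟨C, h0, hC⟩ := schwartz_decay η 4 0
  set m := 1 + t + ‖x‖
  have hm : 1 ≤ m := by have := norm_nonneg x; simp only [m]; linarith
  refine integrable_mul_of_decay hH hi (dilate_continuous η.continuous x t)
    (C := t⁻¹ ^ 3 * (C * (m * (1 + t⁻¹)) ^ 4)) fun y => ?_
  rw [dilate, norm_mul, Complex.norm_real, Real.norm_of_nonneg (by positivity), mul_div_assoc]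
  gcongr
  have h1 := hC (t⁻¹ • (y - x))
  rw [norm_iteratedFDeriv_zero] at h1
  refine h1.trans ?_
  rw [div_le_div_iff₀ (by positivity) (by positivity)]
  have h2 : 1 + ‖y‖ ≤ (m * (1 + t⁻¹)) * (1 + ‖t⁻¹ • (y - x)‖) := by
    rw [norm_smul, Real.norm_of_nonneg (by positivity)]
    have h3 : ‖y‖ ≤ ‖y - x‖ + ‖x‖ := by simpa using norm_add_le (y - x) x
    have h4 : ‖y - x‖ = t * (t⁻¹ * ‖y - x‖) := by field_simp
    have h5 : 0 ≤ t⁻¹ * ‖y - x‖ := by positivity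
    have h6 : 1 + ‖y‖ ≤ m * (1 + t⁻¹ * ‖y - x‖) := by
      have : t * (t⁻¹ * ‖y - x‖) ≤ m * (t⁻¹ * ‖y - x‖) := by
        gcongr; simp only [m]; linarith [norm_nonneg x]
      simp only [m] at *
      nlinarith
    refine h6.trans ?_
    have : m ≤ m * (1 + t⁻¹) := le_mul_of_one_le_right (by linarith) (by
      have : 0 < t⁻¹ := by positivity
      linarith)
    gcongr
  calc C * (1 + ‖y‖ ^ 4) ≤ C * (1 + ‖y‖) ^ 4 := by
        gcongr; exact one_add_pow_four_le (norm_nonneg y)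
    _ ≤ C * ((m * (1 + t⁻¹)) * (1 + ‖t⁻¹ • (y - x)‖)) ^ 4 := by gcongr
    _ = _ := by rw [mul_pow (m * (1 + t⁻¹))]; ring

/-- Averages at large scale of a function in the weighted space forget their centre. -/
theorem tendsto_integral_dilate_sub (η : 𝓢(R3, ℂ)) (x x' : R3) :
    Tendsto (fun t : ℝ => (∫ y, (H y : ℂ) * dilate η x t y) - ∫ y, (H y : ℂ) * dilate η x' t y)
      atTop (𝓝 0) := by
  obtain ⟨C, h0, hC⟩ := schwartz_decay η 4 1
  set M := ‖x‖ + ‖x'‖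
  have hM : 0 ≤ M := by positivity
  -- the key bound on the kernel
  have key : ∀ t : ℝ, 1 + 2 * M ≤ t → ∀ y,
      ‖dilate η x t y - dilate η x' t y‖ ≤ 16 * C * ‖x - x'‖ / (t + ‖y‖) ^ 4 := by
    intro t ht y
    have ht0 : 0 < t := by linarith
    have hd : ‖η (t⁻¹ • (y - x)) - η (t⁻¹ • (y - x'))‖ ≤
        C * 16 * t ^ 4 / (t + ‖y‖) ^ 4 * ‖t⁻¹ • (y - x) - t⁻¹ • (y - x')‖ := by
      have hconv : Convex ℝ (ball (t⁻¹ • y) (t⁻¹ * (M + 1 / 2))) := convex_ball _ _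
      refine hconv.norm_image_sub_le_of_norm_fderiv_le (𝕜 := ℝ)
        (fun z _ => η.differentiableAt) (fun z hz => ?_) ?_ ?_
      · have h1 := hC z
        rw [← norm_iteratedFDeriv_one]
        refine h1.trans ?_
        rw [div_le_div_iff₀ (by positivity) (by positivity)]
        have h2 : t + ‖y‖ ≤ 2 * t * (1 + ‖z‖) := by
          have h3 : ‖t⁻¹ • y‖ ≤ ‖z‖ + t⁻¹ * (M + 1 / 2) := by
            have := norm_sub_le z (z - t⁻¹ • y)
            rw [sub_sub_cancel] at this
            rw [mem_ball, dist_eq_norm] at hz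
            linarith
          rw [norm_smul, Real.norm_of_nonneg (by positivity)] at h3
          have h4 : ‖y‖ ≤ t * ‖z‖ + (M + 1 / 2) := by
            have := mul_le_mul_of_nonneg_left h3 ht0.le
            rw [mul_add, mul_inv_cancel_left₀ ht0.ne', mul_inv_cancel_left₀ ht0.ne'] at this
            exact this
          have : 0 ≤ t * ‖z‖ := by positivity
          nlinarith
        calc C * (t + ‖y‖) ^ 4 ≤ C * (2 * t * (1 + ‖z‖)) ^ 4 := by gcongr
          _ = _ := by ring
      all_goals
        rw [mem_ball, dist_eq_norm, ← smul_sub, norm_smul, Real.norm_of_nonneg (by positivity)]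
        gcongr
        simp only [sub_sub_cancel_left, norm_neg, M]
        linarith [norm_nonneg x, norm_nonneg x']
    rw [dilate, dilate, ← mul_sub, norm_mul, Complex.norm_real, Real.norm_of_nonneg (by positivity)]
    have h5 : ‖t⁻¹ • (y - x) - t⁻¹ • (y - x')‖ = t⁻¹ * ‖x - x'‖ := by
      rw [← smul_sub, norm_smul, Real.norm_of_nonneg (by positivity), sub_sub_sub_cancel_left,
        norm_sub_rev]
    rw [h5] at hd
    calc _ ≤ t⁻¹ ^ 3 * (C * 16 * t ^ 4 / (t + ‖y‖) ^ 4 * (t⁻¹ * ‖x - x'‖)) := by gcongr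
      _ = _ := by field_simp
  have hlim : Tendsto (fun t : ℝ => ∫ y, (H y : ℂ) * (dilate η x t y - dilate η x' t y))
      atTop (𝓝 (∫ _ : R3, (0 : ℂ))) := by
    refine tendsto_integral_filter_of_dominated_convergence
      (fun y => |H y| / (1 + ‖y‖ ^ 4) * (16 * C * ‖x - x'‖)) ?_ ?_ (hi.mul_const _) ?_
    · refine Eventually.of_forall fun t => Continuous.aestronglyMeasurable ?_
      exact (Complex.continuous_ofReal.comp hH).mul
        ((dilate_continuous η.continuous x t).sub (dilate_continuous η.continuous x' t))
    · filter_upwards [eventually_ge_atTop (1 + 2 * M)] with t ht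
      refine Eventually.of_forall fun y => ?_
      rw [norm_mul, Complex.norm_real, Real.norm_eq_abs]
      have h1 : 1 + ‖y‖ ^ 4 ≤ (t + ‖y‖) ^ 4 :=
        (one_add_pow_four_le (norm_nonneg y)).trans (by gcongr; linarith)
      calc |H y| * ‖dilate η x t y - dilate η x' t y‖
          ≤ |H y| * (16 * C * ‖x - x'‖ / (t + ‖y‖) ^ 4) := by gcongr; exact key t ht y
        _ ≤ |H y| * (16 * C * ‖x - x'‖ / (1 + ‖y‖ ^ 4)) := by gcongr
        _ = _ := by ring
    · refine Eventually.of_forall fun y => ?_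
      rw [show (0 : ℂ) = (H y : ℂ) * 0 by simp]
      refine Tendsto.const_mul _ ?_
      refine squeeze_zero_norm' (a := fun t => 16 * C * ‖x - x'‖ / (t + ‖y‖) ^ 4) ?_ ?_
      · filter_upwards [eventually_ge_atTop (1 + 2 * M)] with t ht using key t ht y
      · exact Tendsto.const_div_atTop ((tendsto_pow_atTop (by norm_num)).comp
          (tendsto_atTop_add_const_right _ _ tendsto_id)) _
  rw [integral_zero] at hlim
  refine hlim.congr' ?_
  filter_upwards [eventually_gt_atTop 0] with t ht
  rw [← integral_sub (integrable_mul_dilate hH hi η x ht) (integrable_mul_dilate hH hi η x' ht)]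
  simp_rw [mul_sub]

/-- Dilations to small scales form an approximate identity. -/
theorem tendsto_integral_dilate_zero (η : 𝓢(R3, ℂ)) (x : R3) :
    Tendsto (fun t : ℝ => ∫ y, (H y : ℂ) * dilate η x t y) (𝓝[>] 0) (𝓝 (H x * ∫ z, η z)) := by
  obtain ⟨C, h0, hC⟩ := schwartz_decay η 5 0
  obtain ⟨B, hB⟩ := (isCompact_closedBall x 1).exists_bound_of_continuousOn hH.continuousOn
  set m := 2 + ‖x‖
  have hm : 1 ≤ m := by have := norm_nonneg x; simp only [m]; linarith
  -- far from the centre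
  have hfar : ∀ t : ℝ, 0 < t → ‖∫ y in (closedBall x 1)ᶜ, (H y : ℂ) * dilate η x t y‖ ≤
      t ^ 2 * ∫ y, |H y| / (1 + ‖y‖ ^ 4) * (C * m ^ 4) := by
    intro t ht
    have h1 : ∀ᵐ y ∂(volume.restrict (closedBall x 1)ᶜ), ‖(H y : ℂ) * dilate η x t y‖ ≤
        t ^ 2 * (|H y| / (1 + ‖y‖ ^ 4) * (C * m ^ 4)) := by
      refine (ae_restrict_iff' measurableSet_closedBall.compl).2 (Eventually.of_forall fun y hy => ?_)
      have hr : 1 < ‖y - x‖ := by simpa [dist_eq_norm] using hy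
      have h2 := hC (t⁻¹ • (y - x))
      rw [norm_iteratedFDeriv_zero, norm_smul, Real.norm_of_nonneg (by positivity)] at h2
      have h3 : 1 + ‖y‖ ≤ m * ‖y - x‖ := by
        have h3 : ‖y‖ ≤ ‖y - x‖ + ‖x‖ := by simpa using norm_add_le (y - x) x
        simp only [m]; nlinarith [norm_nonneg x]
      have h4 : 1 + ‖y‖ ^ 4 ≤ m ^ 4 * ‖y - x‖ ^ 5 := by
        calc 1 + ‖y‖ ^ 4 ≤ (1 + ‖y‖) ^ 4 := one_add_pow_four_le (norm_nonneg y)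
          _ ≤ (m * ‖y - x‖) ^ 4 := by gcongr
          _ = m ^ 4 * (‖y - x‖ ^ 4 * 1) := by ring
          _ ≤ m ^ 4 * (‖y - x‖ ^ 4 * ‖y - x‖) := by gcongr
          _ = _ := by ring
      have h5 : ‖dilate η x t y‖ ≤ t ^ 2 * (C * m ^ 4 / (1 + ‖y‖ ^ 4)) := by
        rw [dilate, norm_mul, Complex.norm_real, Real.norm_of_nonneg (by positivity)]
        calc t⁻¹ ^ 3 * ‖η (t⁻¹ • (y - x))‖ ≤ t⁻¹ ^ 3 * (C / (t⁻¹ * ‖y - x‖) ^ 5) := by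
              gcongr
              refine h2.trans (div_le_div_of_nonneg_left h0 (by positivity) ?_)
              gcongr; linarith
          _ = t ^ 2 * (C / ‖y - x‖ ^ 5) := by field_simp
          _ ≤ _ := by
              refine mul_le_mul_of_nonneg_left ?_ (by positivity)
              rw [div_le_div_iff₀ (by positivity) (by positivity)]
              calc _ ≤ C * (m ^ 4 * ‖y - x‖ ^ 5) := by gcongr
                _ = _ := by ring
      rw [norm_mul, Complex.norm_real, Real.norm_eq_abs]
      calc _ ≤ |H y| * (t ^ 2 * (C * m ^ 4 / (1 + ‖y‖ ^ 4))) := by gcongr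
        _ = _ := by ring
    have hI := hi.mul_const (C * m ^ 4)
    refine (norm_integral_le_of_norm_le (hI.const_mul _).integrableOn h1).trans ?_
    rw [← integral_const_mul]
    exact setIntegral_le_integral (hI.const_mul _) (Eventually.of_forall fun y => by positivity)
  -- near the centre, after rescaling
  have hnear : Tendsto (fun t : ℝ => ∫ y in closedBall x 1, (H y : ℂ) * dilate η x t y) (𝓝[>] 0)
      (𝓝 (∫ z, (H x : ℂ) * η z)) := by
    have hres : ∀ t : ℝ, 0 < t → ∫ y in closedBall x 1, (H y : ℂ) * dilate η x t y =
        ∫ z, (closedBall x 1).indicator (fun y => (H y : ℂ)) (x + t • z) * η z := by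
      intro t ht
      rw [← integral_indicator measurableSet_closedBall]
      have h1 := Measure.integral_comp_smul (volume : Measure R3)
        (fun w => (closedBall x 1).indicator (fun y => (H y : ℂ)) (x + w) * η (t⁻¹ • w)) t
      rw [finrank_euclideanSpace_fin, abs_of_pos (by positivity)] at h1
      simp only [inv_smul_smul₀ ht.ne'] at h1
      rw [h1, ← integral_smul,
        ← integral_add_left_eq_self (μ := volume) _ (x : R3)]
      refine integral_congr_ae (Eventually.of_forall fun w => ?_)
      simp only [indicator, dilate, add_sub_cancel_left]
      split_ifs
      · rw [Complex.real_smul, inv_pow]; ring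
      · simp
    refine Tendsto.congr' (f₁ := fun t : ℝ =>
      ∫ z, (closedBall x 1).indicator (fun y => (H y : ℂ)) (x + t • z) * η z) ?_ ?_
    · filter_upwards [self_mem_nhdsWithin] with t ht using (hres t ht).symm
    refine tendsto_integral_filter_of_dominated_convergence (fun z => B * ‖η z‖) ?_ ?_
      (η.integrable.norm.const_mul B) ?_
    · refine Eventually.of_forall fun t => ?_
      refine Measurable.aestronglyMeasurable (Measurable.mul ?_ η.continuous.measurable)
      exact ((Complex.measurable_ofReal.comp hH.measurable).indicator
        measurableSet_closedBall).comp (by fun_prop)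
    · refine Eventually.of_forall fun t => Eventually.of_forall fun z => ?_
      rw [norm_mul]
      gcongr
      by_cases hz : x + t • z ∈ closedBall x 1
      · rw [indicator_of_mem hz, Complex.norm_real]
        exact hB _ hz
      · rw [indicator_of_notMem hz, norm_zero]
        exact (norm_nonneg _).trans (hB x (by simp))
    · refine Eventually.of_forall fun z => Tendsto.mul_const _ ?_
      have hcont : Tendsto (fun t : ℝ => x + t • z) (𝓝[>] 0) (𝓝 x) := by
        have : Tendsto (fun t : ℝ => x + t • z) (𝓝 0) (𝓝 (x + (0 : ℝ) • z)) :=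
          (by fun_prop : Continuous fun t : ℝ => x + t • z).tendsto 0
        simpa using this.mono_left nhdsWithin_le_nhds
      refine (((Complex.continuous_ofReal.comp hH).tendsto x).comp hcont).congr' ?_
      filter_upwards [hcont (closedBall_mem_nhds x one_pos)] with t ht
      exact (indicator_of_mem ht _).symm
  have hfar' : Tendsto (fun t : ℝ => ∫ y in (closedBall x 1)ᶜ, (H y : ℂ) * dilate η x t y)
      (𝓝[>] 0) (𝓝 0) := by
    refine squeeze_zero_norm' (a := fun t : ℝ => t ^ 2 * ∫ y, |H y| / (1 + ‖y‖ ^ 4) * (C * m ^ 4))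
      ?_ ?_
    · filter_upwards [self_mem_nhdsWithin] with t ht using hfar t ht
    · have : Tendsto (fun t : ℝ => t ^ 2 * ∫ y, |H y| / (1 + ‖y‖ ^ 4) * (C * m ^ 4)) (𝓝 0)
          (𝓝 ((0 : ℝ) ^ 2 * ∫ y, |H y| / (1 + ‖y‖ ^ 4) * (C * m ^ 4))) :=
        (by fun_prop : Continuous _).tendsto 0
      simpa using this.mono_left nhdsWithin_le_nhds
  have := hnear.add hfar'
  rw [add_zero, integral_const_mul] at this
  refine this.congr' ?_
  filter_upwards [self_mem_nhdsWithin] with t ht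
  exact integral_add_compl measurableSet_closedBall (integrable_mul_dilate hH hi η x ht)

/-- A continuous function of the weighted space that annihilates all band-limited functions with
spectrum away from the origin is constant. -/
theorem exists_const_of_band
    (hb : ∀ g : R3 → ℂ, ContDiff ℝ ∞ g → HasCompactSupport g → (∀ᶠ ξ in 𝓝 0, g ξ = 0) →
      ∫ x, (H x : ℂ) * 𝓕⁻ g x = 0) : ∃ c, ∀ x, H x = c := by
  obtain ⟨X, hXc, hX1⟩ := exists_spectral_bump
  set η : 𝓢(R3, ℂ) := 𝓕⁻ X with hη
  have hηc : 𝓕⁻ (X : R3 → ℂ) = η := (SchwartzMap.fourierInv_coe X).symm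
  have hmass : ∫ z, η z = 1 := by
    have h1 : 𝓕 (η : R3 → ℂ) 0 = X 0 := by
      rw [← SchwartzMap.fourier_coe, hη, FourierTransform.fourier_fourierInv_eq]
    rw [hX1 0 (by simp), Real.fourier_eq] at h1
    simpa using h1
  set e : R3 → R3 → ℂ := fun x ξ => Complex.exp (-(2 * Real.pi * (inner ℝ ξ x : ℝ) * Complex.I))
  have he : ∀ x, ContDiff ℝ ∞ (e x) := by
    intro x
    have h1 : ContDiff ℝ ∞ fun ξ : R3 => ((inner ℝ ξ x : ℝ) : ℂ) :=
      Complex.ofRealCLM.contDiff.comp (contDiff_id.inner ℝ contDiff_const)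
    exact (((contDiff_const.mul h1).mul contDiff_const).neg).cexp
  have hpiece : ∀ x (t : ℝ), 0 < t → ContDiff ℝ ∞ (fun ξ => e x ξ * X (t • ξ)) ∧
      HasCompactSupport (fun ξ => e x ξ * X (t • ξ)) := by
    intro x t ht
    refine ⟨(he x).mul ((X.smooth ⊤).comp (contDiff_const_smul t)), ?_⟩
    exact (hXc.comp_smul ht.ne').mul_left
  -- the difference of two dilations has its spectrum away from the origin, so the mean of `H` around
  -- `x` does not depend on the scale; small scales identify it as `H x`, large ones forget `x`
  have hindep : ∀ x (s t : ℝ), 0 < s → 0 < t →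
      ∫ y, (H y : ℂ) * dilate η x s y = ∫ y, (H y : ℂ) * dilate η x t y := by
    intro x s t hs ht
    obtain ⟨a1, a2⟩ := hpiece x s hs
    obtain ⟨b1, b2⟩ := hpiece x t ht
    have h1 := hb (fun ξ => e x ξ * X (s • ξ) - e x ξ * X (t • ξ)) (a1.sub b1) (a2.sub b2) (by
      have : ∀ r : ℝ, ∀ᶠ ξ : R3 in 𝓝 0, ‖r • ξ‖ ≤ 1 := by
        intro r
        have : Tendsto (fun ξ : R3 => ‖r • ξ‖) (𝓝 0) (𝓝 ‖r • (0 : R3)‖) :=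
          (by fun_prop : Continuous fun ξ : R3 => ‖r • ξ‖).tendsto 0
        rw [smul_zero, norm_zero] at this
        exact (this.eventually_lt_const one_pos).mono fun _ h => h.le
      filter_upwards [this s, this t] with ξ h1 h2
      simp [hX1 _ h1, hX1 _ h2])
    have h2 : ∀ y, 𝓕⁻ (fun ξ => e x ξ * X (s • ξ) - e x ξ * X (t • ξ)) y =
        dilate η x s y - dilate η x t y := by
      intro y
      rw [← hηc, ← fourierInv_modulate_dilate X x hs, ← fourierInv_modulate_dilate X x ht]
      set A := a2.toSchwartzMap a1
      set B := b2.toSchwartzMap b1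
      have hA : (A : R3 → ℂ) = fun ξ => e x ξ * X (s • ξ) := rfl
      have hB : (B : R3 → ℂ) = fun ξ => e x ξ * X (t • ξ) := rfl
      have hs : 𝓕⁻ (A - B) = 𝓕⁻ A - 𝓕⁻ B := by
        rw [eq_sub_iff_add_eq, ← FourierInvAdd.fourierInv_add, sub_add_cancel]
      have := congrArg (fun φ : 𝓢(R3, ℂ) => φ y) hs
      rw [sub_apply, SchwartzMap.fourierInv_coe, SchwartzMap.fourierInv_coe,
        SchwartzMap.fourierInv_coe] at this
      exact this
    simp_rw [h2, mul_sub] at h1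
    rw [integral_sub (integrable_mul_dilate hH hi η x hs) (integrable_mul_dilate hH hi η x ht),
      sub_eq_zero] at h1
    exact h1
  have hval : ∀ x, ∫ y, (H y : ℂ) * dilate η x 1 y = H x := by
    intro x
    have h1 := tendsto_integral_dilate_zero hH hi η x
    rw [hmass, mul_one] at h1
    refine tendsto_nhds_unique (tendsto_const_nhds (f := 𝓝[>] (0 : ℝ))) (h1.congr' ?_)
    filter_upwards [self_mem_nhdsWithin] with t ht using hindep x t 1 ht one_pos
  refine ⟨H 0, fun x => ?_⟩
  have h1 := tendsto_integral_dilate_sub hH hi η x 0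
  have h2 : (H x : ℂ) - H 0 = 0 := by
    refine tendsto_nhds_unique (tendsto_const_nhds (f := atTop (α := ℝ))) (h1.congr' ?_)
    filter_upwards [eventually_gt_atTop 0] with t ht
    rw [hindep x t 1 ht one_pos, hindep 0 t 1 ht one_pos, hval, hval]
  exact_mod_cast sub_eq_zero.1 h2

end Liouville

/-- The equation in integrated form: `Δ u` is a Riesz potential up to a constant. -/
theorem exists_laplacian_eq {u f : R3 → ℝ} (hu : IsSmoothSolution u (fun x => 2 * f x))
    (hf : Continuous f) (hfi : Integrable f) (hf0 : ∀ y, 0 ≤ f y) :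
    ∃ c, ∀ x, Δ u x = -(1 / Real.pi ^ 2 * rieszPot f x) + c := by
  have hc1 := continuous_laplacian (contDiff_infty.1 hu.smooth 2)
  have hc2 := continuous_rieszPot hf hfi hf0
  obtain ⟨c, hc⟩ := exists_const_of_band (H := fun x => Δ u x + 1 / Real.pi ^ 2 * rieszPot f x)
    (hc1.add (continuous_const.mul hc2)) (by
      refine (hu.laplacian_mem.2.add ((integrable_rieszPot_div hfi hf0).const_mul
        (1 / Real.pi ^ 2))).mono' ?_ (Eventually.of_forall fun x => ?_)
      · exact ((hc1.add (continuous_const.mul hc2)).abs.measurable.div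
          (by fun_prop)).aestronglyMeasurable
      · have h0 : 0 ≤ rieszPot f x := integral_nonneg fun y => mul_nonneg (by positivity) (hf0 y)
        rw [Real.norm_of_nonneg (by positivity)]
        simp only [Pi.add_apply]
        rw [← mul_div_assoc, ← add_div]
        gcongr
        refine (abs_add_le _ _).trans ?_
        rw [abs_of_nonneg (a := 1 / Real.pi ^ 2 * rieszPot f x) (by positivity)])
    fun g h1 h2 h3 => integral_band_eq_zero hu hfi hf0 h1 h2 h3
  exact ⟨c, fun x => by linarith [hc x]⟩

/-! ### Mean values of functions with constant Laplacian -/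

/-- A radial bump function supported in the ball of radius `√2`. -/
def radialBump (y : R3) : ℝ := expNegInvGlue (2 - ‖y‖ ^ 2)

/-- The radial weight `ρ` with `∇ (radialBump) (y) = -ρ(y) y`. -/
def radialWeight (y : R3) : ℝ := 2 * deriv expNegInvGlue (2 - ‖y‖ ^ 2)

theorem contDiff_deriv_expNegInvGlue {n : ℕ} : ContDiff ℝ n (deriv expNegInvGlue) := by
  have : ContDiff ℝ ((n : WithTop ℕ∞) + 1) expNegInvGlue := by
    exact_mod_cast expNegInvGlue.contDiff (n := ((n + 1 : ℕ) : ℕ∞))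
  exact (contDiff_succ_iff_deriv.1 this).2.2

theorem contDiff_radialBump {n : ℕ} : ContDiff ℝ n radialBump := by
  have : ContDiff ℝ n expNegInvGlue := by exact_mod_cast expNegInvGlue.contDiff (n := (n : ℕ∞))
  exact this.comp (contDiff_const.sub (contDiff_norm_sq ℝ))

theorem contDiff_radialWeight {n : ℕ} : ContDiff ℝ n radialWeight :=
  contDiff_const.mul (contDiff_deriv_expNegInvGlue.comp (contDiff_const.sub (contDiff_norm_sq ℝ)))

theorem hasFDerivAt_radialBump (y : R3) :
    HasFDerivAt radialBump (-(radialWeight y) • innerSL ℝ y) y := by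
  have h1 : HasDerivAt expNegInvGlue (deriv expNegInvGlue (2 - ‖y‖ ^ 2)) (2 - ‖y‖ ^ 2) :=
    ((expNegInvGlue.contDiff (n := 1)).differentiable (by simp)).differentiableAt.hasDerivAt
  have h2 : HasFDerivAt (fun z : R3 => 2 - ‖z‖ ^ 2) (-((2 : ℝ) • innerSL ℝ y)) y := by
    simpa using (hasFDerivAt_norm_sq_add 0 y).const_sub 2
  refine (h1.comp_hasFDerivAt y h2).congr_fderiv ?_
  ext a
  simp [radialWeight]
  ring

theorem deriv_expNegInvGlue_of_nonpos {s : ℝ} (hs : s ≤ 0) : deriv expNegInvGlue s = 0 := by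
  rcases hs.lt_or_eq with hs | rfl
  · have : expNegInvGlue =ᶠ[𝓝 s] fun _ => 0 := by
      filter_upwards [Iio_mem_nhds hs] with t ht using expNegInvGlue.zero_of_nonpos (le_of_lt ht)
    rw [this.deriv_eq, deriv_const]
  · have h : IsLocalMin expNegInvGlue 0 := Eventually.of_forall fun t => by
      rw [expNegInvGlue.zero]; exact expNegInvGlue.nonneg t
    exact h.deriv_eq_zero

theorem radialWeight_nonneg (y : R3) : 0 ≤ radialWeight y :=
  mul_nonneg two_pos.le (expNegInvGlue.monotone.deriv_nonneg)

theorem radialWeight_eq_zero {y : R3} (hy : 2 ≤ ‖y‖) : radialWeight y = 0 := by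
  rw [radialWeight, deriv_expNegInvGlue_of_nonpos (by nlinarith), mul_zero]

theorem radialBump_eq_zero {y : R3} (hy : 2 ≤ ‖y‖) : radialBump y = 0 :=
  expNegInvGlue.zero_of_nonpos (by nlinarith)

theorem hasCompactSupport_radialWeight : HasCompactSupport radialWeight :=
  HasCompactSupport.intro (isCompact_closedBall 0 2) fun y hy =>
    radialWeight_eq_zero (by simpa using (not_le.1 (by simpa using hy : ¬ ‖y‖ ≤ 2)).le)

theorem hasCompactSupport_radialBump : HasCompactSupport radialBump :=
  HasCompactSupport.intro (isCompact_closedBall 0 2) fun y hy =>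
    radialBump_eq_zero (by simpa using (not_le.1 (by simpa using hy : ¬ ‖y‖ ≤ 2)).le)

theorem continuous_radialWeight : Continuous radialWeight :=
  (contDiff_radialWeight (n := 0)).continuous

theorem radialWeight_pos {y : R3} (hy : ‖y‖ ≤ 1) : 0 < radialWeight y := by
  have h0 : 0 < 2 - ‖y‖ ^ 2 := by nlinarith [norm_nonneg y]
  have h : HasDerivAt expNegInvGlue
      (Real.exp (-(2 - ‖y‖ ^ 2)⁻¹) * -(-((2 - ‖y‖ ^ 2) ^ 2)⁻¹)) (2 - ‖y‖ ^ 2) := by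
    refine ((hasDerivAt_inv h0.ne').neg.exp).congr_of_eventuallyEq ?_
    filter_upwards [Ioi_mem_nhds h0] with t ht
    simp [expNegInvGlue, not_le.2 (mem_Ioi.1 ht)]
  rw [radialWeight, h.deriv]
  have := Real.exp_pos (-(2 - ‖y‖ ^ 2)⁻¹)
  rw [neg_neg]
  positivity

theorem exists_radialWeight_ge : ∃ κ, 0 < κ ∧ ∀ y : R3, ‖y‖ ≤ 1 → κ ≤ radialWeight y := by
  obtain ⟨y, hy, hm⟩ := (isCompact_closedBall (0 : R3) 1).exists_isMinOn ⟨0, by simp⟩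
    continuous_radialWeight.continuousOn
  exact ⟨_, radialWeight_pos (by simpa using hy), fun z hz => hm (by simpa using hz)⟩

theorem integrable_mul_radialWeight {a : R3 → ℝ} (ha : Continuous a) :
    Integrable fun y => a y * radialWeight y :=
  (ha.mul continuous_radialWeight).integrable_of_hasCompactSupport
    hasCompactSupport_radialWeight.mul_left

/-- The total mass of `radialWeight`. -/
def weightMass : ℝ := ∫ y, radialWeight y

theorem weightMass_pos : 0 < weightMass := by
  have hi := continuous_radialWeight.integrable_of_hasCompactSupport
    (μ := (volume : Measure R3)) hasCompactSupport_radialWeight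
  refine (integral_pos_iff_support_of_nonneg radialWeight_nonneg hi).2 ?_
  refine lt_of_lt_of_le (measure_ball_pos volume (0 : R3) one_pos) (measure_mono fun y hy => ?_)
  exact (radialWeight_pos (by simpa using (mem_ball_zero_iff.1 hy).le)).ne'

theorem laplacian_eq_sum_fderiv {p : R3 → ℝ} (hp : ContDiff ℝ 2 p) (x : R3) :
    Δ p x = ∑ i, fderiv ℝ (fun z => fderiv ℝ p z (EuclideanSpace.single i 1)) x
      (EuclideanSpace.single i 1) := by
  rw [InnerProductSpace.laplacian_eq_iteratedFDeriv_orthonormalBasis p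
    (EuclideanSpace.basisFun (Fin 3) ℝ)]
  refine Finset.sum_congr rfl fun i _ => ?_
  have hd : DifferentiableAt ℝ (fderiv ℝ p) x :=
    ((hp.fderiv_right (m := 1) (by norm_num)).differentiable (by simp)).differentiableAt
  rw [iteratedFDeriv_two_apply, fderiv_clm_apply hd (differentiableAt_const _)]
  simp

theorem sum_coord_smul_single (x : R3) : ∑ i, x i • EuclideanSpace.single i (1 : ℝ) = x := by
  have := (EuclideanSpace.basisFun (Fin 3) ℝ).sum_repr x
  simpa using this

/-- The mean value property: averages of a function with constant Laplacian `c` against the radial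
weight on scale `R` differ from the value at the centre by a universal multiple of `c R²`. -/
theorem integral_mul_radialWeight {p : R3 → ℝ} (hp : ContDiff ℝ 2 p) {c : ℝ}
    (hc : ∀ x, Δ p x = c) (x : R3) (R : ℝ) :
    ∫ y, p (x + R • y) * radialWeight y =
      weightMass * p x + c * R ^ 2 / 2 * ∫ y, radialBump y := by
  have hp1 : ContDiff ℝ 1 (fderiv ℝ p) := hp.fderiv_right (by norm_num)
  have hpd : Differentiable ℝ p := hp.differentiable (by simp)
  have hcomp : ∀ r : ℝ, Continuous fun y : R3 => x + r • y := fun r => by fun_prop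
  -- the radial derivative of the average
  have hder : ∀ r : ℝ, HasDerivAt (fun r : ℝ => ∫ y, p (x + r • y) * radialWeight y)
      (∫ y, fderiv ℝ p (x + r • y) y * radialWeight y) r := by
    intro r
    obtain ⟨B, hB⟩ := (isCompact_closedBall x (2 * (|r| + 1))).exists_bound_of_continuousOn
      hp1.continuous.continuousOn
    refine (hasDerivAt_integral_of_dominated_loc_of_deriv_le (s := ball r 1)
      (bound := fun y => B * 2 * radialWeight y)
      (F' := fun r y => fderiv ℝ p (x + r • y) y * radialWeight y) (ball_mem_nhds r one_pos)
      (Eventually.of_forall fun s =>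
        (integrable_mul_radialWeight (hp.continuous.comp (hcomp s))).1)
      (integrable_mul_radialWeight (hp.continuous.comp (hcomp r))) ?_ ?_
      (integrable_mul_radialWeight continuous_const) ?_).2
    · exact (((hp1.continuous.comp (hcomp r)).clm_apply continuous_id).mul
        continuous_radialWeight).aestronglyMeasurable
    · refine Eventually.of_forall fun y s hs => ?_
      rcases le_or_gt 2 ‖y‖ with hy | hy
      · simp [radialWeight_eq_zero hy]
      · rw [norm_mul, Real.norm_of_nonneg (radialWeight_nonneg y)]
        refine mul_le_mul_of_nonneg_right ?_ (radialWeight_nonneg y)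
        have hs' : |s| ≤ |r| + 1 := by
          rw [mem_ball, Real.dist_eq] at hs
          have := abs_sub_abs_le_abs_sub s r
          linarith
        have h1 : x + s • y ∈ closedBall x (2 * (|r| + 1)) := by
          rw [mem_closedBall, dist_eq_norm, add_sub_cancel_left, norm_smul, Real.norm_eq_abs]
          nlinarith [norm_nonneg y, abs_nonneg s]
        have h2 := hB _ h1
        calc ‖fderiv ℝ p (x + s • y) y‖ ≤ ‖fderiv ℝ p (x + s • y)‖ * ‖y‖ :=
              ContinuousLinearMap.le_opNorm _ _
          _ ≤ B * 2 := by
              gcongr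
              exact (norm_nonneg _).trans h2
    · refine Eventually.of_forall fun y s _ => ?_
      have h1 : HasDerivAt (fun s : ℝ => x + s • y) y s := by
        simpa using ((hasDerivAt_id s).smul_const y).const_add x
      exact ((hpd _).hasFDerivAt.comp_hasDerivAt s h1).mul_const _
  -- integration by parts
  have hibp : ∀ r : ℝ, ∫ y, fderiv ℝ p (x + r • y) y * radialWeight y =
      r * c * ∫ y, radialBump y := by
    intro r
    set q : Fin 3 → R3 → ℝ := fun i y => fderiv ℝ p (x + r • y) (EuclideanSpace.single i 1)
    have hq1 : ∀ i, ContDiff ℝ 1 (q i) := fun i =>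
      (hp1.comp (contDiff_const.add (contDiff_const_smul r))).clm_apply contDiff_const
    have hb1 : ContDiff ℝ 1 radialBump := by exact_mod_cast contDiff_radialBump (n := 1)
    have hbf : ∀ i y, fderiv ℝ radialBump y (EuclideanSpace.single i 1) = -(radialWeight y * y i) := by
      intro i y
      rw [(hasFDerivAt_radialBump y).fderiv]
      simp [EuclideanSpace.inner_single_right]
    have hqf : ∀ i y, fderiv ℝ (q i) y (EuclideanSpace.single i 1) =
        r * fderiv ℝ (fun z => fderiv ℝ p z (EuclideanSpace.single i 1)) (x + r • y)
          (EuclideanSpace.single i 1) := by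
      intro i y
      have h1 : HasFDerivAt (fun y : R3 => x + r • y) (r • ContinuousLinearMap.id ℝ R3) y := by
        simpa using ((hasFDerivAt_id y).const_smul r).const_add x
      have h2 : DifferentiableAt ℝ (fun z => fderiv ℝ p z (EuclideanSpace.single i 1)) (x + r • y) :=
        ((hp1.clm_apply contDiff_const).differentiable (by simp)).differentiableAt
      have h3 := h2.hasFDerivAt.comp y h1
      have h4 : fderiv ℝ (q i) y = _ := h3.fderiv
      rw [h4]
      simp
    have hsum : ∀ y, fderiv ℝ p (x + r • y) y * radialWeight y =
        ∑ i, -(q i y * fderiv ℝ radialBump y (EuclideanSpace.single i 1)) := by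
      intro y
      have h4 := congrArg (fderiv ℝ p (x + r • y)) (sum_coord_smul_single y)
      rw [map_sum] at h4
      rw [← h4, Finset.sum_mul]
      refine Finset.sum_congr rfl fun i _ => ?_
      rw [hbf, map_smul, smul_eq_mul]
      simp only [q]
      ring
    have hI : ∀ i, Integrable fun y => q i y * fderiv ℝ radialBump y (EuclideanSpace.single i 1) :=
      fun i => ((hq1 i).continuous.mul ((hb1.continuous_fderiv (by simp)).clm_apply
        continuous_const)).integrable_of_hasCompactSupport
        (hasCompactSupport_radialBump.fderiv_apply ℝ _).mul_left
    have hI' : ∀ i, Integrable fun y => fderiv ℝ (q i) y (EuclideanSpace.single i 1) * radialBump y :=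
      fun i => ((((hq1 i).continuous_fderiv (by simp)).clm_apply
        continuous_const).mul hb1.continuous).integrable_of_hasCompactSupport
        hasCompactSupport_radialBump.mul_left
    simp_rw [hsum]
    have hIn : ∀ i, Integrable fun y =>
        -(q i y * fderiv ℝ radialBump y (EuclideanSpace.single i 1)) := fun i => (hI i).neg
    rw [integral_finsetSum _ fun i _ => hIn i]
    have hi : ∀ i, ∫ y, -(q i y * fderiv ℝ radialBump y (EuclideanSpace.single i 1)) =
        ∫ y, fderiv ℝ (q i) y (EuclideanSpace.single i 1) * radialBump y := by
      intro i
      rw [integral_neg, integral_mul_fderiv_eq_neg_fderiv_mul_of_integrable (hI' i) (hI i)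
        (((hq1 i).continuous.mul hb1.continuous).integrable_of_hasCompactSupport
          hasCompactSupport_radialBump.mul_left)
        (fun y _ => ((hq1 i).differentiable (by simp)).differentiableAt)
        (fun y _ => (hb1.differentiable (by simp)).differentiableAt), neg_neg]
    rw [Finset.sum_congr rfl fun i _ => hi i, ← integral_finsetSum _ fun i _ => hI' i,
      ← integral_const_mul]
    refine integral_congr_ae (Eventually.of_forall fun y => ?_)
    simp only [hqf]
    rw [← Finset.sum_mul, ← Finset.mul_sum, ← laplacian_eq_sum_fderiv hp, hc]
  set J := ∫ y, radialBump y
  have hconst := is_const_of_deriv_eq_zero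
    (f := fun r : ℝ => (∫ y, p (x + r • y) * radialWeight y) - c * r ^ 2 / 2 * J)
    (fun r => ((hder r).differentiableAt.sub (by fun_prop))) (fun r => by
      have h2 : HasDerivAt (fun r : ℝ => c * r ^ 2 / 2 * J) (r * c * J) r := by
        have := (((hasDerivAt_pow 2 r).const_mul c).div_const 2).mul_const J
        refine this.congr_deriv ?_
        push_cast
        ring
      have := (hder r).sub h2
      rw [hibp, sub_self] at this
      exact this.deriv) R 0
  simp only [zero_smul, add_zero] at hconst
  rw [integral_const_mul] at hconst
  rw [weightMass]
  linarith

/-! ### Functions with constant Laplacian and quadratic growth in the mean -/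

/-- The third difference of `g` at `x` with increments `h`, `k`, `l`. -/
def thirdDiff (g : R3 → ℝ) (h k l x : R3) : ℝ :=
  (((g (x + l + k + h) - g (x + k + h)) - (g (x + l + h) - g (x + h)))
    - ((g (x + l + k) - g (x + k)) - (g (x + l) - g x)))

theorem abs_sub_le_of_fderiv_le {g : R3 → ℝ} (hg : Differentiable ℝ g) {h : R3} {C : ℝ}
    (hC : ∀ x, |fderiv ℝ g x h| ≤ C) {s : ℝ} (hs : 0 ≤ s) (x : R3) :
    |g (x + s • h) - g x| ≤ C * s := by
  have hd : ∀ t : ℝ, HasDerivAt (fun t : ℝ => g (x + t • h)) (fderiv ℝ g (x + t • h) h) t := by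
    intro t
    have h1 : HasDerivAt (fun s : ℝ => x + s • h) h t := by
      simpa using ((hasDerivAt_id t).smul_const h).const_add x
    exact (hg _).hasFDerivAt.comp_hasDerivAt t h1
  have := Convex.norm_image_sub_le_of_norm_hasDerivWithin_le (s := univ)
    (fun t _ => (hd t).hasDerivWithinAt) (fun t _ => by simpa using hC (x + t • h))
    convex_univ (mem_univ 0) (mem_univ s)
  simpa [abs_of_nonneg hs] using this

theorem differentiable_comp_add {g : R3 → ℝ} (hg : Differentiable ℝ g) (a : R3) :
    Differentiable ℝ fun y => g (y + a) := hg.comp (differentiable_id.add_const a)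

theorem fderiv_comp_add (g : R3 → ℝ) (a x : R3) :
    fderiv ℝ (fun y => g (y + a)) x = fderiv ℝ g (x + a) := fderiv_comp_add_right a

/-- The third differences of a smooth compactly supported function are of third order. -/
theorem exists_thirdDiff_le {g : R3 → ℝ} (hg : ContDiff ℝ 3 g) (hc : HasCompactSupport g)
    (h k l : R3) : ∃ C, 0 ≤ C ∧ ∀ s : ℝ, 0 ≤ s → ∀ x,
      |thirdDiff g (s • h) (s • k) (s • l) x| ≤ C * s ^ 3 := by
  set g1 : R3 → ℝ := fun x => fderiv ℝ g x h
  set g2 : R3 → ℝ := fun x => fderiv ℝ g1 x k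
  set g3 : R3 → ℝ := fun x => fderiv ℝ g2 x l
  have e1 : ContDiff ℝ 2 g1 := (hg.fderiv_right (m := 2) (by norm_num)).clm_apply contDiff_const
  have e2 : ContDiff ℝ 1 g2 := (e1.fderiv_right (m := 1) (by norm_num)).clm_apply contDiff_const
  have e3 : Continuous g3 := ((e2.fderiv_right (m := 0) (by norm_num)).clm_apply
    contDiff_const).continuous
  have hc3 : HasCompactSupport g3 := by
    have h1 : HasCompactSupport g1 := hc.fderiv_apply ℝ _
    have h2 : HasCompactSupport g2 := h1.fderiv_apply ℝ _
    exact h2.fderiv_apply ℝ _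
  obtain ⟨C, hC⟩ := hc3.exists_bound_of_continuous e3
  have d0 : Differentiable ℝ g := hg.differentiable (by norm_num)
  have d1 : Differentiable ℝ g1 := e1.differentiable (by norm_num)
  have d2 : Differentiable ℝ g2 := e2.differentiable (by norm_num)
  refine ⟨C, (norm_nonneg _).trans (hC 0), fun s hs x => ?_⟩
  have b2 : ∀ x, |g2 (x + s • l) - g2 x| ≤ C * s :=
    abs_sub_le_of_fderiv_le d2 (fun x => hC x) hs
  have b1 : ∀ x, |(g1 (x + s • k + s • l) - g1 (x + s • k)) - (g1 (x + s • l) - g1 x)|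
      ≤ C * s * s := by
    refine abs_sub_le_of_fderiv_le (g := fun x => g1 (x + s • l) - g1 x) ?_ (fun x => ?_) hs
    · exact (differentiable_comp_add d1 _).sub d1
    · rw [fderiv_fun_sub (differentiable_comp_add d1 _ x) (d1 x), fderiv_comp_add]
      exact b2 x
  have b0 := abs_sub_le_of_fderiv_le (h := h) (C := C * s * s)
    (g := fun x => (g (x + s • k + s • l) - g (x + s • k)) - (g (x + s • l) - g x)) ?_
    (fun x => ?_) hs x
  · refine le_trans (le_of_eq ?_) (b0.trans (le_of_eq (by ring)))
    rw [thirdDiff]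
    congr 1
    simp only [add_right_comm]
  · have t := fun a : R3 => differentiable_comp_add d0 a
    simp only [add_assoc]
    exact ((t (s • k + s • l)).sub (t (s • k))).sub ((t (s • l)).sub d0)
  · have t := fun a : R3 => differentiable_comp_add d0 a
    have e : (fun x => (g (x + s • k + s • l) - g (x + s • k)) - (g (x + s • l) - g x)) =
        fun x => (g (x + (s • k + s • l)) - g (x + s • k)) - (g (x + s • l) - g x) := by
      simp only [add_assoc]
    have t1 : DifferentiableAt ℝ (fun x => g (x + (s • k + s • l)) - g (x + s • k)) x :=
      ((t (s • k + s • l)).sub (t (s • k))) x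
    have t2 : DifferentiableAt ℝ (fun x => g (x + s • l) - g x) x := ((t (s • l)).sub d0) x
    rw [e, fderiv_fun_sub t1 t2, fderiv_fun_sub (t (s • k + s • l) x) (t (s • k) x),
      fderiv_fun_sub (t (s • l) x) (d0 x)]
    have e5 : fderiv ℝ (fun y => g (y + (s • k + s • l))) x = fderiv ℝ g (x + s • k + s • l) := by
      rw [fderiv_comp_add, add_assoc]
    simp only [e5, fderiv_comp_add, sub_apply]
    exact b1 x

/-- A continuous function with vanishing third differences is a quadratic polynomial. -/
theorem exists_quadratic_of_thirdDiff {p : R3 → ℝ} (hp : Continuous p)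
    (h3 : ∀ h k l x, thirdDiff p h k l x = 0) :
    ∃ (T : R3 →ₗ[ℝ] R3) (w : R3), T.IsSymmetric ∧
      ∀ x, p x = p 0 + inner ℝ w x + 1 / 2 * inner ℝ (T x) x := by
  -- the second difference at the origin is biadditive, hence by continuity bilinear
  set b : R3 → R3 → ℝ := fun h k => p (h + k) - p h - p k + p 0
  have hbc : ∀ h, Continuous (b h) := fun h => by fun_prop
  have hsymm : ∀ h k, b h k = b k h := fun h k => by simp only [b, add_comm h k]; ring
  have hadd : ∀ h k l, b h (k + l) = b h k + b h l := by
    intro h k l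
    have := h3 h k l 0
    simp only [thirdDiff, zero_add] at this
    simp only [b]
    rw [show h + (k + l) = l + k + h by abel, show k + l = l + k by abel,
      show h + k = k + h by abel, show h + l = l + h by abel]
    linarith
  let B1 : R3 → R3 →L[ℝ] ℝ := fun h => (AddMonoidHom.mk' (b h) (hadd h)).toRealLinearMap (hbc h)
  have hB1 : ∀ h k, B1 h k = b h k := fun h k => rfl
  let T : R3 →ₗ[ℝ] R3 :=
    { toFun := fun h => (InnerProductSpace.toDual ℝ R3).symm (B1 h)
      map_add' := fun h k => by
        rw [← map_add]
        congr 1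
        ext l
        rw [add_apply, hB1, hB1, hB1, hsymm, hadd, hsymm l h, hsymm l k]
      map_smul' := fun c h => by
        rw [RingHom.id_apply]
        refine ext_inner_right ℝ fun l => ?_
        rw [inner_smul_left, InnerProductSpace.toDual_symm_apply,
          InnerProductSpace.toDual_symm_apply, hB1, hB1, hsymm, ← hB1, map_smul, hB1, hsymm]
        simp }
  have hT : ∀ h k, inner ℝ (T h) k = b h k := fun h k => by
    show inner ℝ ((InnerProductSpace.toDual ℝ R3).symm (B1 h)) k = _
    rw [InnerProductSpace.toDual_symm_apply, hB1]
  let L : R3 →L[ℝ] ℝ := (AddMonoidHom.mk' (fun x => p x - p 0 - 1 / 2 * b x x) fun x y => by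
    have e1 : b (x + y) (x + y) = b x x + 2 * b x y + b y y := by
      rw [hadd, hsymm (x + y) x, hsymm (x + y) y, hadd, hadd, hsymm y x]; ring
    have e2 : p (x + y) = b x y + p x + p y - p 0 := by simp only [b]; ring
    rw [e1, e2]; ring).toRealLinearMap
      (by show Continuous fun x => p x - p 0 - 1 / 2 * b x x; fun_prop)
  have hL : ∀ x, L x = p x - p 0 - 1 / 2 * b x x := fun x => rfl
  refine ⟨T, (InnerProductSpace.toDual ℝ R3).symm L, fun x y => ?_, fun x => ?_⟩
  · rw [hT, real_inner_comm, hT, hsymm]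
  · rw [InnerProductSpace.toDual_symm_apply, hL, hT]; ring

theorem integral_mul_thirdDiff {q g : R3 → ℝ} (hq : Continuous q) (hg : Continuous g)
    (hc : HasCompactSupport g) (h k l a : R3) :
    thirdDiff (fun a => ∫ z, q z * g (z + a)) h k l a = ∫ z, q z * thirdDiff g h k l (z + a) := by
  have hI : ∀ a, Integrable fun z => q z * g (z + a) := fun a =>
    (hq.mul (hg.comp (continuous_add_const a))).integrable_of_hasCompactSupport
      (hc.comp_homeomorph (Homeomorph.addRight a)).mul_left
  simp only [thirdDiff, mul_sub, add_assoc]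
  rw [integral_sub, integral_sub, integral_sub, integral_sub, integral_sub, integral_sub,
    integral_sub]
  all_goals first
    | exact hI _
    | exact (hI _).sub (hI _)
    | exact ((hI _).sub (hI _)).sub ((hI _).sub (hI _))

/-- A function with constant Laplacian that is bounded above by the sum of an integrable and a
linear function has `L¹` averages of quadratic growth. -/
theorem exists_integral_abs_le {p f : R3 → ℝ} (hp : ContDiff ℝ 2 p) {c : ℝ}
    (hc : ∀ x, Δ p x = c) (hf : Integrable f) (hf0 : ∀ y, 0 ≤ f y) {A : ℝ}
    (hA : 0 ≤ A) (hpf : ∀ x, p x ≤ f x + A * (1 + ‖x‖)) :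
    ∃ C, 0 ≤ C ∧ ∀ R : ℝ, 1 ≤ R → ∫ y in closedBall (0 : R3) 1, |p (R • y)| ≤ C * R ^ 2 := by
  obtain ⟨κ, hκ, hκw⟩ := exists_radialWeight_ge
  obtain ⟨S, hS⟩ := hasCompactSupport_radialWeight.exists_bound_of_continuous
    continuous_radialWeight
  have hS0 : 0 ≤ S := (norm_nonneg _).trans (hS 0)
  have hpc := hp.continuous
  have hm := weightMass_pos
  set J := ∫ y, radialBump y
  have hV : 0 ≤ ∫ y, f y := integral_nonneg hf0
  set C := 2 * (S * (∫ y, f y) + A * 3 * weightMass) + weightMass * |p 0| + |c / 2 * J|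
  have hC : 0 ≤ C := by positivity
  refine ⟨C / κ, by positivity, fun R hR => ?_⟩
  have hR0 : 0 < R := by linarith
  have hcR : Continuous fun y : R3 => R • y := continuous_const_smul R
  have hIabs : Integrable fun y => |p (R • y)| * radialWeight y :=
    integrable_mul_radialWeight (hpc.comp hcR).abs
  have hIp : Integrable fun y => p (R • y) * radialWeight y :=
    integrable_mul_radialWeight (hpc.comp hcR)
  have hIf : Integrable fun y => f (R • y) := hf.comp_smul hR0.ne'
  have hIw : Integrable radialWeight := by
    simpa using integrable_mul_radialWeight (a := fun _ => 1) continuous_const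
  have hmv := integral_mul_radialWeight hp hc 0 R
  simp only [zero_add] at hmv
  -- `|p| = 2 p⁺ - p`, and the positive part is controlled by the hypothesis
  have h1 : ∫ y, |p (R • y)| * radialWeight y ≤
      ∫ y, (2 * (S * f (R • y) + A * 3 * R * radialWeight y) - p (R • y) * radialWeight y) := by
    refine integral_mono hIabs
      ((((hIf.const_mul S).add (hIw.const_mul (A * 3 * R))).const_mul 2).sub hIp) fun y => ?_
    have hw := radialWeight_nonneg y
    have hwS : radialWeight y ≤ S := (le_abs_self _).trans (hS y)
    have hb : p (R • y) * radialWeight y ≤ S * f (R • y) + A * 3 * R * radialWeight y := by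
      rcases le_or_gt 2 ‖y‖ with hy | hy
      · rw [radialWeight_eq_zero hy]
        have := mul_nonneg hS0 (hf0 (R • y)); linarith
      · have h2 := hpf (R • y)
        rw [norm_smul, Real.norm_of_nonneg hR0.le] at h2
        have h3 : A * (1 + R * ‖y‖) ≤ A * (3 * R) := by gcongr; nlinarith
        have h4 := mul_le_mul_of_nonneg_right (h2.trans (add_le_add_right h3 _)) hw
        have h5 := mul_le_mul_of_nonneg_left hwS (hf0 (R • y))
        nlinarith
    have h0 : 0 ≤ S * f (R • y) + A * 3 * R * radialWeight y := by
      have := hf0 (R • y); positivity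
    show |p (R • y)| * radialWeight y ≤
      2 * (S * f (R • y) + A * 3 * R * radialWeight y) - p (R • y) * radialWeight y
    rcases abs_cases (p (R • y)) with ⟨h, _⟩ | ⟨h, _⟩ <;> rw [h] <;> nlinarith
  have h2 : ∫ y, f (R • y) ≤ ∫ y, f y := by
    rw [Measure.integral_comp_smul_of_nonneg _ _ _ (hR := hR0.le), smul_eq_mul]
    refine mul_le_of_le_one_left hV (inv_le_one_of_one_le₀ (one_le_pow₀ hR))
  have hI2 : Integrable fun y => 2 * (S * f (R • y) + A * 3 * R * radialWeight y) :=
    ((hIf.const_mul S).add (hIw.const_mul (A * 3 * R))).const_mul 2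
  rw [integral_sub hI2 hIp,
    integral_const_mul, integral_add (hIf.const_mul S) (hIw.const_mul (A * 3 * R)),
    integral_const_mul, integral_const_mul, hmv] at h1
  have h3 : κ * ∫ y in closedBall (0 : R3) 1, |p (R • y)| ≤ ∫ y, |p (R • y)| * radialWeight y := by
    rw [← integral_const_mul]
    refine le_trans (setIntegral_mono_on ?_ hIabs.integrableOn measurableSet_closedBall
      fun y hy => ?_) (setIntegral_le_integral hIabs (Eventually.of_forall fun y => ?_))
    · exact (continuous_const.mul (hpc.comp hcR).abs).continuousOn.integrableOn_compact
        (isCompact_closedBall _ _)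
    · rw [mul_comm]
      exact mul_le_mul_of_nonneg_left (hκw y (by simpa using hy)) (abs_nonneg _)
    · exact mul_nonneg (abs_nonneg _) (radialWeight_nonneg y)
  rw [div_mul_eq_mul_div, le_div_iff₀ hκ, mul_comm _ κ]
  refine h3.trans (h1.trans ?_)
  have hR2 : R ≤ R ^ 2 := by nlinarith
  have hR1 : 1 ≤ R ^ 2 := by nlinarith
  have e1 : S * ∫ y, f (R • y) ≤ S * (∫ y, f y) * R ^ 2 := by
    refine (mul_le_mul_of_nonneg_left h2 hS0).trans ?_
    exact le_mul_of_one_le_right (by positivity) hR1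
  have e2 : A * 3 * R * weightMass ≤ A * 3 * weightMass * R ^ 2 := by
    have : 0 ≤ A * 3 * weightMass := by positivity
    nlinarith
  have e3 : -(weightMass * p 0) ≤ weightMass * |p 0| * R ^ 2 := by
    have h1 := neg_abs_le (p 0)
    have h2 : weightMass * |p 0| ≤ weightMass * |p 0| * R ^ 2 :=
      le_mul_of_one_le_right (by positivity) hR1
    nlinarith
  have e4 : -(c * R ^ 2 / 2 * J) ≤ |c / 2 * J| * R ^ 2 := by
    have h1 := neg_abs_le (c / 2 * J)
    nlinarith
  change 2 * (S * (∫ y, f (R • y)) + A * 3 * R * weightMass) - _ ≤ _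
  simp only [C]
  nlinarith

/-- A function with constant Laplacian that is bounded above by the sum of an integrable and a
linear function is a quadratic polynomial: by the mean value property its third differences can be
moved to the weight at scale `R`, which makes them `O(R⁻³)` times `O(R²)`. -/
theorem exists_quadratic_of_laplacian_eq_const {p f : R3 → ℝ} (hp : ContDiff ℝ 2 p) {c : ℝ}
    (hc : ∀ x, Δ p x = c) (hf : Integrable f) (hf0 : ∀ y, 0 ≤ f y) {A : ℝ}
    (hA : 0 ≤ A) (hpf : ∀ x, p x ≤ f x + A * (1 + ‖x‖)) :
    ∃ (T : R3 →ₗ[ℝ] R3) (w : R3), T.IsSymmetric ∧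
      ∀ x, p x = p 0 + inner ℝ w x + 1 / 2 * inner ℝ (T x) x := by
  refine exists_quadratic_of_thirdDiff hp.continuous fun h k l x => ?_
  obtain ⟨D, hD0, hD⟩ := exists_integral_abs_le hp hc hf hf0 hA hpf
  obtain ⟨C, hC0, hC⟩ := exists_thirdDiff_le (contDiff_radialWeight (n := 3))
    hasCompactSupport_radialWeight (-h) (-k) (-l)
  have hm := weightMass_pos
  -- the third differences are bounded by a multiple of `1 / R`
  have key : ∀ R : ℝ, 1 + ‖x‖ + ‖h‖ + ‖k‖ + ‖l‖ ≤ R →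
      weightMass * |thirdDiff p h k l x| ≤ C * 27 * 9 * D * R⁻¹ := by
    intro R hR
    have hR1 : 1 ≤ R := by linarith [norm_nonneg x, norm_nonneg h, norm_nonneg k, norm_nonneg l]
    have hR0 : 0 < R := by linarith
    have hq : Continuous fun z : R3 => p (R • z) := hp.continuous.comp (continuous_const_smul R)
    -- the mean value property at scale `R`, with the translation moved to the weight
    have hG : ∀ y, weightMass * p y = (∫ z, p (R • z) * radialWeight (z + R⁻¹ • (-y))) -
        c * R ^ 2 / 2 * ∫ y, radialBump y := by
      intro y
      have := integral_mul_radialWeight hp hc y R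
      rw [← integral_add_right_eq_self _ (R⁻¹ • (-y))] at this
      simp only [smul_add, smul_smul, mul_inv_cancel₀ hR0.ne', one_smul,
        add_neg_cancel_comm_assoc] at this
      linarith
    have h1 : weightMass * thirdDiff p h k l x = ∫ z, p (R • z) *
        thirdDiff radialWeight (R⁻¹ • (-h)) (R⁻¹ • (-k)) (R⁻¹ • (-l)) (z + R⁻¹ • (-x)) := by
      rw [← integral_mul_thirdDiff hq continuous_radialWeight hasCompactSupport_radialWeight]
      simp only [thirdDiff, mul_sub, hG, neg_add, smul_add]
      ring
    have hsupp : ∀ z : R3, z ∉ closedBall (0 : R3) 3 → p (R • z) *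
        thirdDiff radialWeight (R⁻¹ • (-h)) (R⁻¹ • (-k)) (R⁻¹ • (-l)) (z + R⁻¹ • (-x)) = 0 := by
      intro z hz
      have hz3 : 3 < ‖z‖ := by simpa using hz
      have hb : ∀ a : R3, ‖a‖ ≤ ‖x‖ + ‖h‖ + ‖k‖ + ‖l‖ → radialWeight (z + R⁻¹ • (-a)) = 0 := by
        intro a ha
        refine radialWeight_eq_zero ?_
        have h2 : ‖R⁻¹ • (-a)‖ ≤ 1 := by
          rw [norm_smul, norm_neg, Real.norm_of_nonneg (by positivity), inv_mul_le_one₀ hR0]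
          linarith
        have := norm_sub_le_norm_add z (R⁻¹ • (-a))
        linarith
      have nx := norm_nonneg x
      have nh := norm_nonneg h
      have nk := norm_nonneg k
      have nl := norm_nonneg l
      have t1 := norm_add_le x l
      have t2 := norm_add_le x k
      have t3 := norm_add_le x h
      have t4 := norm_add_le (x + l) k
      have t5 := norm_add_le (x + l) h
      have t6 := norm_add_le (x + k) h
      have t7 := norm_add_le (x + l + k) h
      simp only [thirdDiff, add_assoc, ← smul_add, ← neg_add]
      simp only [add_assoc] at t4 t5 t6 t7
      rw [hb, hb, hb, hb, hb, hb, hb, hb] <;> linarith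
    have h2 : |weightMass * thirdDiff p h k l x| ≤
        ∫ z in closedBall (0 : R3) 3, C * R⁻¹ ^ 3 * |p (R • z)| := by
      rw [h1, ← setIntegral_eq_integral_of_forall_compl_eq_zero hsupp, ← Real.norm_eq_abs]
      refine norm_integral_le_of_norm_le ?_ (Eventually.of_forall fun z => ?_)
      · exact (continuous_const.mul hq.abs).continuousOn.integrableOn_compact
          (isCompact_closedBall _ _)
      · rw [norm_mul, mul_comm, Real.norm_eq_abs, Real.norm_eq_abs]
        exact mul_le_mul_of_nonneg_right (hC _ (by positivity) _) (abs_nonneg _)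
    have h3 : ∫ z in closedBall (0 : R3) 3, |p (R • z)| =
        27 * ∫ z in closedBall (0 : R3) 1, |p ((3 * R) • z)| := by
      have := Measure.setIntegral_comp_smul_of_pos (volume : Measure R3) (fun z => |p (R • z)|)
        (closedBall (0 : R3) 1) (R := 3) (by norm_num)
      rw [_root_.smul_closedBall _ _ zero_le_one] at this
      simp only [smul_smul, smul_zero, mul_comm R] at this
      rw [this]
      norm_num
      ring
    rw [abs_mul, abs_of_pos hm, integral_const_mul, h3] at h2
    have h4 := hD (3 * R) (by linarith)
    calc _ ≤ _ := h2
      _ ≤ C * R⁻¹ ^ 3 * (27 * (D * (3 * R) ^ 2)) := by gcongr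
      _ = C * 27 * 9 * D * R⁻¹ := by field_simp; ring
  have hlim : Tendsto (fun R : ℝ => C * 27 * 9 * D * R⁻¹) atTop (𝓝 0) := by
    simpa using tendsto_inv_atTop_zero.const_mul (C * 27 * 9 * D)
  have h0 := ge_of_tendsto hlim ((eventually_ge_atTop _).mono key)
  have : |thirdDiff p h k l x| ≤ 0 := by
    by_contra hcon
    exact absurd h0 (not_le.2 (mul_pos hm (not_le.1 hcon)))
  exact abs_nonpos_iff.1 this

/-! ### The polynomial part of a solution -/

/-- The logarithmic potential is bounded below by `-‖f‖₁ log (1 + |x|)`, up to a constant. -/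
theorem exists_logPot_ge {f : R3 → ℝ} (hf : Continuous f) (hfi : Integrable f)
    (hf0 : ∀ y, 0 ≤ f y) :
    ∃ C, 0 ≤ C ∧ ∀ x, -((∫ y, f y) * Real.log (1 + ‖x‖)) - C ≤ logPot f x := by
  have hi : Integrable fun y => ‖y‖⁻¹ * f y := by
    simpa using integrable_inv_norm_mul hf hfi hf0 0
  refine ⟨∫ y, ‖y‖⁻¹ * f y, integral_nonneg fun y => mul_nonneg (by positivity) (hf0 y),
    fun x => ?_⟩
  have h1 : -((∫ y, f y) * Real.log (1 + ‖x‖)) - ∫ y, ‖y‖⁻¹ * f y =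
      ∫ y, (-(Real.log (1 + ‖x‖)) * f y - ‖y‖⁻¹ * f y) := by
    rw [integral_sub (hfi.const_mul _) hi, integral_const_mul]
    ring
  rw [h1, logPot]
  refine integral_mono_ae ((hfi.const_mul _).sub hi) (integrable_log_mul hf hfi hf0 x) ?_
  filter_upwards [ae_ne 0, ae_ne x] with y hy hyx
  have hy0 : 0 < ‖y‖ := norm_pos_iff.2 hy
  have hxy : 0 < ‖x - y‖ := norm_pos_iff.2 (sub_ne_zero.2 hyx.symm)
  have hb : -Real.log (1 + ‖x‖) - ‖y‖⁻¹ ≤ Real.log (‖y‖ / ‖x - y‖) := by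
    have h2 : ‖x - y‖ ≤ (1 + ‖x‖) * (1 + ‖y‖) := by
      nlinarith [norm_sub_le x y, norm_nonneg x]
    have h3 := Real.log_le_log hxy h2
    rw [Real.log_mul (by positivity) (by positivity)] at h3
    have h4 : Real.log (1 + ‖y‖) - Real.log ‖y‖ ≤ ‖y‖⁻¹ := by
      rw [← Real.log_div (by positivity) hy0.ne']
      refine (Real.log_le_sub_one_of_pos (by positivity)).trans (le_of_eq ?_)
      field_simp
      ring
    rw [Real.log_div hy0.ne' hxy.ne']
    linarith
  have := mul_le_mul_of_nonneg_right hb (hf0 y)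
  simpa [sub_mul] using this

/-- A function with constant Laplacian bounded by a logarithm plus a nonnegative integrable
function is bounded by a logarithm. -/
theorem exists_le_log {p f : R3 → ℝ} (hp : ContDiff ℝ 2 p) {c : ℝ} (hc : ∀ x, Δ p x = c)
    (hf : Integrable f) (hf0 : ∀ y, 0 ≤ f y) {A C : ℝ} (hA : 0 ≤ A)
    (hpf : ∀ x, p x ≤ f x + A * Real.log (1 + ‖x‖) + C) :
    ∃ D, ∀ x, p x ≤ A * Real.log (1 + ‖x‖) + D := by
  obtain ⟨S, hS⟩ := hasCompactSupport_radialWeight.exists_bound_of_continuous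
    continuous_radialWeight
  have hm := weightMass_pos
  have hS0 : 0 ≤ S := (norm_nonneg _).trans (hS 0)
  set J := ∫ y, radialBump y
  set V := ∫ y, f y
  refine ⟨weightMass⁻¹ * (S * V - c / 2 * J) + A * Real.log 3 + C, fun x => ?_⟩
  have hmv := integral_mul_radialWeight hp hc x 1
  simp only [one_smul] at hmv
  set B := A * (Real.log 3 + Real.log (1 + ‖x‖)) + C
  have hIw : Integrable radialWeight := by
    simpa using integrable_mul_radialWeight (a := fun _ => 1) continuous_const
  have hIf : Integrable fun y => f (x + y) := hf.comp_add_left x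
  have h1 : ∫ y, p (x + y) * radialWeight y ≤ ∫ y, (S * f (x + y) + B * radialWeight y) := by
    refine integral_mono (integrable_mul_radialWeight (hp.continuous.comp
      (continuous_const.add continuous_id))) ((hIf.const_mul S).add (hIw.const_mul B)) fun y => ?_
    have hw := radialWeight_nonneg y
    have hwS : radialWeight y ≤ S := (le_abs_self _).trans (hS y)
    have h5 := mul_le_mul_of_nonneg_left hwS (hf0 (x + y))
    show p (x + y) * radialWeight y ≤ S * f (x + y) + B * radialWeight y
    rcases le_or_gt 2 ‖y‖ with hy | hy
    · rw [radialWeight_eq_zero hy]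
      have := mul_nonneg hS0 (hf0 (x + y)); linarith
    · have h2 : Real.log (1 + ‖x + y‖) ≤ Real.log 3 + Real.log (1 + ‖x‖) := by
        rw [← Real.log_mul (by norm_num) (by positivity)]
        refine Real.log_le_log (by positivity) ?_
        linarith [norm_add_le x y, norm_nonneg x]
      have h3 : p (x + y) ≤ f (x + y) + B := by
        have := mul_le_mul_of_nonneg_left h2 hA
        have := hpf (x + y)
        simp only [B]; linarith
      nlinarith
  rw [integral_add (hIf.const_mul S) (hIw.const_mul B), integral_const_mul, integral_const_mul,
    integral_add_left_eq_self, hmv] at h1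
  have h2 : weightMass * p x ≤ S * V - c / 2 * J + B * weightMass := by
    have h3 : ∫ y, radialWeight y = weightMass := rfl
    rw [h3] at h1
    simp only [one_pow, mul_one] at h1
    linarith
  have h3 : p x ≤ weightMass⁻¹ * (S * V - c / 2 * J + B * weightMass) := by
    rw [le_inv_mul_iff₀ hm]; exact h2
  refine h3.trans (le_of_eq ?_)
  simp only [B]
  field_simp
  ring

/-- A degenerate direction of a semidefinite quadratic form lies in its kernel. -/
theorem inner_eq_zero_of_nonpos {T : R3 →ₗ[ℝ] R3} (hT : T.IsSymmetric)
    (hT0 : ∀ x, inner ℝ (T x) x ≤ 0) {x : R3} (hx : inner ℝ (T x) x = 0) : T x = 0 := by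
  have key : ∀ y, inner ℝ (T x) y = 0 := by
    intro y
    have h : ∀ s : ℝ, 2 * s * inner ℝ (T x) y + s ^ 2 * inner ℝ (T y) y ≤ 0 := by
      intro s
      have := hT0 (x + s • y)
      rw [map_add, map_smul, inner_add_left, inner_add_right, inner_add_right, inner_smul_left,
        inner_smul_left, inner_smul_right, inner_smul_right, hx, hT y x,
        real_inner_comm (T x) y] at this
      simp only [conj_trivial] at this
      linarith
    have hy := hT0 y
    set a := inner ℝ (T x) y
    set b := inner ℝ (T y) y
    have h1 := h (a / (1 - b))
    have h2 : 2 * (a / (1 - b)) * a + (a / (1 - b)) ^ 2 * b = a ^ 2 * (2 - b) / (1 - b) ^ 2 := by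
      have : 1 - b ≠ 0 := by linarith
      field_simp; ring
    rw [h2] at h1
    by_contra ha
    have : 0 < a ^ 2 * (2 - b) / (1 - b) ^ 2 := by
      have : 0 < 1 - b := by linarith
      have : 0 < 2 - b := by linarith
      positivity
    linarith
  exact inner_self_eq_zero.1 (key (T x))

/-- A quadratic polynomial of logarithmic growth from above attains its maximum. -/
theorem exists_center_of_le_log {T : R3 →ₗ[ℝ] R3} {w : R3} (hT : T.IsSymmetric) {p0 A D : ℝ} (hA : 0 ≤ A)
    (h : ∀ x, p0 + inner ℝ w x + 1 / 2 * inner ℝ (T x) x ≤ A * Real.log (1 + ‖x‖) + D) :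
    (∀ x, inner ℝ (T x) x ≤ 0) ∧ ∃ (x₀ : R3) (q : ℝ), ∀ x,
      p0 + inner ℝ w x + 1 / 2 * inner ℝ (T x) x = q + 1 / 2 * inner ℝ (T (x - x₀)) (x - x₀) := by
  have hlog : ∀ b : ℝ, Tendsto (fun t : ℝ => (A * (Real.log t + b) + D - p0) / t) atTop (𝓝 0) := by
    intro b
    have h1 : Tendsto (fun t : ℝ => Real.log t / t) atTop (𝓝 0) :=
      Real.isLittleO_log_id_atTop.tendsto_div_nhds_zero
    have h2 := (h1.const_mul A).add (tendsto_inv_atTop_zero.const_mul (A * b + D - p0))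
    rw [mul_zero, mul_zero, add_zero] at h2
    refine h2.congr fun t => ?_
    ring
  have hray : ∀ x (t : ℝ), 1 ≤ t → p0 + t * inner ℝ w x + 1 / 2 * (t ^ 2 * inner ℝ (T x) x) ≤
      A * (Real.log t + Real.log (1 + ‖x‖)) + D := by
    intro x t ht
    have h1 := h (t • x)
    rw [map_smul, inner_smul_left, inner_smul_right, inner_smul_right, norm_smul] at h1
    simp only [conj_trivial, Real.norm_of_nonneg (zero_le_one.trans ht)] at h1
    have h2 : Real.log (1 + t * ‖x‖) ≤ Real.log t + Real.log (1 + ‖x‖) := by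
      rw [← Real.log_mul (by positivity) (by positivity)]
      exact Real.log_le_log (by positivity) (by linarith)
    have := mul_le_mul_of_nonneg_left h2 hA
    linarith
  have hquad : ∀ x, inner ℝ (T x) x ≤ 0 := by
    intro x
    have h1 := ((hlog (Real.log (1 + ‖x‖))).sub_const (inner ℝ w x)).mul
      (tendsto_inv_atTop_zero.const_mul 2)
    rw [mul_zero, mul_zero] at h1
    refine ge_of_tendsto h1 ?_
    filter_upwards [eventually_ge_atTop 1] with t ht
    have := hray x t ht
    have ht0 : 0 < t := by linarith
    have e : ((A * (Real.log t + Real.log (1 + ‖x‖)) + D - p0) / t - inner ℝ w x) * (2 * t⁻¹) =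
        2 * (A * (Real.log t + Real.log (1 + ‖x‖)) + D - p0 - t * inner ℝ w x) / t ^ 2 := by
      field_simp
    rw [e, le_div_iff₀ (by positivity)]
    linarith
  have hlin : ∀ x, inner ℝ (T x) x = 0 → inner ℝ w x ≤ 0 := by
    intro x hx
    refine ge_of_tendsto (hlog (Real.log (1 + ‖x‖))) ?_
    filter_upwards [eventually_ge_atTop 1] with t ht
    have := hray x t ht
    rw [hx] at this
    rw [le_div_iff₀ (by linarith)]
    linarith
  refine ⟨hquad, ?_⟩
  -- `w` is orthogonal to the kernel of `T`, hence in its range, and the square can be completed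
  have hw : w ∈ LinearMap.range T := by
    have h1 : (LinearMap.range T)ᗮ = LinearMap.ker T := hT.orthogonal_range
    rw [← Submodule.orthogonal_orthogonal (LinearMap.range T), h1, Submodule.mem_orthogonal']
    intro x hx
    rw [LinearMap.mem_ker] at hx
    refine le_antisymm (hlin x (by rw [hx, inner_zero_left])) ?_
    have := hlin (-x) (by rw [map_neg, hx, neg_zero, inner_zero_left])
    rwa [inner_neg_right, neg_nonpos] at this
  obtain ⟨z, hz⟩ := hw
  refine ⟨-z, p0 - 1 / 2 * inner ℝ (T z) z, fun x => ?_⟩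
  have e : inner ℝ (T x) z = inner ℝ (T z) x := by rw [hT x z, real_inner_comm]
  rw [sub_neg_eq_add, map_add, inner_add_left, inner_add_right, inner_add_right, ← hz, e]
  ring

theorem fderiv_quadratic {T : R3 →ₗ[ℝ] R3} (hT : T.IsSymmetric) (x₀ : R3) (q : ℝ) (x : R3) :
    HasFDerivAt (fun x => q + 1 / 2 * inner ℝ (T (x - x₀)) (x - x₀))
      (innerSL ℝ (T (x - x₀))) x := by
  have h1 : HasFDerivAt (fun x => x - x₀) (ContinuousLinearMap.id ℝ R3) x :=
    (hasFDerivAt_id x).sub_const x₀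
  have h2 : HasFDerivAt (fun x => T (x - x₀)) (LinearMap.toContinuousLinearMap T) x := by
    have := (LinearMap.toContinuousLinearMap T).hasFDerivAt.comp x h1
    exact this.congr_fderiv (by ext; simp)
  refine (((h2.inner ℝ h1).const_mul (1 / 2)).const_add q).congr_fderiv ?_
  ext y
  have e : inner ℝ (T y) (x - x₀) = inner ℝ (T (x - x₀)) y := by
    rw [hT y (x - x₀), real_inner_comm]
  simp [e]
  rw [inner_sub_left]
  ring

theorem laplacian_quadratic {T : R3 →ₗ[ℝ] R3} (hT : T.IsSymmetric) (x₀ : R3) (q : ℝ) (x : R3) :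
    Δ (fun x => q + 1 / 2 * inner ℝ (T (x - x₀)) (x - x₀)) x =
      ∑ i : Fin 3, inner ℝ (T (EuclideanSpace.single i 1)) (EuclideanSpace.single i 1) := by
  have hTc : Continuous T := (LinearMap.toContinuousLinearMap T).continuous
  have hTs : ContDiff ℝ 2 T := (LinearMap.toContinuousLinearMap T).contDiff
  have hs : ContDiff ℝ 2 (fun x => q + 1 / 2 * inner ℝ (T (x - x₀)) (x - x₀)) :=
    contDiff_const.add (contDiff_const.mul ((hTs.comp (contDiff_id.sub contDiff_const)).inner ℝ
      (contDiff_id.sub contDiff_const)))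
  rw [laplacian_eq_sum_fderiv hs]
  refine Finset.sum_congr rfl fun i _ => ?_
  have h1 : (fun z => fderiv ℝ (fun x => q + 1 / 2 * inner ℝ (T (x - x₀)) (x - x₀)) z
      (EuclideanSpace.single i 1)) = fun z => inner ℝ (T (EuclideanSpace.single i 1)) (z - x₀) := by
    funext z
    rw [(fderiv_quadratic hT x₀ q z).fderiv]
    simp only [innerSL_apply_apply]
    rw [hT, real_inner_comm]
  rw [h1]
  have h2 : HasFDerivAt (fun z => inner ℝ (T (EuclideanSpace.single i 1)) (z - x₀))
      (innerSL ℝ (T (EuclideanSpace.single i 1))) x := by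
    have := (innerSL ℝ (T (EuclideanSpace.single i 1))).hasFDerivAt.comp x
      ((hasFDerivAt_id x).sub_const x₀)
    exact this
  rw [h2.fderiv, innerSL_apply_apply]
  
/-- A negative semidefinite symmetric map of trace zero vanishes. -/
theorem eq_zero_of_sum_inner_eq_zero {T : R3 →ₗ[ℝ] R3} (hT : T.IsSymmetric)
    (hT0 : ∀ x, inner ℝ (T x) x ≤ 0)
    (h : ∑ i : Fin 3, inner ℝ (T (EuclideanSpace.single i 1)) (EuclideanSpace.single i (1 : ℝ)) = 0) :
    T = 0 := by
  have h1 := (Finset.sum_eq_zero_iff_of_nonpos fun i _ => hT0 _).1 h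
  ext1 x
  rw [← sum_coord_smul_single x, map_sum]
  simp only [map_smul]
  rw [Finset.sum_eq_zero fun i _ => by
    rw [inner_eq_zero_of_nonpos hT hT0 (h1 i (Finset.mem_univ i)), smul_zero]]
  rfl

theorem exists_mvPolynomial_quadratic (T : R3 →ₗ[ℝ] R3) (x₀ : R3) (q : ℝ) :
    ∃ P : MvPolynomial (Fin 3) ℝ, ∀ x : R3, MvPolynomial.eval (fun i => x i) P =
      q + 1 / 2 * inner ℝ (T (x - x₀)) (x - x₀) := by
  let Y : Fin 3 → MvPolynomial (Fin 3) ℝ := fun i => MvPolynomial.X i - MvPolynomial.C (x₀ i)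
  refine ⟨MvPolynomial.C q + MvPolynomial.C (1 / 2) * ∑ i, ∑ j, MvPolynomial.C
    (inner ℝ (T (EuclideanSpace.single i 1)) (EuclideanSpace.single j 1)) * Y i * Y j, fun x => ?_⟩
  conv_rhs => rw [← sum_coord_smul_single (x - x₀), map_sum, sum_inner]
  simp only [inner_sum, map_smul, inner_smul_left, inner_smul_right]
  simp only [map_add, map_mul, map_sum, MvPolynomial.eval_C, Y, map_sub, MvPolynomial.eval_X,
    PiLp.sub_apply, conj_trivial]
  congr 2
  refine Finset.sum_congr rfl fun i _ => Finset.sum_congr rfl fun j _ => by ring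

theorem totalDegree_eq_zero_of_eval_const {P : MvPolynomial (Fin 3) ℝ} {q : ℝ}
    (h : ∀ x : R3, MvPolynomial.eval (fun i => x i) P = q) : P.totalDegree = 0 := by
  have : P = MvPolynomial.C q := MvPolynomial.funext fun x => by
    simpa using h (WithLp.toLp 2 x)
  rw [this, MvPolynomial.totalDegree_C]

/-- A solution is the sum of its logarithmic potential and a quadratic polynomial with a maximum,
and its Laplacian is the sum of a Riesz potential and the trace of the quadratic form. -/
theorem exists_decomposition {u : R3 → ℝ}
    (hu : IsSmoothSolution u (fun x => 2 * Real.exp (3 * u x)))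
    (hV : Integrable fun x => Real.exp (3 * u x)) :
    ∃ (T : R3 →ₗ[ℝ] R3) (x₀ : R3) (q : ℝ), T.IsSymmetric ∧ (∀ x, inner ℝ (T x) x ≤ 0) ∧
      (∀ x, u x = logPotential u x + (q + 1 / 2 * inner ℝ (T (x - x₀)) (x - x₀))) ∧
      ∀ x, Δ u x = -(1 / Real.pi ^ 2 * rieszPot (fun y => Real.exp (3 * u y)) x) +
        ∑ i : Fin 3, inner ℝ (T (EuclideanSpace.single i 1)) (EuclideanSpace.single i 1) := by
  set f : R3 → ℝ := fun x => Real.exp (3 * u x) with hfdef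
  have hus : ContDiff ℝ 2 u := contDiff_infty.1 hu.smooth 2
  have hf : Continuous f := Real.continuous_exp.comp (continuous_const.mul hu.smooth.continuous)
  have hf0 : ∀ y, 0 ≤ f y := fun y => (Real.exp_pos _).le
  have hπ : 0 < 1 / Real.pi ^ 2 := by positivity
  have hLs : ContDiff ℝ 2 (logPot f) := contDiff_logPot hf hV hf0
  have hLs' : ContDiff ℝ 2 (logPotential u) := contDiff_const.mul hLs
  obtain ⟨c, hc⟩ := exists_laplacian_eq hu hf hV hf0
  set p : R3 → ℝ := fun x => u x - logPotential u x with hpdef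
  have hps : ContDiff ℝ 2 p := hus.sub hLs'
  have hΔL : ∀ x, Δ (logPotential u) x = -(1 / Real.pi ^ 2 * rieszPot f x) := by
    intro x
    have : logPotential u = (1 / Real.pi ^ 2) • logPot f := rfl
    rw [this, InnerProductSpace.laplacian_smul _ hLs.contDiffAt, smul_eq_mul,
      laplacian_logPot hf hV hf0]
    ring
  have hpc : ∀ x, Δ p x = c := by
    intro x
    have h1 : u = p + logPotential u := by funext x; simp [p]
    have h2 := hc x
    rw [h1, hps.contDiffAt.laplacian_add hLs'.contDiffAt, hΔL, ← h1] at h2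
    linarith
  obtain ⟨C, hC0, hC⟩ := exists_logPot_ge hf hV hf0
  set A := 1 / Real.pi ^ 2 * ∫ y, f y
  have hA : 0 ≤ A := mul_nonneg hπ.le (integral_nonneg hf0)
  -- upper bound for `p`: `u ≤ e^{3u}`, and the potential is at least `-C log`
  have hup : ∀ x, p x ≤ f x + A * Real.log (1 + ‖x‖) + 1 / Real.pi ^ 2 * C := by
    intro x
    have h1 : u x ≤ f x := by
      have := Real.add_one_le_exp (3 * u x)
      have := Real.exp_pos (3 * u x)
      simp only [f]
      nlinarith
    have h2 := mul_le_mul_of_nonneg_left (hC x) hπ.le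
    have h3 : logPotential u x = 1 / Real.pi ^ 2 * logPot f x := rfl
    simp only [p, A]
    rw [h3]
    nlinarith
  obtain ⟨T, w, hT, hTp⟩ := exists_quadratic_of_laplacian_eq_const (p := p) (f := f)
    (A := A + 1 / Real.pi ^ 2 * C) hps hpc hV hf0 (by positivity) (fun x => by
      have h1 := Real.log_le_sub_one_of_pos (show 0 < 1 + ‖x‖ by positivity)
      have h2 := hup x
      have h3 := mul_le_mul_of_nonneg_left h1 hA
      have h4 : 0 ≤ 1 / Real.pi ^ 2 * C * ‖x‖ := by positivity
      nlinarith)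
  obtain ⟨D, hD⟩ := exists_le_log hps hpc hV hf0 hA hup
  obtain ⟨hT0, x₀, q, hq⟩ := exists_center_of_le_log hT hA (p0 := p 0) (w := w)
    fun x => (hTp x).symm.le.trans (hD x)
  have hpq : p = fun x => q + 1 / 2 * inner ℝ (T (x - x₀)) (x - x₀) :=
    funext fun x => (hTp x).trans (hq x)
  refine ⟨T, x₀, q, hT, hT0, fun x => ?_, fun x => ?_⟩
  · have := congrFun hpq x
    rw [← this]; simp [p]
  · have h1 := hpc 0
    rw [hpq, laplacian_quadratic hT] at h1
    rw [hc, h1]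

/-! ### Behaviour at infinity -/

instance : IsCountablyGenerated (cocompact R3) := by
  rw [← Metric.cobounded_eq_cocompact, ← comap_norm_atTop]
  infer_instance

theorem tendsto_norm_cocompact_R3 : Tendsto (fun x : R3 => ‖x‖) (cocompact R3) atTop :=
  tendsto_norm_cocompact_atTop

theorem exists_integral_compl_le {f : R3 → ℝ} (hfi : Integrable f) {ε : ℝ} (hε : 0 < ε) :
    ∃ R, 0 ≤ R ∧ ∫ y in (closedBall (0 : R3) R)ᶜ, f y ≤ ε := by
  have h1 := tendsto_setIntegral_of_monotone (μ := volume) (f := f)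
    (s := fun n : ℕ => closedBall (0 : R3) n) (fun n => measurableSet_closedBall)
    (fun a b hab => closedBall_subset_closedBall (by exact_mod_cast hab)) hfi.integrableOn
  rw [iUnion_closedBall_nat, setIntegral_univ] at h1
  obtain ⟨n, hn⟩ := (h1.eventually_const_lt (sub_lt_self (∫ y, f y) hε)).exists
  refine ⟨n, n.cast_nonneg, ?_⟩
  have := integral_add_compl (measurableSet_closedBall (x := (0 : R3)) (ε := n)) hfi
  linarith

/-- The contribution of the unit ball around `x` to `logPot f x`. -/
def nearPot (f : R3 → ℝ) (x : R3) : ℝ := ∫ y, Real.posLog ‖x - y‖⁻¹ * f y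

theorem posLog_le_self {t : ℝ} (ht : 0 ≤ t) : Real.posLog t ≤ t :=
  max_le ht (Real.log_le_self ht)

theorem integral_indicator_inv_norm_sub (x : R3) {r : ℝ} (hr : 0 < r) :
    Integrable (fun y => (ball (0 : R3) r).indicator (fun z => ‖z‖⁻¹) (x - y)) ∧
    ∫ y, (ball (0 : R3) r).indicator (fun z => ‖z‖⁻¹) (x - y) = r ^ 2 * poleMass 1 := by
  constructor
  · have := integrableOn_ball_norm_rpow (s := 1) (by norm_num) r
    simp only [Real.rpow_neg_one] at this
    exact (this.integrable_indicator measurableSet_ball).comp_sub_left x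
  · rw [integral_sub_left_eq_self _ volume x, integral_indicator measurableSet_ball, poleMass]
    have := Measure.setIntegral_comp_smul_of_pos (volume : Measure R3) (fun z => ‖z‖⁻¹)
      (ball (0 : R3) 1) hr
    rw [smul_unitBall hr.ne', Real.norm_of_nonneg hr.le] at this
    simp only [norm_smul, Real.norm_of_nonneg hr.le, mul_inv, integral_const_mul,
      finrank_euclideanSpace, Fintype.card_fin, smul_eq_mul] at this
    simp only [Real.rpow_neg_one]
    field_simp at this ⊢
    linarith

section
variable {f : R3 → ℝ} (hf : Continuous f) (hfi : Integrable f) (hf0 : ∀ y, 0 ≤ f y)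
include hf hfi hf0

theorem integrable_posLog_mul (x : R3) : Integrable fun y => Real.posLog ‖x - y‖⁻¹ * f y := by
  refine (integrable_inv_norm_mul hf hfi hf0 x).mono' ?_ (Eventually.of_forall fun y => ?_)
  · refine AEStronglyMeasurable.mul ?_ hfi.1
    exact (Real.continuous_posLog.measurable.comp
      (measurable_norm.comp (measurable_const.sub measurable_id)).inv).aestronglyMeasurable
  · rw [norm_mul, Real.norm_of_nonneg Real.posLog_nonneg, Real.norm_of_nonneg (hf0 y)]
    exact mul_le_mul_of_nonneg_right (posLog_le_self (by positivity)) (hf0 y)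

/-- Away from the local contribution, the logarithmic potential decays like
`-‖f‖₁ log (1 + |x|)`. -/
theorem exists_logPot_le {ε : ℝ} (hε : 0 < ε) :
    ∃ C, ∀ x, logPot f x ≤ -(((∫ y, f y) - ε) * Real.log (1 + ‖x‖)) + C + nearPot f x := by
  -- up to the mass `ε / 2` the density `f` lives in the ball of radius `R`, where `log (|y| / |x - y|)`
  -- is at most `C - log (1 + |x|)`; the mass outside contributes at most `ε / 2 * log (1 + |x|)`
  obtain ⟨R, hR, hRε⟩ := exists_integral_compl_le hfi (half_pos hε)
  refine ⟨(Real.log (1 + R) + Real.log (2 + R)) * ∫ y, f y, fun x => ?_⟩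
  set L := Real.log (1 + ‖x‖)
  have hL : 0 ≤ L := Real.log_nonneg (by linarith [norm_nonneg x])
  have h1R : 0 ≤ Real.log (1 + R) := Real.log_nonneg (by linarith)
  have h2R : 0 ≤ Real.log (2 + R) := Real.log_nonneg (by linarith)
  set g : R3 → ℝ := (closedBall (0 : R3) R)ᶜ.indicator f
  have hg : Integrable g := hfi.indicator measurableSet_closedBall.compl
  have hgint : ∫ y, g y = ∫ y in (closedBall (0 : R3) R)ᶜ, f y :=
    integral_indicator measurableSet_closedBall.compl
  have hN := integrable_posLog_mul hf hfi hf0 x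
  have hI1 : Integrable fun y => ((Real.log (1 + R) + Real.log (2 + R)) - L) * f y :=
    hfi.const_mul _
  have hI2 : Integrable fun y => 2 * L * g y := hg.const_mul _
  have hI3 : Integrable fun y => ((Real.log (1 + R) + Real.log (2 + R)) - L) * f y + 2 * L * g y :=
    hI1.add hI2
  have hle : logPot f x ≤ ∫ y, (((Real.log (1 + R) + Real.log (2 + R)) - L) * f y + 2 * L * g y
      + Real.posLog ‖x - y‖⁻¹ * f y) := by
    rw [logPot]
    refine integral_mono_ae (integrable_log_mul hf hfi hf0 x) (hI3.add hN) ?_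
    filter_upwards [ae_ne 0, ae_ne x] with y hy hyx
    have hy0 : 0 < ‖y‖ := norm_pos_iff.2 hy
    have hxy : 0 < ‖x - y‖ := norm_pos_iff.2 (sub_ne_zero.2 hyx.symm)
    have hm : 0 < max 1 ‖x - y‖ := lt_max_of_lt_left one_pos
    have hsplit : Real.log (‖y‖ / ‖x - y‖) =
        Real.log ‖y‖ - Real.log (max 1 ‖x - y‖) + Real.posLog ‖x - y‖⁻¹ := by
      rw [Real.log_div hy0.ne' hxy.ne', ← Real.posLog_eq_log_max_one hxy.le,
        ← Real.posLog_sub_posLog_inv (x := ‖x - y‖)]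
      ring
    have hk1 : Real.log ‖y‖ - Real.log (max 1 ‖x - y‖) ≤ L := by
      have h1 : ‖y‖ ≤ (1 + ‖x‖) * max 1 ‖x - y‖ := by
        have h2 : ‖y‖ ≤ ‖x‖ + ‖x - y‖ := by
          have := norm_sub_le x (x - y); simpa using this
        nlinarith [le_max_left 1 ‖x - y‖, le_max_right 1 ‖x - y‖, norm_nonneg x]
      have := Real.log_le_log hy0 h1
      rw [Real.log_mul (by positivity) hm.ne'] at this
      linarith
    have hk2 : ‖y‖ ≤ R → Real.log ‖y‖ - Real.log (max 1 ‖x - y‖) ≤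
        Real.log (1 + R) + Real.log (2 + R) - L := by
      intro hyR
      have h1 : 1 + ‖x‖ ≤ (2 + R) * max 1 ‖x - y‖ := by
        have h2 : ‖x‖ ≤ ‖x - y‖ + ‖y‖ := by
          have := norm_add_le (x - y) y; simpa using this
        nlinarith [le_max_left 1 ‖x - y‖, le_max_right 1 ‖x - y‖]
      have h3 := Real.log_le_log (by positivity) h1
      rw [Real.log_mul (by positivity) hm.ne'] at h3
      have h4 := Real.log_le_log hy0 (show ‖y‖ ≤ 1 + R by linarith)
      linarith
    show Real.log (‖y‖ / ‖x - y‖) * f y ≤ _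
    have hfy := hf0 y
    rw [hsplit, add_mul]
    refine add_le_add_left ?_ _
    by_cases hyR : ‖y‖ ≤ R
    · have : g y = 0 := indicator_of_notMem (by simpa using hyR) f
      rw [this, mul_zero, add_zero]
      exact mul_le_mul_of_nonneg_right (hk2 hyR) hfy
    · have : g y = f y := indicator_of_mem (by simpa using hyR) f
      rw [this]
      nlinarith
  rw [integral_add hI3 hN, integral_add hI1 hI2, integral_const_mul, integral_const_mul,
    hgint] at hle
  change _ ≤ _ + nearPot f x at hle
  have : 2 * L * ∫ y in (closedBall (0 : R3) R)ᶜ, f y ≤ 2 * L * (ε / 2) := by gcongr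
  nlinarith

/-- The contribution of the unit ball, split at the radius `ρ`: outside the kernel is at most
`log (1 / ρ)`, inside `f` is at most `S`. -/
theorem nearPot_le {x : R3} {ρ S : ℝ} (hρ : 0 < ρ) (hρ1 : ρ ≤ 1)
    (hS : ∀ y ∈ ball x ρ, f y ≤ S) :
    nearPot f x ≤ Real.log ρ⁻¹ * (∫ y in ball x 1, f y) + S * ρ ^ 3 * poleMass 1 := by
  have hS0 : 0 ≤ S := (hf0 x).trans (hS x (mem_ball_self hρ))
  set g : R3 → ℝ := (ball (0 : R3) ρ).indicator fun z => ‖z‖⁻¹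
  obtain ⟨hgx, hgint⟩ := integral_indicator_inv_norm_sub x hρ
  set b : R3 → ℝ := (ball x 1).indicator f
  have hb : Integrable b := hfi.indicator measurableSet_ball
  have hbint : ∫ y, b y = ∫ y in ball x 1, f y := integral_indicator measurableSet_ball
  have hlogρ : 0 ≤ Real.log ρ⁻¹ := Real.log_nonneg ((one_le_inv₀ hρ).2 hρ1)
  have hle : nearPot f x ≤ ∫ y, (Real.log ρ⁻¹ * b y + S * ρ * g (x - y)) := by
    refine integral_mono (integrable_posLog_mul hf hfi hf0 x)
      ((hb.const_mul _).add (hgx.const_mul _)) fun y => ?_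
    have hfy := hf0 y
    have hb0 : 0 ≤ b y := indicator_nonneg (fun y _ => hf0 y) y
    have hg0 : 0 ≤ g (x - y) := indicator_nonneg (fun z _ => inv_nonneg.2 (norm_nonneg z)) _
    show Real.posLog ‖x - y‖⁻¹ * f y ≤ Real.log ρ⁻¹ * b y + S * ρ * g (x - y)
    by_cases hy1 : y ∈ ball x 1
    · have hby : b y = f y := indicator_of_mem hy1 f
      rw [hby]
      by_cases hyρ : y ∈ ball x ρ
      · have hgy : g (x - y) = ‖x - y‖⁻¹ := indicator_of_mem (by
          rwa [mem_ball_zero_iff, ← dist_eq_norm, dist_comm]) _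
        rw [hgy]
        have h1 : Real.posLog ‖x - y‖⁻¹ ≤ Real.log ρ⁻¹ + ρ * ‖x - y‖⁻¹ := by
          have h2 : ‖x - y‖⁻¹ = ρ⁻¹ * (ρ * ‖x - y‖⁻¹) := by field_simp
          have h3 := Real.posLog_mul (x := ρ⁻¹) (y := ρ * ‖x - y‖⁻¹)
          have h6 : Real.posLog ρ⁻¹ = Real.log ρ⁻¹ := Real.posLog_eq_log (by
            rw [abs_of_pos (by positivity)]; exact (one_le_inv₀ hρ).2 hρ1)
          rw [← h2, h6] at h3
          have := posLog_le_self (t := ρ * ‖x - y‖⁻¹) (by positivity)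
          linarith
        have h4 := hS y hyρ
        have h5 : 0 ≤ ρ * ‖x - y‖⁻¹ := by positivity
        nlinarith [mul_le_mul_of_nonneg_right h1 hfy, mul_le_mul_of_nonneg_left h4 h5]
      · have h1 : Real.posLog ‖x - y‖⁻¹ ≤ Real.log ρ⁻¹ := by
          have h2 : ρ ≤ ‖x - y‖ := by
            rw [← dist_eq_norm, dist_comm]; simpa using hyρ
          refine max_le hlogρ ?_
          have : 0 < ‖x - y‖ := hρ.trans_le h2
          exact Real.log_le_log (by positivity) (inv_anti₀ hρ h2)
        have : 0 ≤ S * ρ * g (x - y) := by positivity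
        nlinarith [mul_le_mul_of_nonneg_right h1 hfy]
    · have h1 : Real.posLog ‖x - y‖⁻¹ = 0 := by
        rw [Real.posLog_eq_zero_iff, abs_of_nonneg (by positivity)]
        refine inv_le_one_of_one_le₀ ?_
        rw [← dist_eq_norm, dist_comm]; simpa using hy1
      rw [h1, zero_mul]
      positivity
  rw [integral_add (hb.const_mul _) (hgx.const_mul _), integral_const_mul, integral_const_mul,
    hbint, hgint] at hle
  linarith

/-- Riesz potentials of a bounded integrable function vanishing at infinity vanish at infinity. -/
theorem tendsto_integral_rpow_mul {s S : ℝ} (hs0 : 0 < s) (hs : s < 3) (hS : ∀ y, f y ≤ S)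
    (hlim : Tendsto f (cocompact R3) (𝓝 0)) :
    Tendsto (fun x => ∫ y, ‖x - y‖ ^ (-s) * f y) (cocompact R3) (𝓝 0) := by
  have hsplit : ∀ x, ∫ y, ‖x - y‖ ^ (-s) * f y =
      (∫ z in ball (0 : R3) 1, ‖z‖ ^ (-s) * f (x - z)) +
        ∫ y in (ball x 1)ᶜ, ‖x - y‖ ^ (-s) * f y := by
    intro x
    have hI := (rieszPotential_bound hs0.le hs hfi hf0 (x := x) (S := S) fun y _ => hS y).1
    rw [← integral_add_compl (measurableSet_ball (x := x) (ε := 1)) hI]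
    congr 1
    rw [← integral_indicator measurableSet_ball, ← integral_indicator measurableSet_ball,
      ← integral_sub_left_eq_self _ volume x]
    refine integral_congr_ae (Eventually.of_forall fun z => ?_)
    simp only [indicator, mem_ball, dist_eq_norm, sub_sub_cancel_left, norm_neg, sub_zero,
      sub_sub_cancel]
  simp_rw [hsplit]
  have hsub : ∀ z : R3, Tendsto (fun x => x - z) (cocompact R3) (cocompact R3) := fun z =>
    (Homeomorph.subRight z).isClosedEmbedding.tendsto_cocompact
  have h1 : Tendsto (fun x => ∫ z in ball (0 : R3) 1, ‖z‖ ^ (-s) * f (x - z)) (cocompact R3)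
      (𝓝 (∫ z in ball (0 : R3) 1, (0 : ℝ))) := by
    refine tendsto_integral_filter_of_dominated_convergence (fun z => ‖z‖ ^ (-s) * S)
      (Eventually.of_forall fun x => ?_) (Eventually.of_forall fun x =>
        Eventually.of_forall fun z => ?_) ((integrableOn_ball_norm_rpow hs 1).mul_const S)
      (Eventually.of_forall fun z => ?_)
    · exact ((measurable_norm.pow_const _).mul
        (hf.measurable.comp (measurable_const.sub measurable_id))).aestronglyMeasurable
    · rw [Real.norm_of_nonneg (mul_nonneg (by positivity) (hf0 _))]
      exact mul_le_mul_of_nonneg_left (hS _) (by positivity)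
    · simpa using (hlim.comp (hsub z)).const_mul (‖z‖ ^ (-s))
  have h2 : Tendsto (fun x => ∫ y, (ball x 1)ᶜ.indicator (fun y => ‖x - y‖ ^ (-s) * f y) y)
      (cocompact R3) (𝓝 (∫ y : R3, (0 : ℝ))) := by
    refine tendsto_integral_filter_of_dominated_convergence f
      (Eventually.of_forall fun x => ?_) (Eventually.of_forall fun x =>
        Eventually.of_forall fun y => ?_) hfi (Eventually.of_forall fun y => ?_)
    · refine AEStronglyMeasurable.indicator ?_ measurableSet_ball.compl
      exact (((measurable_norm.comp (measurable_const.sub measurable_id)).pow_const _).mul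
        hf.measurable).aestronglyMeasurable
    · by_cases hy : y ∈ (ball x 1)ᶜ
      · rw [indicator_of_mem hy, Real.norm_of_nonneg (mul_nonneg (by positivity) (hf0 _))]
        refine mul_le_of_le_one_left (hf0 y) (Real.rpow_le_one_of_one_le_of_nonpos ?_ (by linarith))
        rw [← dist_eq_norm, dist_comm]; simpa using hy
      · rw [indicator_of_notMem hy, norm_zero]; exact hf0 y
    · have h3 : Tendsto (fun x => ‖x - y‖ ^ (-s)) (cocompact R3) (𝓝 0) :=
        (tendsto_rpow_neg_atTop hs0).comp (tendsto_norm_cocompact_R3.comp (hsub y))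
      have h4 : Tendsto (fun x => ‖x - y‖ ^ (-s) * f y) (cocompact R3) (𝓝 0) := by
        simpa using h3.mul_const (f y)
      refine squeeze_zero_norm (fun x => ?_) (by simpa using h4)
      refine (norm_indicator_le_norm_self _ _).trans (le_of_eq ?_)
      exact Real.norm_of_nonneg (mul_nonneg (by positivity) (hf0 _))
  have h3 := h1.add h2
  simp only [integral_zero, add_zero] at h3
  refine h3.congr fun x => ?_
  rw [integral_indicator measurableSet_ball.compl]

end

/-- If `f = e^{3u}` is integrable and `u` is at most its logarithmic potential plus a constant,
then `u` is bounded above. The bound near `x₀` comes from a maximum point of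
`(1 - |y - x₀|)³ f(y)`: there `f` is controlled on a ball of radius `f^{-1/3} = e^{-u}`, and the
potential created by the remaining mass is at most a small multiple of `u`. -/
theorem exists_le_of_le_logPot {u : R3 → ℝ} (hu : Continuous u)
    (hV : Integrable fun x => Real.exp (3 * u x)) {q : ℝ}
    (h : ∀ x, u x ≤ logPotential u x + q) : ∃ S, ∀ x, u x ≤ S := by
  set f : R3 → ℝ := fun x => Real.exp (3 * u x)
  have hf : Continuous f := Real.continuous_exp.comp (continuous_const.mul hu)
  have hfp : ∀ y, 0 < f y := fun y => Real.exp_pos _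
  have hf0 : ∀ y, 0 ≤ f y := fun y => (hfp y).le
  have hVp : 0 < ∫ y, f y := by
    refine (integral_pos_iff_support_of_nonneg hf0 hV).2 ?_
    rw [Function.support_eq_univ fun y => (hfp y).ne']
    simp
  set β := 1 / Real.pi ^ 2
  have hβ : 0 < β := by positivity
  obtain ⟨C, hC⟩ := exists_logPot_le hf hV hf0 hVp
  have hN : ∀ x, u x ≤ β * C + q + β * nearPot f x := by
    intro x
    have h1 := h x
    have h2 : logPotential u x = β * logPot f x := rfl
    have h3 := mul_le_mul_of_nonneg_left (hC x) hβ.le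
    simp only [sub_self, zero_mul, neg_zero, zero_add] at h3
    rw [h2] at h1
    linarith
  obtain ⟨R, hR, hRε⟩ := exists_integral_compl_le hV (ε := 1 / (2 * β)) (by positivity)
  set K := max (Real.log 8) (2 * (|β * C + q| + β * (8 * poleMass 1)))
  -- far from the origin
  have hfar : ∀ x₀ : R3, R + 2 < ‖x₀‖ → u x₀ ≤ K := by
    intro x₀ hx₀
    by_contra hcon
    push Not at hcon
    have hK8 : Real.log 8 < u x₀ := (le_max_left _ _).trans_lt hcon
    have hlog8 : 0 < Real.log 8 := Real.log_pos (by norm_num)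
    obtain ⟨y, hy, hmax⟩ := (isCompact_closedBall x₀ (1 : ℝ)).exists_isMaxOn ⟨x₀, by simp⟩
      (f := fun y => (1 - dist y x₀) * Real.exp (u y))
      ((continuous_const.sub (continuous_id.dist continuous_const)).mul
        (Real.continuous_exp.comp hu)).continuousOn
    set d := 1 - dist y x₀
    have hexp : Real.exp (u x₀) ≤ d * Real.exp (u y) := by
      have := hmax (mem_closedBall_self zero_le_one)
      simpa using this
    have hd1 : d ≤ 1 := by simp only [d]; linarith [dist_nonneg (x := y) (y := x₀)]
    have hd0 : 0 < d := by
      have : 0 < d * Real.exp (u y) := (Real.exp_pos _).trans_le hexp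
      exact pos_of_mul_pos_left this (Real.exp_pos _).le
    have huy : u x₀ ≤ u y := by
      rw [← Real.exp_le_exp]
      exact hexp.trans (mul_le_of_le_one_left (Real.exp_pos _).le hd1)
    have hd2 : 8 < d * Real.exp (u y) := by
      refine lt_of_lt_of_le ?_ hexp
      rwa [← Real.log_lt_iff_lt_exp (by norm_num)]
    set ρ := Real.exp (-u y)
    have hρ0 : 0 < ρ := Real.exp_pos _
    have hρe : ρ * Real.exp (u y) = 1 := by
      simp only [ρ]; rw [← Real.exp_add]; simp
    have hρd : ρ ≤ d / 2 := by
      by_contra hc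
      push Not at hc
      nlinarith [Real.exp_pos (u y), mul_lt_mul_of_pos_right hc (Real.exp_pos (u y))]
    have hS : ∀ z ∈ ball y ρ, f z ≤ 8 * f y := by
      intro z hz
      have hzy : dist z y < ρ := hz
      have h1 : dist z x₀ ≤ dist z y + dist y x₀ := dist_triangle _ _ _
      have h2 : d / 2 ≤ 1 - dist z x₀ := by simp only [d] at hρd ⊢; linarith
      have h3 : (1 - dist z x₀) * Real.exp (u z) ≤ d * Real.exp (u y) :=
        hmax (show dist z x₀ ≤ 1 by linarith)
      have h4 : Real.exp (u z) ≤ 2 * Real.exp (u y) := by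
        have := mul_le_mul_of_nonneg_right h2 (Real.exp_pos (u z)).le
        by_contra hc
        push Not at hc
        nlinarith
      have h5 : ∀ t : ℝ, Real.exp (3 * t) = Real.exp t ^ 3 := fun t => by
        rw [← Real.exp_nat_mul]; norm_num
      simp only [f, h5]
      calc _ ≤ (2 * Real.exp (u y)) ^ 3 := by gcongr
        _ = _ := by ring
    have hnear := nearPot_le hf hV hf0 hρ0 (by linarith) hS
    have hmass : ∫ z in ball y 1, f z ≤ 1 / (2 * β) := by
      refine le_trans (setIntegral_mono_set hV.integrableOn (ae_of_all _ hf0)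
        (Eventually.of_forall fun z hz => ?_)) hRε
      show z ∈ (closedBall (0 : R3) R)ᶜ
      rw [mem_compl_iff, mem_closedBall_zero_iff, not_le]
      have h1 : dist z y < 1 := hz
      have h2 : dist y x₀ ≤ 1 := hy
      have h3 : ‖x₀‖ ≤ ‖z‖ + dist z y + dist y x₀ := by
        have := dist_triangle4 0 z y x₀
        simpa [dist_zero_left] using this
      linarith
    have hlogρ : Real.log ρ⁻¹ = u y := by
      rw [Real.log_inv, Real.log_exp, neg_neg]
    have h8 : 8 * f y * ρ ^ 3 = 8 := by
      have : f y * ρ ^ 3 = 1 := by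
        simp only [f, ρ]
        rw [← Real.exp_nat_mul, ← Real.exp_add]
        push_cast
        rw [show 3 * u y + 3 * -u y = 0 by ring, Real.exp_zero]
      linarith
    rw [hlogρ, h8] at hnear
    have hy0 : 0 ≤ u y := by linarith
    have h9 := hN y
    have h10 : β * nearPot f y ≤ u y / 2 + β * (8 * poleMass 1) := by
      have h11 : u y * ∫ z in ball y 1, f z ≤ u y * (1 / (2 * β)) := by gcongr
      have h12 := mul_le_mul_of_nonneg_left (hnear.trans (add_le_add_left h11 _)) hβ.le
      refine h12.trans (le_of_eq ?_)
      field_simp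
    have h13 : u y ≤ 2 * (|β * C + q| + β * (8 * poleMass 1)) := by
      linarith [le_abs_self (β * C + q)]
    exact absurd (huy.trans (h13.trans (le_max_right _ _))) (not_le.2 hcon)
  obtain ⟨B, hB⟩ := (isCompact_closedBall (0 : R3) (R + 2)).exists_bound_of_continuousOn
    hu.continuousOn
  refine ⟨max K B, fun x => ?_⟩
  rcases le_or_gt ‖x‖ (R + 2) with hx | hx
  · exact ((le_abs_self _).trans (hB x (by simpa using hx))).trans (le_max_right _ _)
  · exact (hfar x hx).trans (le_max_left _ _)

/-- The normalized mass `α = π⁻² ∫ e^{3u}`, for which `logPotential u` behaves like `-α log |x|`. -/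
theorem normalizedMass_pos {u : R3 → ℝ} (hV : Integrable fun x => Real.exp (3 * u x)) :
    0 < 1 / Real.pi ^ 2 * ∫ y, Real.exp (3 * u y) := by
  have : 0 < ∫ y, Real.exp (3 * u y) := by
    refine (integral_pos_iff_support_of_nonneg (fun y => (Real.exp_pos _).le) hV).2 ?_
    rw [Function.support_eq_univ fun y => (Real.exp_pos _).ne']
    simp
  positivity

section
variable {u : R3 → ℝ} (hu : Continuous u) (hV : Integrable fun x => Real.exp (3 * u x)) {q : ℝ}
  (h : ∀ x, u x ≤ logPotential u x + q)
include hu hV h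

/-- Upper bounds for the logarithmic potential: it is at most `-(α - ε) log (1 + |x|) + C`, where
`α` is the normalized mass. -/
theorem exists_logPotential_le {ε : ℝ} (hε : 0 < ε) :
    ∃ C, ∀ x, logPotential u x ≤
      -((1 / Real.pi ^ 2 * (∫ y, Real.exp (3 * u y)) - ε) * Real.log (1 + ‖x‖)) + C := by
  obtain ⟨S, hS⟩ := exists_le_of_le_logPot hu hV h
  have hf : Continuous fun x => Real.exp (3 * u x) := by fun_prop
  have hf0 : ∀ y, 0 ≤ Real.exp (3 * u y) := fun y => (Real.exp_pos _).le
  obtain ⟨C, hC⟩ := exists_logPot_le hf hV hf0 (ε := Real.pi ^ 2 * ε) (by positivity)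
  refine ⟨1 / Real.pi ^ 2 * (C + Real.exp (3 * S) * poleMass 1), fun x => ?_⟩
  have h1 := nearPot_le hf hV hf0 (x := x) (S := Real.exp (3 * S)) one_pos le_rfl
    fun y _ => Real.exp_le_exp.2 (by linarith [hS y])
  simp only [inv_one, Real.log_one, zero_mul, one_pow, mul_one, zero_add] at h1
  have h2 := mul_le_mul_of_nonneg_left ((hC x).trans (add_le_add_right h1 _))
    (show 0 ≤ 1 / Real.pi ^ 2 by positivity)
  refine h2.trans (le_of_eq ?_)
  have := Real.pi_pos.ne'
  field_simp
  ring

/-- The density vanishes at infinity, because `u ≤ -(α / 2) log (1 + |x|) + C` with `α > 0`. -/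
theorem tendsto_exp_cocompact :
    Tendsto (fun x => Real.exp (3 * u x)) (cocompact R3) (𝓝 0) := by
  have hα := normalizedMass_pos hV
  set α := 1 / Real.pi ^ 2 * ∫ y, Real.exp (3 * u y)
  obtain ⟨C, hC⟩ := exists_logPotential_le hu hV h (half_pos hα)
  have h1 : Tendsto (fun x : R3 => Real.log (1 + ‖x‖)) (cocompact R3) atTop :=
    Real.tendsto_log_atTop.comp (tendsto_atTop_add_const_left _ _ tendsto_norm_cocompact_R3)
  have h2 : Tendsto (fun x : R3 => -(α / 2 * Real.log (1 + ‖x‖)) + (C + q)) (cocompact R3) atBot :=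
    tendsto_atBot_add_const_right _ _
      (tendsto_neg_atTop_atBot.comp (h1.const_mul_atTop (half_pos hα)))
  have h3 : Tendsto u (cocompact R3) atBot := tendsto_atBot_mono (fun x => by
    have := hC x
    have := h x
    linarith) h2
  exact Real.tendsto_exp_atBot.comp (h3.const_mul_atBot three_pos)

theorem tendsto_rieszPot_cocompact :
    Tendsto (rieszPot fun x => Real.exp (3 * u x)) (cocompact R3) (𝓝 0) := by
  obtain ⟨S, hS⟩ := exists_le_of_le_logPot hu hV h
  have := tendsto_integral_rpow_mul (s := 2) (S := Real.exp (3 * S)) (by fun_prop) hV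
    (fun y => (Real.exp_pos _).le) two_pos (by norm_num)
    (fun y => Real.exp_le_exp.2 (by linarith [hS y])) (tendsto_exp_cocompact hu hV h)
  refine this.congr fun x => ?_
  simp [rieszPot]

/-- The gradient of the logarithmic potential vanishes at infinity. -/
theorem tendsto_integral_gradKer_cocompact :
    Tendsto (fun x => ∫ y, Real.exp (3 * u y) • gradKer 0 (x - y)) (cocompact R3) (𝓝 0) := by
  obtain ⟨S, hS⟩ := exists_le_of_le_logPot hu hV h
  have := tendsto_integral_rpow_mul (s := 1) (S := Real.exp (3 * S)) (by fun_prop) hV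
    (fun y => (Real.exp_pos _).le) one_pos (by norm_num)
    (fun y => Real.exp_le_exp.2 (by linarith [hS y])) (tendsto_exp_cocompact hu hV h)
  refine squeeze_zero_norm (fun x => ?_) this
  refine norm_integral_le_of_norm_le (by
    have := integrable_inv_norm_mul (by fun_prop) hV (fun y => (Real.exp_pos _).le) x
    simpa only [Real.rpow_neg_one] using this) (Eventually.of_forall fun y => ?_)
  rw [norm_smul, norm_gradKer, Real.norm_of_nonneg (Real.exp_pos _).le, mul_comm, add_zero,
    abs_of_nonneg (by positivity), Real.rpow_neg_one]
  refine mul_le_mul_of_nonneg_right (le_of_eq ?_) (Real.exp_pos _).le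
  rcases eq_or_ne ‖x - y‖ 0 with h0 | h0
  · simp [h0]
  · field_simp

end

/-! ### The Pohozaev identity -/

theorem sum_coord_mul_fderiv (g : R3 → ℝ) (x : R3) :
    ∑ i, x i * fderiv ℝ g x (EuclideanSpace.single i 1) = fderiv ℝ g x x := by
  have := congrArg (fderiv ℝ g x) (sum_coord_smul_single x)
  rw [map_sum] at this
  rw [← this]
  exact Finset.sum_congr rfl fun i _ => by rw [map_smul, smul_eq_mul]

theorem integral_mul_fderiv_self {φ g : R3 → ℝ} (hφ : ContDiff ℝ 1 φ) (hc : HasCompactSupport φ)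
    (hg : ContDiff ℝ 1 g) :
    ∫ x, φ x * fderiv ℝ g x x = -∫ x, (3 * φ x + fderiv ℝ φ x x) * g x := by
  set a : Fin 3 → R3 → ℝ := fun i x => φ x * x i
  have hco : ∀ i : Fin 3, ContDiff ℝ 1 fun x : R3 => x i := fun i => by fun_prop
  have ha : ∀ i, ContDiff ℝ 1 (a i) := fun i => hφ.mul (hco i)
  have hac : ∀ i, HasCompactSupport (a i) := fun i => hc.mul_right
  have hcont : ∀ {h : R3 → ℝ}, ContDiff ℝ 1 h → ∀ e : R3, Continuous fun x => fderiv ℝ h x e :=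
    fun hh e => (hh.continuous_fderiv (by simp)).clm_apply continuous_const
  have hI1 : ∀ i, Integrable fun x => a i x * fderiv ℝ g x (EuclideanSpace.single i 1) := fun i =>
    ((ha i).continuous.mul (hcont hg _)).integrable_of_hasCompactSupport (hac i).mul_right
  have hI2 : ∀ i, Integrable fun x => fderiv ℝ (a i) x (EuclideanSpace.single i 1) * g x := fun i =>
    ((hcont (ha i) _).mul hg.continuous).integrable_of_hasCompactSupport
      ((hac i).fderiv_apply ℝ _).mul_right
  have hI3 : ∀ i, Integrable fun x => a i x * g x := fun i =>
    ((ha i).continuous.mul hg.continuous).integrable_of_hasCompactSupport (hac i).mul_right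
  have hibp : ∀ i, ∫ x, a i x * fderiv ℝ g x (EuclideanSpace.single i 1) =
      -∫ x, fderiv ℝ (a i) x (EuclideanSpace.single i 1) * g x := fun i =>
    integral_mul_fderiv_eq_neg_fderiv_mul_of_integrable (hI2 i) (hI1 i) (hI3 i)
      (fun x _ => ((ha i).differentiable (by simp)).differentiableAt)
      (fun x _ => (hg.differentiable (by simp)).differentiableAt)
  have hfa : ∀ i x, fderiv ℝ (a i) x (EuclideanSpace.single i 1) =
      φ x + x i * fderiv ℝ φ x (EuclideanSpace.single i 1) := by
    intro i x
    have h1 := (hφ.differentiable (by simp)).differentiableAt (x := x)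
    have h2 := ((hco i).differentiable (by simp)).differentiableAt (x := x)
    have h3 : fderiv ℝ (fun x : R3 => x i) x = EuclideanSpace.proj i :=
      (EuclideanSpace.proj i : R3 →L[ℝ] ℝ).fderiv
    simp only [a]
    rw [fderiv_fun_mul h1 h2, h3]
    simp
  have h1 : ∀ x, φ x * fderiv ℝ g x x =
      ∑ i, a i x * fderiv ℝ g x (EuclideanSpace.single i 1) := by
    intro x
    rw [← sum_coord_mul_fderiv, Finset.mul_sum]
    exact Finset.sum_congr rfl fun i _ => by simp only [a]; ring
  have h2 : ∀ x, (3 * φ x + fderiv ℝ φ x x) * g x =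
      ∑ i, fderiv ℝ (a i) x (EuclideanSpace.single i 1) * g x := by
    intro x
    rw [← Finset.sum_mul]
    simp only [hfa]
    rw [Finset.sum_add_distrib, sum_coord_mul_fderiv]
    simp
  simp_rw [h1, h2]
  rw [integral_finsetSum _ fun i _ => hI1 i, integral_finsetSum _ fun i _ => hI2 i,
    ← Finset.sum_neg_distrib]
  exact Finset.sum_congr rfl fun i _ => hibp i

/-- For the radial bump function `φ`, the vector field `x ↦ φ(x / R) x` is Lipschitz uniformly in
`R`. -/
theorem exists_lipschitz_radialBump_smul :
    ∃ K : ℝ, 0 ≤ K ∧ ∀ R : ℝ, 0 < R → ∀ x y : R3,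
      ‖radialBump (R⁻¹ • x) • x - radialBump (R⁻¹ • y) • y‖ ≤ K * ‖x - y‖ := by
  have h1 : ContDiff ℝ 1 fun x : R3 => radialBump x • x := by
    have : ContDiff ℝ 1 radialBump := by exact_mod_cast contDiff_radialBump (n := 1)
    exact this.smul contDiff_id
  obtain ⟨K, hK⟩ := h1.lipschitzWith_of_hasCompactSupport
    (hasCompactSupport_radialBump.smul_right) (by simp)
  refine ⟨K, K.2, fun R hR x y => ?_⟩
  have h2 : dist (radialBump (R⁻¹ • x) • R⁻¹ • x) (radialBump (R⁻¹ • y) • R⁻¹ • y) ≤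
    K * dist (R⁻¹ • x) (R⁻¹ • y) := hK.dist_le_mul (R⁻¹ • x) (R⁻¹ • y)
  rw [dist_eq_norm, dist_eq_norm, ← smul_sub, norm_smul, smul_comm _ R⁻¹ x, smul_comm _ R⁻¹ y,
    ← smul_sub, norm_smul] at h2
  have h3 : 0 < ‖R⁻¹‖ := norm_pos_iff.2 (inv_ne_zero hR.ne')
  rw [mul_left_comm] at h2
  exact le_of_mul_le_mul_left h2 h3

theorem integrable_prod_mul_inv_norm {f : R3 → ℝ} (hf : Continuous f) (hfi : Integrable f)
    (hf0 : ∀ y, 0 ≤ f y) {S : ℝ} (hS : ∀ y, f y ≤ S) :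
    Integrable (fun z : R3 × R3 => f z.1 * (‖z.1 - z.2‖⁻¹ * f z.2)) (volume.prod volume) := by
  have hm : Measurable fun z : R3 × R3 => f z.1 * (‖z.1 - z.2‖⁻¹ * f z.2) :=
    (hf.measurable.comp measurable_fst).mul
      ((measurable_norm.comp (measurable_fst.sub measurable_snd)).inv.mul
        (hf.measurable.comp measurable_snd))
  rw [integrable_prod_iff hm.aestronglyMeasurable]
  refine ⟨Eventually.of_forall fun x =>
    (integrable_inv_norm_mul hf hfi hf0 x).const_mul (f x), ?_⟩
  refine (hfi.mul_const (S * poleMass 1 + ∫ y, f y)).mono'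
    hm.norm.aestronglyMeasurable.integral_prod_right' (Eventually.of_forall fun x => ?_)
  have h0 : ∀ y, 0 ≤ f x * (‖x - y‖⁻¹ * f y) := fun y =>
    mul_nonneg (hf0 x) (mul_nonneg (by positivity) (hf0 y))
  rw [Real.norm_of_nonneg (integral_nonneg fun y => norm_nonneg _)]
  simp only [Real.norm_of_nonneg (h0 _), integral_const_mul]
  refine mul_le_mul_of_nonneg_left ?_ (hf0 x)
  have := (rieszPotential_bound (s := 1) (by norm_num) (by norm_num) hfi hf0 (x := x)
    fun y _ => hS y).2
  simpa only [Real.rpow_neg_one] using this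

theorem norm_gradKer_zero (z : R3) : ‖gradKer 0 z‖ = ‖z‖⁻¹ := by
  rw [norm_gradKer, add_zero, abs_of_nonneg (by positivity)]
  rcases eq_or_ne ‖z‖ 0 with h | h
  · simp [h]
  · field_simp

theorem measurable_gradKer : Measurable (gradKer 0) :=
  ((measurable_norm.pow_const 2).add_const 0).inv.smul measurable_id

/-- The Pohozaev identity: a solution of `u = log-potential of e^{3u}`, up to a constant, has
normalized mass two. Cutting off by `x ↦ φ(x/R) x`, which is Lipschitz uniformly in `R`, makes it
available without any decay of `u`. -/
theorem normalizedMass_eq_two {u : R3 → ℝ} (hu : ContDiff ℝ 1 u)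
    (hV : Integrable fun x => Real.exp (3 * u x)) {β S : ℝ} (hS : ∀ x, u x ≤ S)
    (hd : ∀ x e, fderiv ℝ u x e =
      -(β * inner ℝ (∫ y, Real.exp (3 * u y) • gradKer 0 (x - y)) e)) :
    β * ∫ y, Real.exp (3 * u y) = 2 := by
  set f : R3 → ℝ := fun x => Real.exp (3 * u x)
  have hfs : ContDiff ℝ 1 f := Real.contDiff_exp.comp (contDiff_const.mul hu)
  have hf := hfs.continuous
  have hf0 : ∀ y, 0 ≤ f y := fun y => (Real.exp_pos _).le
  have hfS : ∀ y, f y ≤ Real.exp (3 * S) := fun y => Real.exp_le_exp.2 (by linarith [hS y])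
  set V := ∫ y, f y
  have hVp : 0 < V := by
    refine (integral_pos_iff_support_of_nonneg hf0 hV).2 ?_
    rw [Function.support_eq_univ fun y => (Real.exp_pos _).ne']
    simp
  set b := radialBump 0
  have hb : 0 < b := expNegInvGlue.pos_of_pos (by norm_num)
  have hbc : ContDiff ℝ 1 radialBump := by exact_mod_cast contDiff_radialBump (n := 1)
  obtain ⟨K, hK0, hK⟩ := exists_lipschitz_radialBump_smul
  obtain ⟨B, hB⟩ := hasCompactSupport_radialBump.exists_bound_of_continuous hbc.continuous
  obtain ⟨B', hB'⟩ := hasCompactSupport_radialWeight.exists_bound_of_continuous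
    continuous_radialWeight
  set g : ℝ → R3 → ℝ := fun R x => radialBump (R⁻¹ • x)
  have hgs : ∀ R, ContDiff ℝ 1 (g R) := fun R => hbc.comp (contDiff_const_smul _)
  have hgc : ∀ R, 0 < R → HasCompactSupport (g R) := fun R hR =>
    hasCompactSupport_radialBump.comp_smul (inv_ne_zero hR.ne')
  have hgd : ∀ R x, fderiv ℝ (g R) x x = -(radialWeight (R⁻¹ • x) * ‖R⁻¹ • x‖ ^ 2) := by
    intro R x
    have h1 : HasFDerivAt (fun y : R3 => R⁻¹ • y) (R⁻¹ • ContinuousLinearMap.id ℝ R3) x :=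
      (hasFDerivAt_id x).const_smul R⁻¹
    have h2 := (hasFDerivAt_radialBump (R⁻¹ • x)).comp x h1
    have h3 : fderiv ℝ (g R) x = _ := h2.fderiv
    rw [h3, norm_smul, mul_pow, Real.norm_eq_abs, sq_abs]
    simp
    ring
  have hdf : ∀ x e, fderiv ℝ f x e =
      -(3 * β * (f x * inner ℝ (∫ y, f y • gradKer 0 (x - y)) e)) := by
    intro x e
    have h1 := (hu.differentiable (by simp)).differentiableAt (x := x)
    have h2 := ((h1.hasFDerivAt.const_mul 3).exp).fderiv
    have h3 : fderiv ℝ f x = _ := h2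
    rw [h3]
    simp only [smul_apply, hd, smul_eq_mul]
    simp only [f]
    ring
  have hlimx : ∀ x : R3, Tendsto (fun n : ℕ => (((n : ℝ) + 1)⁻¹) • x) atTop (𝓝 0) := by
    intro x
    have : Tendsto (fun n : ℕ => ((n : ℝ) + 1)⁻¹) atTop (𝓝 0) :=
      tendsto_inv_atTop_zero.comp (tendsto_natCast_atTop_atTop.atTop_add tendsto_const_nhds)
    simpa using this.smul_const x
  have hlimg : ∀ x : R3, Tendsto (fun n : ℕ => g ((n : ℝ) + 1) x) atTop (𝓝 b) := fun x =>
    (hbc.continuous.tendsto 0).comp (hlimx x)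
  -- the two sides of the identity for the cut-off vector field
  have hlhs : Tendsto (fun n : ℕ => ∫ x, (3 * g ((n : ℝ) + 1) x + fderiv ℝ (g ((n : ℝ) + 1)) x x) *
      f x) atTop (𝓝 (∫ x, 3 * b * f x)) := by
    refine tendsto_integral_of_dominated_convergence (fun x => (3 * B + B' * 4) * f x)
      (fun n => ?_) (hV.const_mul _) (fun n => Eventually.of_forall fun x => ?_)
      (Eventually.of_forall fun x => ?_)
    · simp only [hgd]
      have h1 : Continuous fun x : R3 => ((n : ℝ) + 1)⁻¹ • x := continuous_const_smul _
      exact (((continuous_const.mul (hgs _).continuous).add ((continuous_radialWeight.comp h1).mul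
        (h1.norm.pow 2)).neg).mul hf).aestronglyMeasurable
    · rw [norm_mul, Real.norm_of_nonneg (hf0 x), hgd]
      refine mul_le_mul_of_nonneg_right ?_ (hf0 x)
      set z := ((n : ℝ) + 1)⁻¹ • x
      have h1 : ‖3 * g ((n : ℝ) + 1) x‖ ≤ 3 * B := by
        rw [norm_mul]; norm_num; exact hB z
      have h2 : ‖-(radialWeight z * ‖z‖ ^ 2)‖ ≤ B' * 4 := by
        rw [norm_neg, norm_mul, norm_pow, norm_norm]
        rcases le_or_gt 2 ‖z‖ with hz | hz
        · rw [radialWeight_eq_zero hz, norm_zero, zero_mul]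
          have := (norm_nonneg _).trans (hB' 0); linarith
        · have := norm_nonneg z
          exact mul_le_mul (hB' z) (by nlinarith) (by positivity) ((norm_nonneg _).trans (hB' 0))
      exact (norm_add_le _ _).trans (add_le_add h1 h2)
    · have h1 : Tendsto (fun n : ℕ => radialWeight (((n : ℝ) + 1)⁻¹ • x) *
          ‖((n : ℝ) + 1)⁻¹ • x‖ ^ 2) atTop (𝓝 (radialWeight 0 * ‖(0 : R3)‖ ^ 2)) :=
        ((continuous_radialWeight.tendsto 0).comp (hlimx x)).mul ((hlimx x).norm.pow 2)
      have h2 := (((hlimg x).const_mul 3).sub h1).mul_const (f x)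
      simp only [hgd]
      simpa [sub_eq_add_neg] using h2
  have hrhs : Tendsto (fun n : ℕ => ∫ z : R3 × R3, f z.1 * f z.2 *
      inner ℝ (g ((n : ℝ) + 1) z.1 • z.1 - g ((n : ℝ) + 1) z.2 • z.2) (gradKer 0 (z.1 - z.2)))
      atTop (𝓝 (∫ z : R3 × R3, f z.1 * f z.2 * b)) := by
    have hne : ∀ᵐ z : R3 × R3, z.1 ≠ z.2 := by
      rw [Measure.volume_eq_prod]
      refine (Measure.ae_prod_iff_ae_ae (p := fun z : R3 × R3 => z.1 ≠ z.2)
        (isClosed_eq continuous_fst continuous_snd).measurableSet.compl).2 ?_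
      exact Eventually.of_forall fun x => (ae_ne x).mono fun y hy => hy.symm
    refine tendsto_integral_of_dominated_convergence (fun z => f z.1 * f z.2 * K)
      (fun n => ?_) ((hV.mul_prod hV).mul_const K) (fun n => Eventually.of_forall fun z => ?_)
      (hne.mono fun z hz => ?_)
    · have hgm : Measurable fun x => g ((n : ℝ) + 1) x • x :=
        ((hgs _).continuous.smul continuous_id).measurable
      exact (((hf.measurable.comp measurable_fst).mul (hf.measurable.comp measurable_snd)).mul
        (((hgm.comp measurable_fst).sub (hgm.comp measurable_snd)).inner
          (measurable_gradKer.comp (measurable_fst.sub measurable_snd)))).aestronglyMeasurable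
    · rw [norm_mul, Real.norm_of_nonneg (mul_nonneg (hf0 _) (hf0 _))]
      refine mul_le_mul_of_nonneg_left ?_ (mul_nonneg (hf0 _) (hf0 _))
      refine (norm_inner_le_norm _ _).trans ?_
      rw [norm_gradKer_zero]
      refine (mul_le_mul_of_nonneg_right (hK _ (by positivity) _ _) (by positivity)).trans ?_
      rw [mul_assoc]
      exact mul_le_of_le_one_right hK0 (mul_inv_le_one)
    · refine Tendsto.const_mul _ ?_
      have h1 := (((hlimg z.1).smul_const z.1).sub ((hlimg z.2).smul_const z.2)).inner (𝕜 := ℝ)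
        (tendsto_const_nhds (x := gradKer 0 (z.1 - z.2)))
      refine h1.trans (le_of_eq ?_)
      have h2 : ‖z.1 - z.2‖ ≠ 0 := norm_ne_zero_iff.2 (sub_ne_zero.2 hz)
      rw [← smul_sub, gradKer, inner_smul_left, inner_smul_right, real_inner_self_eq_norm_sq]
      simp [h2]
  -- integration by parts; the kernel `(x - y) / |x - y|²` is odd, so the resulting double integral can
  -- be symmetrized in `x` and `y`, which cancels the singularity
  have hkey : ∀ R, 0 < R → ∫ x, (3 * g R x + fderiv ℝ (g R) x x) * f x =
      3 * β / 2 * ∫ z : R3 × R3, f z.1 * f z.2 *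
        inner ℝ (g R z.1 • z.1 - g R z.2 • z.2) (gradKer 0 (z.1 - z.2)) := by
    intro R hR
    set H : R3 × R3 → ℝ := fun z => f z.1 * (f z.2 * inner ℝ (g R z.1 • z.1) (gradKer 0 (z.1 - z.2)))
    have hgx : Continuous fun x => g R x • x := (hgs R).continuous.smul continuous_id
    obtain ⟨D, hD⟩ := (hgc R hR).smul_right (f' := fun x => x) |>.exists_bound_of_continuous hgx
    have hH : Integrable H (volume.prod volume) := by
      refine ((integrable_prod_mul_inv_norm hf hV hf0 hfS).const_mul D).mono' ?_
        (Eventually.of_forall fun z => ?_)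
      · exact ((hf.measurable.comp measurable_fst).mul ((hf.measurable.comp measurable_snd).mul
          ((hgx.measurable.comp measurable_fst).inner
          (measurable_gradKer.comp (measurable_fst.sub measurable_snd))))).aestronglyMeasurable
      · rw [norm_mul, norm_mul, Real.norm_of_nonneg (hf0 _), Real.norm_of_nonneg (hf0 _)]
        have h1 : ‖inner ℝ (g R z.1 • z.1) (gradKer 0 (z.1 - z.2))‖ ≤ D * ‖z.1 - z.2‖⁻¹ := by
          refine (norm_inner_le_norm _ _).trans ?_
          rw [norm_gradKer_zero]
          exact mul_le_mul_of_nonneg_right (hD z.1) (by positivity)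
        have h2 := mul_le_mul_of_nonneg_left h1 (mul_nonneg (hf0 z.1) (hf0 z.2))
        linarith
    have hodd : ∀ z : R3, gradKer 0 (-z) = -gradKer 0 z := fun z => by
      simp [gradKer]
    have h1 : ∫ z, H z ∂(volume.prod volume) = ∫ x, f x *
        inner ℝ (g R x • x) (∫ y, f y • gradKer 0 (x - y)) := by
      rw [integral_prod _ hH]
      refine integral_congr_ae (Eventually.of_forall fun x => ?_)
      simp only [H]
      rw [integral_const_mul, ← integral_inner (integrable_smul_gradKer hf hV hf0 x)]
      simp only [inner_smul_right]
    have h2 : ∫ z : R3 × R3, f z.1 * f z.2 *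
        inner ℝ (g R z.1 • z.1 - g R z.2 • z.2) (gradKer 0 (z.1 - z.2)) =
        2 * ∫ z, H z ∂(volume.prod volume) := by
      rw [two_mul]
      nth_rewrite 2 [← integral_prod_swap]
      have hHs : Integrable (fun z : R3 × R3 => H z.swap) (volume.prod volume) := hH.swap
      rw [← integral_add hH hHs]
      refine integral_congr_ae (Eventually.of_forall fun z => ?_)
      simp only [H, Prod.fst_swap, Prod.snd_swap]
      rw [← neg_sub z.1 z.2, hodd, inner_neg_right, inner_sub_left]
      ring
    rw [h2, h1, ← neg_neg (∫ x, (3 * g R x + fderiv ℝ (g R) x x) * f x),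
      ← integral_mul_fderiv_self (hgs R) (hgc R hR) hfs, ← integral_neg, ← integral_const_mul,
      ← integral_const_mul]
    refine integral_congr_ae (Eventually.of_forall fun x => ?_)
    simp only [hdf]
    rw [inner_smul_left, real_inner_comm]
    simp only [conj_trivial]
    ring
  have h1 : Tendsto (fun n : ℕ => ∫ x, (3 * g ((n : ℝ) + 1) x + fderiv ℝ (g ((n : ℝ) + 1)) x x) *
      f x) atTop (𝓝 (3 * β / 2 * (∫ z : R3 × R3, f z.1 * f z.2 * b))) :=
    (hrhs.const_mul (3 * β / 2)).congr fun n => (hkey _ (by positivity)).symm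
  have h2 := tendsto_nhds_unique hlhs h1
  rw [integral_const_mul, integral_mul_const, Measure.volume_eq_prod,
    integral_prod_mul (fun x => f x) (fun x => f x)] at h2
  have h3 : V * b * (β * V - 2) = 0 := by
    change 3 * b * V = 3 * β / 2 * (V * V * b) at h2
    linarith
  rcases mul_eq_zero.1 h3 with h | h
  · exact absurd h (mul_pos hVp hb).ne'
  · linarith

/-! ### Inversions and the method of moving spheres -/

open EuclideanGeometry

/-- The transform of `u` by the inversion with centre `c` and radius `R`, under which the metric
`e^{2u} |dx|²` is pulled back. The value at the centre `c` is a junk value. -/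
def sphereReflect (u : R3 → ℝ) (c : R3) (R : ℝ) (x : R3) : ℝ :=
  2 * Real.log (R / dist x c) + u (inversion c R x)

/-- The difference of the logarithmic kernels at `x` and at its inversion, normalized to vanish on
the sphere. -/
def invKer (c : R3) (R : ℝ) (x y : R3) : ℝ :=
  Real.log (dist x c / R) + Real.log (dist (inversion c R x) y) - Real.log (dist x y)

theorem sq_dist_mul_dist_inversion {c x : R3} (R : ℝ) (hx : x ≠ c) (y : R3) :
    (dist x c * dist (inversion c R x) y) ^ 2 =
      R ^ 2 * dist x y ^ 2 + (R ^ 2 - dist x c ^ 2) * (R ^ 2 - dist y c ^ 2) := by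
  have hd : ‖x - c‖ ≠ 0 := norm_ne_zero_iff.2 (sub_ne_zero.2 hx)
  obtain ⟨a, rfl⟩ : ∃ a, x = a + c := ⟨x - c, by simp⟩
  obtain ⟨b, rfl⟩ : ∃ b, y = b + c := ⟨y - c, by simp⟩
  simp only [add_sub_cancel_right] at hd
  have e1 : inversion c R (a + c) - (b + c) = (R / ‖a‖) ^ 2 • a - b := by
    rw [inversion, dist_eq_norm]
    simp
  rw [dist_eq_norm (inversion c R (a + c)), e1]
  simp only [dist_eq_norm, add_sub_cancel_right, add_sub_add_right_eq_sub]
  rw [mul_pow, @norm_sub_sq_real _ _ _ _ b, @norm_sub_sq_real _ _ _ a b, norm_smul,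
    inner_smul_left]
  simp only [conj_trivial, norm_pow, norm_div, Real.norm_eq_abs, mul_pow, div_pow]
  field_simp
  have h4 : ∀ t : ℝ, |t| ^ 4 = t ^ 4 := fun t => by
    rw [show 4 = 2 * 2 by norm_num, pow_mul, sq_abs, ← pow_mul]
  simp only [h4, abs_norm]
  ring

theorem invKer_eq {c x y : R3} {R : ℝ} (hR : 0 < R) (hx : x ≠ c) (hy : y ≠ x)
    (hy' : inversion c R x ≠ y) :
    invKer c R x y = Real.log (dist x c * dist (inversion c R x) y / (R * dist x y)) := by
  have h1 := (dist_pos.2 hx).ne'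
  have h2 := (dist_pos.2 hy').ne'
  have h3 := (dist_pos.2 hy.symm).ne'
  rw [invKer, Real.log_div (mul_ne_zero h1 h2) (mul_ne_zero hR.ne' h3), Real.log_mul h1 h2,
    Real.log_mul hR.ne' h3, Real.log_div h1 hR.ne']
  ring

theorem inversion_ne_of_mem_ball {c x y : R3} {R : ℝ} (hR : 0 < R) (hx : x ≠ c)
    (hxR : x ∈ ball c R) (hyR : y ∈ ball c R) : inversion c R x ≠ y := by
  rintro rfl
  have h1 := dist_inversion_center c x R
  have h2 := dist_pos.2 hx
  have h3 : dist x c < R := hxR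
  have h4 : dist (inversion c R x) c < R := hyR
  rw [h1, div_lt_iff₀ h2] at h4
  nlinarith

/-- On the ball the kernel is positive, and no more singular than `1 / |x - y|`, uniformly in `x`. -/
theorem invKer_bounds {c x y : R3} {R : ℝ} (hR : 0 < R) (hx : x ≠ c) (hy : y ≠ x)
    (hxR : x ∈ ball c R) (hyR : y ∈ ball c R) :
    0 < invKer c R x y ∧ invKer c R x y ≤ 2 * R * ‖x - y‖⁻¹ := by
  have hne := inversion_ne_of_mem_ball hR hx hxR hyR
  have hxc := dist_pos.2 hx
  have hxy := dist_pos.2 hy.symm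
  have hiy := dist_pos.2 hne
  have hx1 : dist x c < R := hxR
  have hy1 : dist y c < R := hyR
  have hy0 : 0 ≤ dist y c := dist_nonneg
  have hsq := sq_dist_mul_dist_inversion R hx y
  rw [invKer_eq hR hx hy hne]
  have hpos : 0 < (R ^ 2 - dist x c ^ 2) * (R ^ 2 - dist y c ^ 2) := by
    apply mul_pos <;> nlinarith
  constructor
  · refine Real.log_pos ?_
    rw [one_lt_div (by positivity)]
    refine lt_of_pow_lt_pow_left₀ 2 (by positivity) ?_
    rw [hsq, mul_pow]
    linarith
  · refine (Real.log_le_self (by positivity)).trans ?_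
    rw [← dist_eq_norm, div_le_iff₀ (by positivity),
      show 2 * R * (dist x y)⁻¹ * (R * dist x y) = 2 * R ^ 2 by field_simp]
    refine le_of_sq_le_sq ?_ (by positivity)
    rw [hsq]
    have h1 : dist x y ≤ dist x c + dist y c := dist_triangle_right x y c
    have h2 : dist x y ^ 2 ≤ (dist x c + dist y c) ^ 2 := by gcongr
    have h3 : R ^ 2 * dist x y ^ 2 ≤ R ^ 2 * (dist x c + dist y c) ^ 2 := by gcongr
    nlinarith [mul_pos hxc hR, mul_nonneg hy0 hR.le, mul_nonneg hxc.le hy0,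
      mul_le_mul hx1.le hy1.le hy0 hR.le]

/-- The kernel is odd under the inversion of its second argument. -/
theorem invKer_inversion {c x y : R3} {R : ℝ} (hR : 0 < R) (hx : x ≠ c) (hy : y ≠ c)
    (hyx : y ≠ x) (hne : inversion c R x ≠ y) :
    invKer c R x (inversion c R y) = -invKer c R x y := by
  have hix : inversion c R x ≠ c := by rwa [Ne, inversion_eq_center hR.ne']
  have h1 := dist_inversion_inversion hx hy R
  have h2 := dist_inversion_inversion hix hy R
  rw [inversion_inversion c hR.ne', dist_inversion_center] at h2
  have hxc := dist_pos.2 hx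
  have hyc := dist_pos.2 hy
  have hxy := dist_pos.2 hyx.symm
  have hiy := dist_pos.2 hne
  have e : R ^ 2 / (R ^ 2 / dist x c * dist y c) = dist x c / dist y c := by field_simp
  rw [e] at h2
  rw [invKer, invKer, h1, h2, Real.log_mul (by positivity) hxy.ne', Real.log_mul (by positivity) hiy.ne',
    Real.log_div hxc.ne' hR.ne', Real.log_div (pow_ne_zero 2 hR.ne') (mul_ne_zero hxc.ne' hyc.ne'),
    Real.log_div hxc.ne' hyc.ne', Real.log_mul hxc.ne' hyc.ne', Real.log_pow]
  push_cast
  ring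

/-- The Jacobian determinant of the inversion. -/
theorem abs_det_inversion (c x : R3) (R : ℝ) :
    |((R / dist x c) ^ 2 • ((ℝ ∙ (x - c))ᗮ.reflection : R3 →L[ℝ] R3)).det| =
      (R / dist x c) ^ 6 := by
  have h : |LinearMap.det ((ℝ ∙ (x - c))ᗮ.reflection.toLinearMap)| = 1 := by
    rw [Submodule.det_reflection, abs_pow, abs_neg, abs_one, one_pow]
  have e : ((R / dist x c) ^ 2 • ((ℝ ∙ (x - c))ᗮ.reflection : R3 →L[ℝ] R3)).det =
      LinearMap.det ((R / dist x c) ^ 2 • (ℝ ∙ (x - c))ᗮ.reflection.toLinearMap) := rfl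
  rw [e, LinearMap.det_smul, abs_mul, h, mul_one, finrank_euclideanSpace, Fintype.card_fin,
    ← pow_mul, abs_of_nonneg]
  have := sq_nonneg ((R / dist x c) ^ 3)
  rwa [← pow_mul] at this

theorem inversion_image_ball {c : R3} {R : ℝ} (hR : 0 < R) :
    inversion c R '' (ball c R \ {c}) = (closedBall c R)ᶜ := by
  ext y
  simp only [mem_image, Set.mem_sdiff, mem_ball, mem_singleton_iff, mem_compl_iff, mem_closedBall, not_le]
  constructor
  · rintro ⟨x, ⟨hxR, hx⟩, rfl⟩
    rw [dist_inversion_center, lt_div_iff₀ (dist_pos.2 hx)]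
    nlinarith
  · intro hy
    have hyc : 0 < dist y c := hR.trans hy
    refine ⟨inversion c R y, ⟨?_, ?_⟩, inversion_inversion c hR.ne' y⟩
    · rw [dist_inversion_center, div_lt_iff₀ hyc]
      nlinarith
    · rw [inversion_eq_center hR.ne']
      exact dist_pos.1 hyc

theorem ball_diff_ae_eq (c : R3) (R : ℝ) : (ball c R \ {c} : Set R3) =ᵐ[volume] ball c R :=
  sdiff_null_ae_eq_self (measure_singleton c)

theorem ball_compl_ae_eq (c : R3) {R : ℝ} (hR : R ≠ 0) :
    ((ball c R)ᶜ : Set R3) =ᵐ[volume] ((closedBall c R)ᶜ : Set R3) := by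
  refine EventuallyEq.compl ?_
  have : (closedBall c R : Set R3) \ sphere c R = ball c R := closedBall_sdiff_sphere
  rw [← this]
  exact sdiff_null_ae_eq_self (Measure.addHaar_sphere_of_ne_zero volume c hR)

/-- The change of variables by an inversion. -/
theorem integral_eq_integral_ball_add {c : R3} {R : ℝ} (hR : 0 < R) {g : R3 → ℝ}
    (hg : Integrable g) :
    IntegrableOn (fun y => (R / dist y c) ^ 6 * g (inversion c R y)) (ball c R \ {c}) ∧
    ∫ y, g y = ∫ y in ball c R \ {c}, (g y + (R / dist y c) ^ 6 * g (inversion c R y)) := by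
  have hs : MeasurableSet (ball c R \ {c} : Set R3) :=
    measurableSet_ball.diff (measurableSet_singleton c)
  have hder : ∀ x ∈ (ball c R \ {c} : Set R3), HasFDerivWithinAt (inversion c R)
      ((R / dist x c) ^ 2 • ((ℝ ∙ (x - c))ᗮ.reflection : R3 →L[ℝ] R3)) (ball c R \ {c}) x :=
    fun x hx => (hasFDerivAt_inversion hx.2).hasFDerivWithinAt
  have hinj : InjOn (inversion c R) (ball c R \ {c}) :=
    (inversion_injective c hR.ne').injOn
  have h1 := integral_image_eq_integral_abs_det_fderiv_smul volume hs hder hinj g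
  have h2 := (integrableOn_image_iff_integrableOn_abs_det_fderiv_smul volume hs hder hinj g).1
    hg.integrableOn
  simp only [abs_det_inversion, smul_eq_mul] at h1 h2
  refine ⟨h2, ?_⟩
  rw [integral_add hg.integrableOn h2, ← h1, inversion_image_ball hR,
    setIntegral_congr_set (ball_diff_ae_eq c R), ← setIntegral_congr_set (ball_compl_ae_eq c hR.ne'),
    integral_add_compl measurableSet_ball hg]

/-- The volume form `e^{3u} dx` is transformed with the Jacobian determinant. -/
theorem exp_sphereReflect {u : R3 → ℝ} {c x : R3} {R : ℝ} (hR : 0 < R) (hx : x ≠ c) :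
    Real.exp (3 * sphereReflect u c R x) =
      (R / dist x c) ^ 6 * Real.exp (3 * u (inversion c R x)) := by
  have hxc := dist_pos.2 hx
  have h : Real.exp (Real.log (R / dist x c)) = R / dist x c := Real.exp_log (by positivity)
  rw [sphereReflect, mul_add, Real.exp_add]
  congr 1
  nth_rewrite 2 [← h]
  rw [← Real.exp_nat_mul]
  congr 1
  push_cast
  ring

/-- The kernel `1 / |x - y|` has small integral over sets of small measure, uniformly in `x`. -/
theorem setIntegral_inv_norm_le {A : Set R3} (hA : volume A ≠ ⊤) (x : R3)
    {r : ℝ} (hr : 0 < r) :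
    IntegrableOn (fun y => ‖x - y‖⁻¹) A ∧
    ∫ y in A, ‖x - y‖⁻¹ ≤ r ^ 2 * poleMass 1 + r⁻¹ * volume.real A := by
  set g : R3 → ℝ := (ball (0 : R3) r).indicator fun z => ‖z‖⁻¹
  obtain ⟨hgx, hgint⟩ := integral_indicator_inv_norm_sub x hr
  have hg0 : ∀ z, 0 ≤ g z := indicator_nonneg (fun z _ => inv_nonneg.2 (norm_nonneg z))
  have hle : ∀ y, ‖x - y‖⁻¹ ≤ g (x - y) + r⁻¹ := by
    intro y
    by_cases hy : x - y ∈ ball (0 : R3) r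
    · have : g (x - y) = ‖x - y‖⁻¹ := indicator_of_mem hy _
      rw [this]; linarith [inv_pos.2 hr]
    · have h1 : r ≤ ‖x - y‖ := by simpa using hy
      exact (inv_anti₀ hr h1).trans (le_add_of_nonneg_left (hg0 _))
  have hI : IntegrableOn (fun y => g (x - y) + r⁻¹) A :=
    hgx.integrableOn.add (integrableOn_const hA)
  have hI2 : IntegrableOn (fun y => ‖x - y‖⁻¹) A :=
    hI.mono' (measurable_norm.comp (measurable_const.sub measurable_id)).inv.aestronglyMeasurable
      (Eventually.of_forall fun y => by rw [Real.norm_of_nonneg (by positivity)]; exact hle y)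
  refine ⟨hI2, (integral_mono hI2 hI hle).trans ?_⟩
  rw [integral_add hgx.integrableOn (integrableOn_const hA), setIntegral_const, smul_eq_mul,
    mul_comm r⁻¹]
  refine add_le_add_left ?_ _
  rw [← hgint]
  exact setIntegral_le_integral hgx (Eventually.of_forall fun y => hg0 _)

section
variable {u : R3 → ℝ} (hu : Continuous u) (hV : Integrable fun x => Real.exp (3 * u x)) {q : ℝ}
  (hrep : ∀ x, u x = logPotential u x + q)
  (hmass : 1 / Real.pi ^ 2 * ∫ y, Real.exp (3 * u y) = 2)

theorem continuous_sphereReflect {u : R3 → ℝ} (hu : Continuous u) (c : R3) {R : ℝ} (hR : 0 < R) :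
    ContinuousOn (sphereReflect u c R) {c}ᶜ := by
  have h1 : ContinuousOn (fun x : R3 => inversion c R x) {c}ᶜ :=
    continuousOn_const.inversion continuousOn_const continuousOn_id fun x hx => hx
  have h2 : ContinuousOn (fun x : R3 => Real.log (R / dist x c)) {c}ᶜ := by
    refine ContinuousOn.log (continuousOn_const.div (by fun_prop) fun x hx => ?_) fun x hx => ?_
    · exact (dist_pos.2 hx).ne'
    · exact (div_pos hR (dist_pos.2 hx)).ne'
  exact (h2.const_mul 2).add (hu.comp_continuousOn h1)

theorem measurableSet_sphereReflect_lt {u : R3 → ℝ} (hu : Continuous u) (c : R3) {R : ℝ}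
    (hR : 0 < R) : MeasurableSet {y ∈ ball c R \ {c} | sphereReflect u c R y < u y} := by
  have h1 : IsOpen (ball c R \ {c}) := isOpen_ball.sdiff isClosed_singleton
  have h2 : ContinuousOn (fun y => u y - sphereReflect u c R y) (ball c R \ {c}) :=
    hu.continuousOn.sub ((continuous_sphereReflect hu c hR).mono fun y hy => hy.2)
  have h3 := h2.isOpen_inter_preimage h1 isOpen_Ioi (t := Ioi 0)
  convert h3.measurableSet using 1
  ext y
  simp [sub_pos]

theorem tendsto_sphereReflect {u : R3 → ℝ} (hu : Continuous u) {c x : R3} (hx : x ≠ c)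
    {ι : Type*} {l : Filter ι} {r : ι → ℝ} {R : ℝ} (hR : 0 < R) (hr : Tendsto r l (𝓝 R)) :
    Tendsto (fun i => sphereReflect u c (r i) x) l (𝓝 (sphereReflect u c R x)) := by
  have hxc := dist_pos.2 hx
  have h1 : Tendsto (fun i => inversion c (r i) x) l (𝓝 (inversion c R x)) :=
    tendsto_const_nhds.inversion hr tendsto_const_nhds hx
  exact (((hr.div_const _).log (div_pos hR hxc).ne').const_mul 2).add
    ((hu.tendsto _).comp h1)

theorem sphereReflect_inversion (u : R3 → ℝ) {c x : R3} {R : ℝ} (hR : 0 < R) (hx : x ≠ c) :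
    u (inversion c R x) - sphereReflect u c R (inversion c R x) =
      -(u x - sphereReflect u c R x) := by
  have hxc := dist_pos.2 hx
  rw [sphereReflect, sphereReflect, inversion_inversion c hR.ne', dist_inversion_center,
    Real.log_div hR.ne' (by positivity), Real.log_div (by positivity) hxc.ne',
    Real.log_div hR.ne' hxc.ne', Real.log_pow]
  push_cast
  ring

include hu hV hrep hmass

/-- The difference between `u` and its reflection in a sphere, as a potential over the ball. -/
theorem sub_sphereReflect {c x : R3} {R : ℝ} (hR : 0 < R) (hx : x ≠ c) :
    IntegrableOn (fun y => invKer c R x y *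
      (Real.exp (3 * u y) - Real.exp (3 * sphereReflect u c R y))) (ball c R \ {c}) ∧
    u x - sphereReflect u c R x = 1 / Real.pi ^ 2 * ∫ y in ball c R \ {c}, invKer c R x y *
      (Real.exp (3 * u y) - Real.exp (3 * sphereReflect u c R y)) := by
  set f : R3 → ℝ := fun x => Real.exp (3 * u x)
  have hf : Continuous f := by fun_prop
  have hf0 : ∀ y, 0 ≤ f y := fun y => (Real.exp_pos _).le
  have hs : MeasurableSet (ball c R \ {c} : Set R3) :=
    measurableSet_ball.diff (measurableSet_singleton c)
  set x' := inversion c R x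
  have h1 := integrable_log_mul hf hV hf0 x
  have h2 := integrable_log_mul hf hV hf0 x'
  -- the constant `log (|x - c| / R)` in the kernel has coefficient `α = 2`: only for this mass is the
  -- reflection of `u` again a potential
  have hae : (fun y => Real.log (dist x c / R) * f y + (Real.log (‖y‖ / ‖x - y‖) * f y -
      Real.log (‖y‖ / ‖x' - y‖) * f y)) =ᵐ[volume] fun y => invKer c R x y * f y := by
    filter_upwards [ae_ne 0, ae_ne x, ae_ne x'] with y h0 hyx hyx'
    have e0 := (norm_pos_iff.2 h0).ne'
    have e1 := (norm_pos_iff.2 (sub_ne_zero.2 hyx.symm)).ne'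
    have e2 := (norm_pos_iff.2 (sub_ne_zero.2 hyx'.symm)).ne'
    rw [invKer, dist_eq_norm (inversion c R x) y, dist_eq_norm x y, Real.log_div e0 e1,
      Real.log_div e0 e2]
    ring
  have hI3 : Integrable fun y => Real.log (‖y‖ / ‖x - y‖) * f y - Real.log (‖y‖ / ‖x' - y‖) * f y :=
    h1.sub h2
  have hI : Integrable fun y => invKer c R x y * f y :=
    ((hV.const_mul (Real.log (dist x c / R))).add hI3).congr hae
  obtain ⟨h3, h4⟩ := integral_eq_integral_ball_add (c := c) hR hI
  have hae2 : ∀ᵐ y ∂(volume.restrict (ball c R \ {c})), invKer c R x y * f y +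
      (R / dist y c) ^ 6 * (invKer c R x (inversion c R y) * f (inversion c R y)) =
      invKer c R x y * (f y - Real.exp (3 * sphereReflect u c R y)) := by
    filter_upwards [ae_restrict_mem hs, ae_restrict_of_ae (ae_ne x),
      ae_restrict_of_ae (ae_ne x')] with y hy hyx hyx'
    rw [invKer_inversion hR hx hy.2 hyx hyx'.symm, exp_sphereReflect hR hy.2]
    ring
  refine ⟨(hI.integrableOn.add h3).congr hae2, ?_⟩
  -- fold the integral over the exterior into the ball, where the kernel changes sign
  rw [← integral_congr_ae hae2, ← h4, ← integral_congr_ae hae,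
    integral_add (hV.const_mul _) hI3, integral_sub h1 h2, integral_const_mul, sphereReflect,
    hrep x, hrep (inversion c R x)]
  have e1 : ∀ z, logPotential u z = 1 / Real.pi ^ 2 * ∫ y, Real.log (‖y‖ / ‖z - y‖) * f y :=
    fun z => rfl
  have hxc := dist_pos.2 hx
  rw [e1, e1, mul_add, mul_left_comm, hmass, ← inv_div (dist x c) R, Real.log_inv]
  ring

/-- With normalized mass two, `u` decays at most like `-2 log |x|`. -/
theorem exists_ge_log : ∃ C, ∀ x, -(2 * Real.log (1 + ‖x‖)) - C ≤ u x := by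
  obtain ⟨C, -, hC⟩ := exists_logPot_ge (f := fun x => Real.exp (3 * u x)) (by fun_prop) hV
    fun y => (Real.exp_pos _).le
  refine ⟨1 / Real.pi ^ 2 * C - q, fun x => ?_⟩
  have h1 := mul_le_mul_of_nonneg_left (hC x) (show 0 ≤ 1 / Real.pi ^ 2 by positivity)
  have h2 : logPotential u x =
    1 / Real.pi ^ 2 * logPot (fun x => Real.exp (3 * u x)) x := rfl
  rw [hrep x, h2, ← hmass]
  refine le_trans (le_of_eq ?_) (add_le_add_left h1 q)
  ring

/-- The reflection of `u` is bounded below on the ball. -/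
theorem exists_le_sphereReflect (c : R3) {R : ℝ} (hR : 0 < R) :
    ∃ C, ∀ x ∈ ball c R, x ≠ c → C ≤ sphereReflect u c R x := by
  obtain ⟨C, hC⟩ := exists_ge_log hu hV hrep hmass
  refine ⟨2 * Real.log R - 2 * Real.log (R * (1 + ‖c‖) + R ^ 2) - C, fun x hxR hx => ?_⟩
  have hxc := dist_pos.2 hx
  have hxR' : dist x c < R := hxR
  have h1 := hC (inversion c R x)
  have h2 : ‖inversion c R x‖ ≤ ‖c‖ + R ^ 2 / dist x c := by
    have := dist_triangle (inversion c R x) c 0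
    rw [dist_inversion_center, dist_zero_right, dist_zero_right] at this
    linarith
  have h3 : dist x c * (1 + ‖inversion c R x‖) ≤ R * (1 + ‖c‖) + R ^ 2 := by
    have h4 := mul_le_mul_of_nonneg_left h2 hxc.le
    rw [mul_add, mul_div_cancel₀ _ hxc.ne'] at h4
    nlinarith [norm_nonneg c]
  have h5 := Real.log_le_log (by positivity) h3
  rw [Real.log_mul hxc.ne' (by positivity)] at h5
  rw [sphereReflect, Real.log_div hR.ne' hxc.ne']
  linarith

/-- The comparison principle on sets of small measure: if `u` exceeds its reflection only on a
small part of the ball, then it does not exceed it at all. -/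
theorem exists_comparison {S : ℝ} (hS : ∀ x, u x ≤ S) (c : R3) {R₀ : ℝ} (hR₀ : 0 < R₀) :
    ∃ δ, 0 < δ ∧ ∀ R, 0 < R → R ≤ R₀ →
      volume.real {y ∈ ball c R \ {c} | sphereReflect u c R y < u y} ≤ δ →
      ∀ x ∈ ball c R, x ≠ c → u x ≤ sphereReflect u c R x := by
  set β := 1 / Real.pi ^ 2
  have hβ : 0 < β := by positivity
  set M := Real.exp (3 * S)
  have hM : 0 < M := Real.exp_pos _
  set Q := 6 * β * M * R₀
  have hQ : 0 < Q := by positivity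
  -- choose `r` and `δ` with `Q (r² m + δ / r) ≤ 1 / 2`
  have hm := poleMass_nonneg 1
  set r := min 1 (1 / (4 * Q * (poleMass 1 + 1)))
  have hr : 0 < r := lt_min one_pos (by positivity)
  have hr1 : r ≤ 1 := min_le_left _ _
  have hr2 : Q * (r ^ 2 * poleMass 1) ≤ 1 / 4 := by
    have h1 : r ≤ 1 / (4 * Q * (poleMass 1 + 1)) := min_le_right _ _
    rw [le_div_iff₀ (by positivity)] at h1
    have h2 : r ^ 2 ≤ r := by nlinarith
    have h3 : Q * (r ^ 2 * poleMass 1) ≤ Q * (r * poleMass 1) := by gcongr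
    nlinarith [mul_pos hr hQ]
  refine ⟨r / (4 * Q), by positivity, fun R hR hRR hδ => ?_⟩
  set s : Set R3 := ball c R \ {c}
  have hs : MeasurableSet s := measurableSet_ball.diff (measurableSet_singleton c)
  set A := {y ∈ s | sphereReflect u c R y < u y}
  have hA : MeasurableSet A := measurableSet_sphereReflect_lt hu c hR
  have hAfin : volume A ≠ ⊤ := by
    refine ((measure_mono ?_).trans_lt (measure_ball_lt_top (x := c) (r := R))).ne
    exact fun y hy => hy.1.1
  obtain ⟨C, hC⟩ := exists_le_sphereReflect hu hV hrep hmass c hR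
  -- one step halves any bound for the positive part of the difference
  have step : ∀ W : ℝ, 0 ≤ W → (∀ x ∈ s, u x - sphereReflect u c R x ≤ W) →
      ∀ x ∈ s, u x - sphereReflect u c R x ≤ W / 2 := by
    intro W hW hWs x hx
    obtain ⟨hI, hrepx⟩ := sub_sphereReflect hu hV hrep hmass hR hx.2
    obtain ⟨hJ, hJle⟩ := setIntegral_inv_norm_le hAfin x hr
    set g : R3 → ℝ := A.indicator fun y => ‖x - y‖⁻¹
    have hg : Integrable g := hJ.integrable_indicator hA
    have hle : ∫ y in s, invKer c R x y *
        (Real.exp (3 * u y) - Real.exp (3 * sphereReflect u c R y)) ≤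
        ∫ y in s, 6 * R₀ * M * W * g y := by
      refine integral_mono_ae hI (hg.integrableOn.const_mul _) ?_
      filter_upwards [ae_restrict_mem hs, ae_restrict_of_ae (ae_ne x)] with y hy hyx
      obtain ⟨hk0, hk1⟩ := invKer_bounds hR hx.2 hyx hx.1 hy.1
      set a := u y
      set b := sphereReflect u c R y
      show invKer c R x y * (Real.exp (3 * a) - Real.exp (3 * b)) ≤ 6 * R₀ * M * W * g y
      by_cases hyA : y ∈ A
      · have hgy : g y = ‖x - y‖⁻¹ := indicator_of_mem hyA _
        have hab : b < a := hyA.2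
        have h1 : Real.exp (3 * a) - Real.exp (3 * b) ≤ M * (3 * W) := by
          have h2 := Real.add_one_le_exp (3 * b - 3 * a)
          have h3 : Real.exp (3 * b) = Real.exp (3 * a) * Real.exp (3 * b - 3 * a) := by
            rw [← Real.exp_add]; ring_nf
          have h4 : Real.exp (3 * a) ≤ M := Real.exp_le_exp.2 (by linarith [hS y])
          have h5 : a - b ≤ W := hWs y hy
          have h6 := Real.exp_pos (3 * a)
          calc Real.exp (3 * a) - Real.exp (3 * b) =
              Real.exp (3 * a) * (1 - Real.exp (3 * b - 3 * a)) := by rw [h3]; ring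
            _ ≤ Real.exp (3 * a) * (3 * W) := by
              refine mul_le_mul_of_nonneg_left ?_ h6.le; linarith
            _ ≤ M * (3 * W) := by gcongr
        have h0 : 0 ≤ Real.exp (3 * a) - Real.exp (3 * b) :=
          sub_nonneg.2 (Real.exp_le_exp.2 (by linarith))
        rw [hgy]
        calc _ ≤ (2 * R * ‖x - y‖⁻¹) * (M * (3 * W)) := mul_le_mul hk1 h1 h0 (by positivity)
          _ ≤ (2 * R₀ * ‖x - y‖⁻¹) * (M * (3 * W)) := by gcongr
          _ = _ := by ring
      · have hgy : g y = 0 := indicator_of_notMem hyA _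
        have hab : a ≤ b := by
          by_contra hc
          exact hyA ⟨hy, not_le.1 hc⟩
        rw [hgy, mul_zero]
        exact mul_nonpos_of_nonneg_of_nonpos hk0.le
          (sub_nonpos.2 (Real.exp_le_exp.2 (by linarith)))
    have hgs : ∫ y in s, g y ≤ r ^ 2 * poleMass 1 + r⁻¹ * (r / (4 * Q)) := by
      refine (setIntegral_le_integral hg (Eventually.of_forall fun y =>
        indicator_nonneg (fun z _ => by positivity) y)).trans ?_
      rw [integral_indicator hA]
      refine hJle.trans ?_
      gcongr
    have hfinal : Q * (r ^ 2 * poleMass 1 + r⁻¹ * (r / (4 * Q))) ≤ 1 / 2 := by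
      have : Q * (r⁻¹ * (r / (4 * Q))) = 1 / 4 := by field_simp
      rw [mul_add, this]; linarith
    rw [hrepx]
    rw [integral_const_mul] at hle
    calc _ ≤ β * (6 * R₀ * M * W * (r ^ 2 * poleMass 1 + r⁻¹ * (r / (4 * Q)))) := by
          refine mul_le_mul_of_nonneg_left (hle.trans ?_) hβ.le
          gcongr
      _ = W * (Q * (r ^ 2 * poleMass 1 + r⁻¹ * (r / (4 * Q)))) := by simp only [Q]; ring
      _ ≤ W * (1 / 2) := by gcongr
      _ = _ := by ring
  have hiter : ∀ n : ℕ, ∀ x ∈ s, u x - sphereReflect u c R x ≤ |S - C| / 2 ^ n := by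
    intro n
    induction n with
    | zero =>
      intro x hx
      have h1 := hC x hx.1 hx.2
      have h2 := hS x
      have h3 := le_abs_self (S - C)
      simp only [pow_zero, div_one]
      linarith
    | succ n ih =>
      intro x hx
      refine (step _ (by positivity) ih x hx).trans (le_of_eq ?_)
      rw [pow_succ, div_div]
  intro x hxR hx
  have hlim : Tendsto (fun n : ℕ => |S - C| / 2 ^ n) atTop (𝓝 0) := by
    have := (tendsto_pow_atTop_nhds_zero_of_lt_one (r := (1 / 2 : ℝ)) (by norm_num)
      (by norm_num)).const_mul |S - C|
    simpa [div_eq_mul_inv] using this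
  have := ge_of_tendsto' hlim fun n => hiter n x ⟨hxR, hx⟩
  linarith

/-- If `u` stays below its reflection in a ball without being equal to it, then it is strictly
below it. -/
theorem lt_sphereReflect {c : R3} {R : ℝ} (hR : 0 < R)
    (hle : ∀ x ∈ ball c R, x ≠ c → u x ≤ sphereReflect u c R x)
    (hne : ∃ x, x ≠ c ∧ u x ≠ sphereReflect u c R x) :
    ∀ x ∈ ball c R, x ≠ c → u x < sphereReflect u c R x := by
  obtain ⟨z, hzR, hz, hzlt⟩ : ∃ z ∈ ball c R, z ≠ c ∧ u z < sphereReflect u c R z := by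
    obtain ⟨x, hx, hxne⟩ := hne
    have hxc := dist_pos.2 hx
    rcases lt_trichotomy (dist x c) R with h | h | h
    · exact ⟨x, h, hx, lt_of_le_of_ne (hle x h hx) hxne⟩
    · exfalso
      apply hxne
      rw [sphereReflect, inversion_of_mem_sphere (by exact h), h, div_self hR.ne', Real.log_one]
      ring
    · have h1 : inversion c R x ∈ ball c R := by
        rw [mem_ball, dist_inversion_center, div_lt_iff₀ hxc]; nlinarith
      have h2 : inversion c R x ≠ c := by rwa [Ne, inversion_eq_center hR.ne']
      refine ⟨_, h1, h2, lt_of_le_of_ne (hle _ h1 h2) fun h3 => hxne ?_⟩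
      have := sphereReflect_inversion u hR hx
      rw [h3] at this
      linarith
  intro x hxR hx
  refine lt_of_le_of_ne (hle x hxR hx) fun heq => ?_
  obtain ⟨hI, hrepx⟩ := sub_sphereReflect hu hV hrep hmass hR hx
  set s : Set R3 := ball c R \ {c}
  have hs : MeasurableSet s := measurableSet_ball.diff (measurableSet_singleton c)
  have hso : IsOpen s := isOpen_ball.sdiff isClosed_singleton
  set G : R3 → ℝ := fun y => -(invKer c R x y *
    (Real.exp (3 * u y) - Real.exp (3 * sphereReflect u c R y)))
  have hG0 : 0 ≤ᵐ[volume.restrict s] G := by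
    filter_upwards [ae_restrict_mem hs, ae_restrict_of_ae (ae_ne x)] with y hy hyx
    have h1 := (invKer_bounds hR hx hyx hxR hy.1).1
    have h2 := hle y hy.1 hy.2
    have h3 : Real.exp (3 * u y) ≤ Real.exp (3 * sphereReflect u c R y) :=
      Real.exp_le_exp.2 (by linarith)
    simp only [G, Pi.zero_apply]
    nlinarith
  -- at a point of contact the integral of a function of one sign vanishes, so that the open set on
  -- which `u` lies strictly below its reflection is null
  have hGint : ∫ y in s, G y = 0 := by
    simp only [G]
    rw [integral_neg, neg_eq_zero]
    rw [heq, sub_self] at hrepx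
    have : (1 / Real.pi ^ 2 : ℝ) ≠ 0 := by positivity
    exact (mul_eq_zero.1 hrepx.symm).resolve_left this
  have hGz := (setIntegral_eq_zero_iff_of_nonneg_ae hG0 hI.neg).1 hGint
  have hGz' : ∀ᵐ y, y ∈ s → ¬ u y < sphereReflect u c R y := by
    filter_upwards [(ae_restrict_iff' hs).1 hGz, ae_ne x] with y hy hyx hys hlt
    have h1 := (invKer_bounds hR hx hyx hxR hys.1).1
    have h2 := hy hys
    have h3 : Real.exp (3 * u y) < Real.exp (3 * sphereReflect u c R y) :=
      Real.exp_lt_exp.2 (by linarith)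
    simp only [G, Pi.zero_apply] at h2
    nlinarith
  set O := s ∩ (fun y => sphereReflect u c R y - u y) ⁻¹' Ioi 0
  have hO : IsOpen O := ContinuousOn.isOpen_inter_preimage
    (((continuous_sphereReflect hu c hR).mono fun y hy => hy.2).sub hu.continuousOn) hso isOpen_Ioi
  have hO0 : volume O = 0 := by
    refine measure_mono_null (fun y hy => ?_) hGz'
    simp only [mem_compl_iff, mem_ofPred_eq, not_forall, not_not]
    exact ⟨hy.1, sub_pos.1 hy.2⟩
  exact (hO.measure_pos volume ⟨z, ⟨hzR, hz⟩, sub_pos.2 hzlt⟩).ne' hO0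

/-- The method of moving spheres: about every point `u` is invariant under an inversion. -/
theorem exists_eq_sphereReflect (c : R3) :
    ∃ R, 0 < R ∧ ∀ x, x ≠ c → u x = sphereReflect u c R x := by
  have hrep' : ∀ x, u x ≤ logPotential u x + q := fun x => (hrep x).le
  obtain ⟨S, hS⟩ := exists_le_of_le_logPot hu hV hrep'
  by_contra hcon
  push Not at hcon
  set P : Set ℝ := {R | 0 < R ∧ ∀ x ∈ ball c R, x ≠ c → u x ≤ sphereReflect u c R x}
  have hsmall : ∀ R, volume.real {y ∈ ball c R \ {c} | sphereReflect u c R y < u y} ≤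
      volume.real (ball c R) := fun R =>
    measureReal_mono (fun y hy => hy.1.1) measure_ball_lt_top.ne
  -- small spheres
  have hPne : P.Nonempty := by
    obtain ⟨δ, hδ, h⟩ := exists_comparison hu hV hrep hmass hS c one_pos
    have h1 : Tendsto (fun R : ℝ => volume.real (ball c R)) (𝓝[>] 0) (𝓝 0) := by
      have h2 : Tendsto (fun R : ℝ => R ^ 3 * volume.real (ball (0 : R3) 1)) (𝓝[>] 0) (𝓝 0) := by
        have : Continuous fun R : ℝ => R ^ 3 * volume.real (ball (0 : R3) 1) := by fun_prop
        exact tendsto_nhdsWithin_of_tendsto_nhds (by simpa using this.tendsto 0)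
      refine h2.congr' ?_
      filter_upwards [self_mem_nhdsWithin] with R hR
      rw [← Measure.addHaar_real_closedBall_eq_addHaar_real_ball volume c,
        Measure.addHaar_real_closedBall volume _ (le_of_lt hR), finrank_euclideanSpace,
        Fintype.card_fin]
    have h3 : ∀ᶠ R : ℝ in 𝓝[>] 0, R ∈ Ioc (0 : ℝ) 1 := Ioc_mem_nhdsGT one_pos
    obtain ⟨R, hR1, hR2⟩ := ((h1.eventually_lt_const hδ).and h3).exists
    have hR0 := hR2.1
    exact ⟨R, hR0, h R hR0 hR2.2 ((hsmall R).trans hR1.le)⟩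
  -- the radii are bounded: at distance one from `c` the reflection is `2 log R + u` at distance `R²`
  -- from `c`, where `u ≤ -(3/2) log R² + C`
  have hPbdd : BddAbove P := by
    obtain ⟨C, hC⟩ := exists_logPotential_le hu hV hrep' (ε := 1 / 2) (by norm_num)
    rw [hmass] at hC
    obtain ⟨e, he⟩ : ∃ e : R3, ‖e‖ = 1 := ⟨EuclideanSpace.single 0 1, by simp⟩
    set x := c + e
    have hxc : dist x c = 1 := by simp [x, he]
    have hx : x ≠ c := by rw [← dist_pos, hxc]; exact one_pos
    set B := C + q - u x + 3 / 2 * Real.log (1 + ‖c‖)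
    refine ⟨max 1 (Real.exp B), fun R hR => ?_⟩
    rcases le_or_gt R 1 with h1 | h1
    · exact h1.trans (le_max_left _ _)
    refine le_trans ?_ (le_max_right _ _)
    rw [← Real.log_le_iff_le_exp hR.1]
    have h2 := hR.2 x (by rw [mem_ball, hxc]; exact h1) hx
    have h3 := hC (inversion c R x)
    have h4 := hrep (inversion c R x)
    rw [sphereReflect, hxc, div_one] at h2
    have h5 : 1 + R ^ 2 ≤ (1 + ‖inversion c R x‖) * (1 + ‖c‖) := by
      have := dist_triangle_right (inversion c R x) c 0
      rw [dist_inversion_center, hxc, dist_zero_right, dist_zero_right, div_one] at this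
      nlinarith [mul_nonneg (norm_nonneg (inversion c R x)) (norm_nonneg c)]
    have h6 := Real.log_le_log (pow_pos hR.1 2) ((le_add_of_nonneg_left zero_le_one).trans h5)
    rw [Real.log_mul (by positivity) (by positivity), Real.log_pow] at h6
    push_cast at h6
    simp only [B]
    linarith
  set R := sSup P
  obtain ⟨r, -, hrlim, hrP⟩ := exists_seq_tendsto_sSup hPne hPbdd
  have hR : 0 < R := hPne.some_mem.1.trans_le (le_csSup hPbdd hPne.some_mem)
  have hRP : ∀ x ∈ ball c R, x ≠ c → u x ≤ sphereReflect u c R x := by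
    intro x hxR hx
    refine ge_of_tendsto (tendsto_sphereReflect hu hx hR hrlim) ?_
    filter_upwards [hrlim.eventually_const_lt hxR] with n hn
    exact (hrP n).2 x hn hx
  have hstrict := lt_sphereReflect hu hV hrep hmass hR hRP (hcon R hR)
  -- slightly larger spheres
  obtain ⟨δ, hδ, h⟩ := exists_comparison hu hV hrep hmass hS c (R₀ := R + 1) (by linarith)
  set t : ℕ → ℝ := fun n => R + 1 / ((n : ℝ) + 1)
  have ht : Tendsto t atTop (𝓝 R) := by
    have := (tendsto_one_div_add_atTop_nhds_zero_nat (𝕜 := ℝ)).const_add R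
    rwa [add_zero] at this
  have htR : ∀ n, R < t n := fun n => lt_add_of_pos_right _ (by positivity)
  have htR1 : ∀ n, t n ≤ R + 1 := fun n => by
    simp only [t]
    have : 1 / ((n : ℝ) + 1) ≤ 1 := by
      rw [div_le_one (by positivity)]; linarith [n.cast_nonneg (α := ℝ)]
    linarith
  set A : ℕ → Set R3 := fun n => {y ∈ ball c (t n) \ {c} | sphereReflect u c (t n) y < u y}
  have hAm : ∀ n, MeasurableSet (A n) := fun n =>
    measurableSet_sphereReflect_lt hu c (hR.trans (htR n))
  have hlimA : Tendsto (fun n => volume (A n)) atTop (𝓝 (volume (∅ : Set R3))) := by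
    refine tendsto_measure_of_ae_tendsto_indicator atTop MeasurableSet.empty hAm
      (measurableSet_ball (x := c) (ε := R + 1)) measure_ball_lt_top.ne
      (Eventually.of_forall fun n y hy => ball_subset_ball (htR1 n) hy.1.1) ?_
    have hsph : ∀ᵐ y : R3, y ∉ sphere c R := by
      exact measure_eq_zero_iff_ae_notMem.1 (Measure.addHaar_sphere_of_ne_zero volume c hR.ne')
    filter_upwards [ae_ne c, hsph] with y hyc hyR
    rcases lt_or_gt_of_ne (show dist y c ≠ R from hyR) with h1 | h1
    · have h2 := (tendsto_sphereReflect hu hyc hR ht).eventually_const_lt (hstrict y h1 hyc)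
      filter_upwards [h2] with n hn
      simp only [A, mem_ofPred_eq, mem_empty_iff_false, iff_false, not_and, not_lt]
      exact fun _ => hn.le
    · filter_upwards [ht.eventually_lt_const h1] with n hn
      simp only [mem_empty_iff_false, iff_false]
      exact fun hy => absurd hy.1.1 (not_lt.2 hn.le)
  rw [measure_empty] at hlimA
  have hlimA' : Tendsto (fun n => volume.real (A n)) atTop (𝓝 0) := by
    exact (ENNReal.tendsto_toReal ENNReal.zero_ne_top).comp hlimA
  obtain ⟨n, hn⟩ := (hlimA'.eventually_lt_const hδ).exists
  have hmem : t n ∈ P := ⟨hR.trans (htR n), h (t n) (hR.trans (htR n)) (htR1 n) hn.le⟩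
  exact absurd (le_csSup hPbdd hmem) (not_le.2 (htR n))

end

/-! ### Functions invariant under an inversion about every point -/

/-- The volume of the round sphere in stereographic coordinates, `2π²`, divided by eight. -/
theorem integral_one_add_norm_sq_pow : ∫ x : R3, ((1 + ‖x‖ ^ 2) ^ 3)⁻¹ = Real.pi ^ 2 / 4 := by
  have hF : ∀ r : ℝ, HasDerivAt
      (fun r => 1 / 8 * (Real.arctan r + r * (r ^ 2 - 1) / (1 + r ^ 2) ^ 2))
      (r ^ 2 * ((1 + r ^ 2) ^ 3)⁻¹) r := by
    intro r
    have h0 : (1 : ℝ) + r ^ 2 ≠ 0 := by positivity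
    have h1 : HasDerivAt (fun r : ℝ => r * (r ^ 2 - 1)) (1 * (r ^ 2 - 1) + r * (2 * r)) r := by
      have := (hasDerivAt_id r).mul ((hasDerivAt_pow 2 r).sub_const 1)
      exact this.congr_deriv (by simp)
    have h2 : HasDerivAt (fun r : ℝ => (1 + r ^ 2) ^ 2) (2 * (1 + r ^ 2) * (2 * r)) r := by
      have := ((hasDerivAt_pow 2 r).const_add 1).pow 2
      exact this.congr_deriv (by simp)
    refine (((Real.hasDerivAt_arctan r).add (h1.div h2 (by positivity))).const_mul
      (1 / 8)).congr_deriv ?_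
    field_simp
    ring
  have hlim : Tendsto (fun r : ℝ => 1 / 8 * (Real.arctan r + r * (r ^ 2 - 1) / (1 + r ^ 2) ^ 2))
      atTop (𝓝 (1 / 8 * (Real.pi / 2 + 0))) := by
    have h1 : Tendsto (fun r : ℝ => r * (r ^ 2 - 1) / (1 + r ^ 2) ^ 2) atTop (𝓝 0) := by
      refine squeeze_zero' (g := fun r => r⁻¹) ?_ ?_ tendsto_inv_atTop_zero
      · filter_upwards [eventually_ge_atTop 1] with r hr
        have : 0 ≤ r ^ 2 - 1 := by nlinarith
        positivity
      · filter_upwards [eventually_ge_atTop 1] with r hr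
        rw [div_le_iff₀ (by positivity), inv_mul_eq_div, le_div_iff₀ (by linarith)]
        nlinarith [sq_nonneg r]
    exact ((tendsto_nhdsWithin_iff.1 Real.tendsto_arctan_atTop).1.add h1).const_mul _
  have h1 := integral_Ioi_of_hasDerivAt_of_nonneg' (a := 0) (fun r _ => hF r)
    (fun r hr => by positivity) hlim
  have h2 := integral_fun_norm_addHaar (volume : Measure R3) fun r : ℝ => ((1 + r ^ 2) ^ 3)⁻¹
  rw [h2]
  have h3 : volume.real (ball (0 : R3) 1) = 4 / 3 * Real.pi := by
    rw [Measure.real, EuclideanSpace.volume_ball_fin_three, ENNReal.ofReal_one, one_pow, one_mul,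
      ENNReal.toReal_ofReal (by positivity)]
    ring
  simp only [finrank_euclideanSpace, Fintype.card_fin, smul_eq_mul, nsmul_eq_mul]
  norm_num at h1 ⊢
  rw [h1, h3]
  ring

theorem integral_add_norm_sq_pow (x₀ : R3) {b : ℝ} (hb : 0 < b) :
    ∫ x : R3, ((b ^ 2 + ‖x - x₀‖ ^ 2) ^ 3)⁻¹ = (b ^ 3)⁻¹ * (Real.pi ^ 2 / 4) := by
  rw [integral_sub_right_eq_self (fun x : R3 => ((b ^ 2 + ‖x‖ ^ 2) ^ 3)⁻¹) x₀]
  have h := Measure.integral_comp_smul_of_nonneg (volume : Measure R3)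
    (fun x : R3 => ((b ^ 2 + ‖x‖ ^ 2) ^ 3)⁻¹) b (hR := hb.le)
  have h2 : ∀ x : R3, ((b ^ 2 + ‖b • x‖ ^ 2) ^ 3)⁻¹ = (b ^ 6)⁻¹ * ((1 + ‖x‖ ^ 2) ^ 3)⁻¹ := by
    intro x
    rw [norm_smul, Real.norm_of_nonneg hb.le, ← mul_inv]
    congr 1
    ring
  simp only [h2, integral_const_mul, integral_one_add_norm_sq_pow, finrank_euclideanSpace,
    Fintype.card_fin, smul_eq_mul] at h
  field_simp at h ⊢
  linarith

/-- The expansion at infinity, along a ray, of a function invariant under an inversion: the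
function `u(e / s) - 2 log s` extends to `s = 0` with a derivative. -/
theorem hasDerivAt_sphereReflect_at_infinity {u : R3 → ℝ} (hu : Differentiable ℝ u) {c : R3}
    {R : ℝ} (hR : 0 < R) (h : ∀ x, x ≠ c → u x = sphereReflect u c R x) {e : R3} (he : ‖e‖ = 1) :
    ∃ Φ : ℝ → ℝ, Φ 0 = 2 * Real.log R + u c ∧
      HasDerivAt Φ (2 * inner ℝ e c + R ^ 2 * fderiv ℝ u c e) 0 ∧
      ∀ᶠ s in 𝓝[>] 0, Φ s = u (s⁻¹ • e) - 2 * Real.log s := by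
  -- `Φ s` is the reflection of `u` at `e / s`, plus `-2 log s`; the inversion `γ s` of `e / s` and the
  -- factor `D s = |e - s c|²` extend smoothly to `s = 0`
  set D : ℝ → ℝ := fun s => 1 - 2 * s * inner ℝ e c + s ^ 2 * ‖c‖ ^ 2
  have hD0 : D 0 = 1 := by simp [D]
  have hDd : HasDerivAt D (-(2 * inner ℝ e c)) 0 := by
    have h1 := (((hasDerivAt_id (0 : ℝ)).const_mul 2).mul_const (inner ℝ e c)).const_sub 1
    have h2 := h1.add ((hasDerivAt_pow 2 (0 : ℝ)).mul_const (‖c‖ ^ 2))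
    exact h2.congr_deriv (by simp)
  have hDn : ∀ s, D s = ‖e - s • c‖ ^ 2 := by
    intro s
    rw [norm_sub_sq_real, he, norm_smul, inner_smul_right, mul_pow, Real.norm_eq_abs, sq_abs]
    simp only [D]; ring
  set γ : ℝ → R3 := fun s => c + (R ^ 2 * s / D s) • (e - s • c)
  have hγ0 : γ 0 = c := by simp [γ]
  have hγd : HasDerivAt γ (R ^ 2 • e) 0 := by
    have h1 : HasDerivAt (fun s => R ^ 2 * s / D s) (R ^ 2) 0 := by
      have := ((hasDerivAt_id (0 : ℝ)).const_mul (R ^ 2)).div hDd (by rw [hD0]; exact one_ne_zero)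
      exact this.congr_deriv (by simp [hD0])
    have h2 : HasDerivAt (fun s : ℝ => e - s • c) (-c) 0 := by
      simpa using ((hasDerivAt_id (0 : ℝ)).smul_const c).const_sub e
    exact ((h1.smul h2).const_add c).congr_deriv (by simp)
  refine ⟨fun s => 2 * Real.log R - Real.log (D s) + u (γ s), by simp [hD0, hγ0], ?_, ?_⟩
  · have h1 : HasDerivAt (fun s => u (γ s)) (fderiv ℝ u c (R ^ 2 • e)) 0 := by
      have h2 := (hu (γ 0)).hasFDerivAt.comp_hasDerivAt (0 : ℝ) hγd
      rw [hγ0] at h2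
      exact h2
    have h2 := (((hDd.log (by rw [hD0]; exact one_ne_zero)).const_sub (2 * Real.log R)).add h1)
    refine h2.congr_deriv ?_
    rw [hD0, map_smul, smul_eq_mul]
    ring
  · have h1 : ∀ᶠ s in 𝓝[>] (0 : ℝ), D s ≠ 0 :=
      nhdsWithin_le_nhds (hDd.continuousAt.eventually_ne (by rw [hD0]; exact one_ne_zero))
    filter_upwards [h1, self_mem_nhdsWithin] with s hs hs0
    have hs0 : 0 < s := hs0
    have hec : 0 < ‖e - s • c‖ := by
      refine (norm_nonneg _).lt_of_ne fun h0 => hs ?_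
      rw [hDn, ← h0]; simp
    have e1 : s⁻¹ • e - c = s⁻¹ • (e - s • c) := by
      rw [smul_sub, smul_smul, inv_mul_cancel₀ hs0.ne', one_smul]
    have hdist : dist (s⁻¹ • e) c = s⁻¹ * ‖e - s • c‖ := by
      rw [dist_eq_norm, e1, norm_smul, Real.norm_of_nonneg (inv_nonneg.2 hs0.le)]
    have hne : s⁻¹ • e ≠ c := by
      rw [← dist_pos, hdist]; positivity
    have hinv : EuclideanGeometry.inversion c R (s⁻¹ • e) = γ s := by
      rw [EuclideanGeometry.inversion, hdist]
      simp only [vsub_eq_sub, vadd_eq_add, γ, hDn]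
      rw [e1, smul_smul, add_comm]
      congr 2
      field_simp
    rw [h _ hne, sphereReflect, hinv, hdist, Real.log_div hR.ne' (by positivity),
      Real.log_mul (by positivity) hec.ne', Real.log_inv, hDn, Real.log_pow]
    push_cast
    ring

/-- A function invariant under an inversion about every point is spherical, provided that it has
the right mass. -/
theorem isSpherical_of_sphereReflect {u : R3 → ℝ} (hu : Differentiable ℝ u)
    (h : ∀ c, ∃ R, 0 < R ∧ ∀ x, x ≠ c → u x = sphereReflect u c R x)
    (hmass : ∫ y, Real.exp (3 * u y) = 2 * Real.pi ^ 2) : IsSpherical u := by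
  choose R hR hRu using h
  -- the expansion at infinity does not depend on the centre `c`; comparing the constant terms gives
  -- `R(c)² = exp (L - u(c))`, and the next terms a first order equation for `u`
  have hcmp : ∀ c (e : R3), ‖e‖ = 1 → 2 * Real.log (R c) + u c = 2 * Real.log (R 0) + u 0 ∧
      2 * inner ℝ e c + R c ^ 2 * fderiv ℝ u c e = R 0 ^ 2 * fderiv ℝ u 0 e := by
    intro c e he
    obtain ⟨Φ, h1, h2, h3⟩ := hasDerivAt_sphereReflect_at_infinity hu (hR c) (hRu c) he
    obtain ⟨Ψ, k1, k2, k3⟩ := hasDerivAt_sphereReflect_at_infinity hu (hR 0) (hRu 0) he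
    have heq : Φ =ᶠ[𝓝[>] 0] Ψ := by
      filter_upwards [h3, k3] with s a b using a.trans b.symm
    have h0 : Φ 0 = Ψ 0 := tendsto_nhds_unique
      ((h2.continuousAt.tendsto.mono_left nhdsWithin_le_nhds).congr' heq)
      (k2.continuousAt.tendsto.mono_left nhdsWithin_le_nhds)
    have h4 : HasDerivWithinAt Φ _ (Ioi 0) 0 := k2.hasDerivWithinAt.congr_of_eventuallyEq heq h0
    have h5 := (uniqueDiffWithinAt_Ioi (0 : ℝ)).eq_deriv _ h2.hasDerivWithinAt h4
    refine ⟨by rw [← h1, ← k1, h0], ?_⟩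
    simpa using h5
  obtain ⟨e₀, he₀⟩ : ∃ e : R3, ‖e‖ = 1 := ⟨EuclideanSpace.single 0 1, by simp⟩
  set L := 2 * Real.log (R 0) + u 0
  have hg : ∀ c, R c ^ 2 = Real.exp (L - u c) := by
    intro c
    rw [← (hcmp c e₀ he₀).1, add_sub_cancel_right]
    have := Real.exp_log (hR c)
    rw [two_mul, Real.exp_add, this]
    ring
  set ℓ : R3 →L[ℝ] ℝ := R 0 ^ 2 • fderiv ℝ u 0
  have hgd : ∀ c, HasFDerivAt (fun c => Real.exp (L - u c) - ‖c‖ ^ 2 + ℓ c)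
      (0 : R3 →L[ℝ] ℝ) c := by
    intro c
    have h1 := ((hu c).hasFDerivAt.const_sub L).exp
    have h2 := (h1.sub (hasFDerivAt_norm_sq_add 0 c)).add ℓ.hasFDerivAt
    have h3 : (fun c : R3 => Real.exp (L - u c) - ‖c‖ ^ 2 + ℓ c) =
        fun c => Real.exp (L - u c) - (‖c‖ ^ 2 + 0) + ℓ c := by simp
    rw [h3]
    refine HasFDerivAt.congr_fderiv h2 ?_
    have key : ∀ e : R3, ‖e‖ = 1 → -(Real.exp (L - u c) * fderiv ℝ u c e) - 2 * inner ℝ c e + ℓ e = 0 := by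
      intro e he
      have := (hcmp c e he).2
      rw [hg c, real_inner_comm] at this
      simp only [ℓ, smul_apply, smul_eq_mul]
      linarith
    ext e
    rcases eq_or_ne e 0 with rfl | he
    · simp
    · have he' : ‖e‖ ≠ 0 := norm_ne_zero_iff.2 he
      have h4 := key (‖e‖⁻¹ • e) (by rw [norm_smul, norm_inv, norm_norm, inv_mul_cancel₀ he'])
      rw [map_smul, map_smul, inner_smul_right, smul_eq_mul, smul_eq_mul] at h4
      have h5 : ‖e‖⁻¹ * (-(Real.exp (L - u c) * fderiv ℝ u c e) - 2 * inner ℝ c e + ℓ e) = 0 := by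
        linarith
      have h6 := (mul_eq_zero.1 h5).resolve_left (inv_ne_zero he')
      simpa [sub_eq_add_neg] using h6
  -- hence `exp (L - u)` is a quadratic polynomial with leading part `|c|²`
  have hconst : ∀ c, Real.exp (L - u c) - ‖c‖ ^ 2 + ℓ c = Real.exp (L - u 0) := by
    intro c
    have := is_const_of_fderiv_eq_zero (fun x => (hgd x).differentiableAt)
      (fun x => (hgd x).fderiv) c 0
    simpa using this
  set k := (InnerProductSpace.toDual ℝ R3).symm ℓ
  have hk : ∀ c, ℓ c = inner ℝ k c := fun c => by
    rw [InnerProductSpace.toDual_symm_apply]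
  set x₀ : R3 := (1 / 2 : ℝ) • k
  set b := Real.exp (L - u 0) - ‖x₀‖ ^ 2
  have hform : ∀ c, Real.exp (L - u c) = b + ‖c - x₀‖ ^ 2 := by
    intro c
    have h1 := hconst c
    rw [hk] at h1
    have h2 : inner ℝ k c = 2 * inner ℝ c x₀ := by
      simp only [x₀]; rw [inner_smul_right, real_inner_comm]; ring
    rw [norm_sub_sq_real]
    simp only [b]
    linarith
  have hb : 0 < b := by
    have := hform x₀
    rw [sub_self, norm_zero] at this
    have h2 := Real.exp_pos (L - u x₀)
    linarith
  have hu2 : ∀ x, u x = L - Real.log (b + ‖x - x₀‖ ^ 2) := by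
    intro x
    rw [← hform, Real.log_exp]; ring
  have hb2 : Real.sqrt b ^ 2 = b := Real.sq_sqrt hb.le
  have hsb : 0 < Real.sqrt b := Real.sqrt_pos.2 hb
  set a := Real.sqrt b
  -- the mass determines the additive constant
  have hexp : ∀ x, Real.exp (3 * u x) = Real.exp L ^ 3 * ((a ^ 2 + ‖x - x₀‖ ^ 2) ^ 3)⁻¹ := by
    intro x
    have h1 : Real.exp (u x) = Real.exp L * (a ^ 2 + ‖x - x₀‖ ^ 2)⁻¹ := by
      rw [hu2, Real.exp_sub, Real.exp_log (by positivity), hb2, div_eq_mul_inv]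
    have h2 : Real.exp (3 * u x) = Real.exp (u x) ^ 3 := by
      rw [← Real.exp_nat_mul]; norm_num
    rw [h2, h1, mul_pow, inv_pow]
  simp only [hexp] at hmass
  rw [integral_const_mul, integral_add_norm_sq_pow x₀ hsb] at hmass
  have hL : Real.exp L = 2 * a := by
    have h1 : Real.exp L ^ 3 = (2 * a) ^ 3 := by
      have := Real.pi_pos
      field_simp at hmass
      linarith
    exact (pow_left_inj₀ (Real.exp_pos L).le (by positivity) (by norm_num)).1 h1
  refine ⟨x₀, a⁻¹, inv_pos.2 hsb, fun x => ?_⟩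
  have h1 : 2 * a⁻¹ / (1 + a⁻¹ ^ 2 * ‖x - x₀‖ ^ 2) = 2 * a / (b + ‖x - x₀‖ ^ 2) := by
    rw [← hb2]
    field_simp
  rw [h1, ← hL, Real.log_div (Real.exp_pos _).ne' (by positivity), Real.log_exp, hu2]

/-- The classification of the solutions whose polynomial part is constant. -/
theorem isSpherical_of_eq_logPotential_add_const {u : R3 → ℝ} (hu : ContDiff ℝ 1 u)
    (hV : Integrable fun x => Real.exp (3 * u x)) {q : ℝ}
    (hrep : ∀ x, u x = logPotential u x + q) : IsSpherical u := by
  obtain ⟨S, hS⟩ := exists_le_of_le_logPot hu.continuous hV fun x => (hrep x).le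
  have hmass := normalizedMass_eq_two hu hV (β := 1 / Real.pi ^ 2) hS fun x e => by
    have h1 := ((hasFDerivAt_logPot (f := fun x => Real.exp (3 * u x))
      (Real.continuous_exp.comp (continuous_const.mul hu.continuous)) hV
      (fun y => (Real.exp_pos _).le) x).const_mul (1 / Real.pi ^ 2)).add_const q
    have h2 : HasFDerivAt u _ x := h1.congr_of_eventuallyEq (Eventually.of_forall fun x => hrep x)
    rw [h2.fderiv]
    simp
  refine isSpherical_of_sphereReflect (hu.differentiable (by simp))
    (exists_eq_sphereReflect hu.continuous hV hrep hmass) ?_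
  have := Real.pi_pos
  field_simp at hmass
  linarith

/-! ### The scalar curvature of a conformally flat metric -/

theorem partialDeriv_sub_add {u : R3 → ℝ} (hu : ContDiff ℝ 2 u) (a b c : ℝ) (m i j k : Fin 3)
    (x : R3) :
    partialDeriv m (fun y => a * partialDeriv i u y + b * partialDeriv j u y -
      c * partialDeriv k u y) x =
    a * partialDeriv m (partialDeriv i u) x + b * partialDeriv m (partialDeriv j u) x -
      c * partialDeriv m (partialDeriv k u) x := by
  have hd : ∀ i, HasFDerivAt (partialDeriv i u) (fderiv ℝ (partialDeriv i u) x) x := fun i =>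
    (((hu.fderiv_right (m := 1) (by norm_num)).clm_apply contDiff_const).differentiable
      (by simp) x).hasFDerivAt
  have h : HasFDerivAt (fun y => a * partialDeriv i u y + b * partialDeriv j u y -
      c * partialDeriv k u y) _ x :=
    (((hd i).const_mul a).add ((hd j).const_mul b)).sub ((hd k).const_mul c)
  rw [partialDeriv, h.fderiv]
  simp [partialDeriv]

theorem metricMatrix_conformalMetric (u : R3 → ℝ) (x : R3) :
    metricMatrix (conformalMetric u) x = Real.exp (2 * u x) • (1 : Matrix (Fin 3) (Fin 3) ℝ) := by
  ext i j
  have h : metricMatrix (conformalMetric u) x i j = Real.exp (2 * u x) *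
    inner ℝ (EuclideanSpace.single i (1 : ℝ)) (EuclideanSpace.single j 1) := rfl
  rw [h, EuclideanSpace.inner_single_left]
  simp [Matrix.one_apply, PiLp.single_apply]

theorem metricMatrix_conformalMetric_inv (u : R3 → ℝ) (x : R3) :
    (metricMatrix (conformalMetric u) x)⁻¹ =
      Real.exp (-(2 * u x)) • (1 : Matrix (Fin 3) (Fin 3) ℝ) := by
  rw [metricMatrix_conformalMetric]
  refine Matrix.inv_eq_left_inv ?_
  rw [Matrix.smul_mul, Matrix.one_mul, smul_smul, ← Real.exp_add, neg_add_cancel, Real.exp_zero,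
    one_smul]

theorem partialDeriv_metricMatrix {u : R3 → ℝ} (hu : ContDiff ℝ 2 u) (m i j : Fin 3) (x : R3) :
    partialDeriv m (fun y => metricMatrix (conformalMetric u) y i j) x =
      2 * Real.exp (2 * u x) * partialDeriv m u x * (1 : Matrix (Fin 3) (Fin 3) ℝ) i j := by
  have hd := (hu.differentiable (by simp) x).hasFDerivAt
  have h := (hd.const_mul 2).exp.mul_const ((1 : Matrix (Fin 3) (Fin 3) ℝ) i j)
  simp only [metricMatrix_conformalMetric, Matrix.smul_apply, smul_eq_mul]
  rw [partialDeriv, h.fderiv]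
  simp [partialDeriv]
  ring

theorem christoffel_conformalMetric {u : R3 → ℝ} (hu : ContDiff ℝ 2 u) (k i j : Fin 3) :
    christoffel (conformalMetric u) k i j = fun x =>
      (1 : Matrix (Fin 3) (Fin 3) ℝ) j k * partialDeriv i u x +
      (1 : Matrix (Fin 3) (Fin 3) ℝ) i k * partialDeriv j u x -
      (1 : Matrix (Fin 3) (Fin 3) ℝ) i j * partialDeriv k u x := by
  funext x
  have he : Real.exp (-(2 * u x)) * Real.exp (2 * u x) = 1 := by
    rw [← Real.exp_add, neg_add_cancel, Real.exp_zero]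
  simp only [christoffel, metricMatrix_conformalMetric_inv, partialDeriv_metricMatrix hu,
    Matrix.smul_apply, smul_eq_mul]
  rw [Finset.sum_eq_single k (fun l _ hl => by rw [Matrix.one_apply_ne hl.symm]; ring) (by simp),
    Matrix.one_apply_eq]
  linear_combination ((1 : Matrix (Fin 3) (Fin 3) ℝ) j k * partialDeriv i u x +
      (1 : Matrix (Fin 3) (Fin 3) ℝ) i k * partialDeriv j u x -
      (1 : Matrix (Fin 3) (Fin 3) ℝ) i j * partialDeriv k u x) * he

theorem laplacian_eq_sum_partialDeriv {u : R3 → ℝ} (hu : ContDiff ℝ 2 u) (x : R3) :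
    Δ u x = ∑ i, partialDeriv i (partialDeriv i u) x := laplacian_eq_sum_fderiv hu x

/-- The scalar curvature of `e^{2u} |dx|²` is `-e^{-2u} (4 Δu + 2 |∇u|²)`. -/
theorem scalarCurvature_conformalMetric {u : R3 → ℝ} (hu : ContDiff ℝ 2 u) (x : R3) :
    scalarCurvature (conformalMetric u) x =
      Real.exp (-(2 * u x)) * (-4 * Δ u x - 2 * ∑ i, partialDeriv i u x ^ 2) := by
  simp only [scalarCurvature, metricMatrix_conformalMetric_inv, Matrix.smul_apply, smul_eq_mul,
    laplacian_eq_sum_partialDeriv hu]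
  have h : ∀ i, ∑ j, Real.exp (-(2 * u x)) * (1 : Matrix (Fin 3) (Fin 3) ℝ) i j *
      ricci (conformalMetric u) i j x = Real.exp (-(2 * u x)) * ricci (conformalMetric u) i i x := by
    intro i
    rw [Finset.sum_eq_single i (fun j _ hj => by rw [Matrix.one_apply_ne hj.symm]; ring) (by simp),
      Matrix.one_apply_eq, mul_one]
  simp only [h]
  rw [← Finset.mul_sum]
  congr 1
  simp only [ricci, christoffel_conformalMetric hu, partialDeriv_sub_add hu]
  simp [Fin.sum_univ_three, Matrix.one_apply]
  ring

theorem sum_partialDeriv_sq {u : R3 → ℝ} {G : R3} {x : R3} (h : HasFDerivAt u (innerSL ℝ G) x) :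
    ∑ i, partialDeriv i u x ^ 2 = ‖G‖ ^ 2 := by
  rw [EuclideanSpace.norm_sq_eq]
  refine Finset.sum_congr rfl fun i _ => ?_
  rw [partialDeriv, h.fderiv]
  simp [EuclideanSpace.inner_single_right]

/-! ### Spherical solutions -/

/-- Gradient and Laplacian of the spherical solution `log (2l / (1 + l²|x - x₀|²))`. -/
theorem IsSpherical.derivatives {u : R3 → ℝ} (hu : IsSpherical u) :
    ∃ (x₀ : R3) (e : ℝ), 0 < e ∧ ∀ x, Real.exp (-(2 * u x)) = (‖x - x₀‖ ^ 2 + e) ^ 2 / (4 * e) ∧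
      HasFDerivAt u (innerSL ℝ (-(2 : ℝ) • gradKer e (x - x₀))) x ∧
      Δ u x = -2 * (3 / (‖x - x₀‖ ^ 2 + e) - 2 * ‖x - x₀‖ ^ 2 / (‖x - x₀‖ ^ 2 + e) ^ 2) := by
  obtain ⟨x₀, l, hl, h⟩ := hu
  set e := (l ^ 2)⁻¹
  have he : 0 < e := by positivity
  have hrw : ∀ x, 2 * l / (1 + l ^ 2 * ‖x - x₀‖ ^ 2) = 2 * l * e / (‖x - x₀‖ ^ 2 + e) := by
    intro x
    simp only [e]
    field_simp
    ring
  have hux : ∀ x, u x = Real.log (2 * l * e) - 2 * logKer e (x - x₀) := by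
    intro x
    rw [h, hrw, Real.log_div (by positivity) (by positivity), logKer]
    ring
  have hd : ∀ x, HasFDerivAt u (innerSL ℝ (-(2 : ℝ) • gradKer e (x - x₀))) x := by
    intro x
    have h1 := (hasFDerivAt_logKer he (x - x₀)).comp x ((hasFDerivAt_id x).sub_const x₀)
    have h2 : HasFDerivAt (fun x => Real.log (2 * l * e) - 2 * logKer e (x - x₀)) _ x :=
      (h1.const_mul 2).const_sub (Real.log (2 * l * e))
    rw [funext hux]
    refine h2.congr_fderiv ?_
    ext y
    simp
  refine ⟨x₀, e, he, fun x => ⟨?_, hd x, ?_⟩⟩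
  · have h1 : Real.exp (-(2 * u x)) = (Real.exp (u x) ^ 2)⁻¹ := by
      rw [← Real.exp_nat_mul, ← Real.exp_neg]; norm_num
    have h2 : l ^ 2 * e = 1 := mul_inv_cancel₀ (by positivity)
    rw [h1, h, hrw, Real.exp_log (by positivity), div_pow, inv_div]
    have h3 : (2 * l * e) ^ 2 = 4 * e := by linear_combination 4 * e * h2
    rw [h3]
  · have h1 : HasFDerivAt (fun x => -(2 : ℝ) • gradKer e (x - x₀))
        (-(2 : ℝ) • hessKer e (x - x₀)) x := by
      have h2 := (hasFDerivAt_gradKer he (x - x₀)).comp x ((hasFDerivAt_id x).sub_const x₀)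
      exact (h2.const_smul (-(2 : ℝ))).congr_fderiv (by ext; simp)
    rw [laplacian_eq_sum hd h1]
    have hn : ‖x - x₀‖ ^ 2 = (x - x₀) 0 ^ 2 + (x - x₀) 1 ^ 2 + (x - x₀) 2 ^ 2 := by
      rw [EuclideanSpace.norm_sq_eq, Fin.sum_univ_three]; simp
    have hne : ‖x - x₀‖ ^ 2 + e ≠ 0 := by positivity
    set z := x - x₀
    simp [Fin.sum_univ_three, hessKer, EuclideanSpace.inner_single_right]
    field_simp
    rw [hn]
    ring

theorem IsSpherical.scalarCurvature_eq {u : R3 → ℝ} (hu : IsSpherical u) (hs : ContDiff ℝ 2 u)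
    (x : R3) : scalarCurvature (conformalMetric u) x = 6 := by
  obtain ⟨x₀, e, he, h⟩ := hu.derivatives
  obtain ⟨h1, h2, h3⟩ := h x
  have hne : ‖x - x₀‖ ^ 2 + e ≠ 0 := by positivity
  rw [scalarCurvature_conformalMetric hs, sum_partialDeriv_sq h2, h1, h3, norm_smul, norm_gradKer,
    abs_of_pos (by positivity)]
  norm_num
  field_simp
  ring

theorem tendsto_ray_cocompact (x₀ : R3) {e : R3} (he : e ≠ 0) :
    Tendsto (fun t : ℝ => x₀ + t • e) atTop (cocompact R3) := by
  rw [← Metric.cobounded_eq_cocompact, ← tendsto_norm_atTop_iff_cobounded]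
  have h1 : Tendsto (fun t : ℝ => t * ‖e‖ - ‖x₀‖) atTop atTop :=
    tendsto_atTop_add_const_right _ _ (tendsto_id.atTop_mul_const (norm_pos_iff.2 he))
  refine tendsto_atTop_mono' _ ?_ h1
  filter_upwards [eventually_ge_atTop 0] with t ht
  have h2 := norm_sub_le_norm_add (t • e) x₀
  rw [norm_smul, Real.norm_of_nonneg ht, add_comm] at h2
  exact h2

/-- The scalar curvature is not bounded below near infinity if the polynomial part is not
constant: along a ray on which the gradient of the polynomial grows, `|∇u|² → ∞` while `Δu` and
`e^{2u}` stay bounded. -/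
theorem exists_scalarCurvature_lt {u : R3 → ℝ} (hu : ContDiff ℝ 2 u)
    (hV : Integrable fun x => Real.exp (3 * u x)) {T : R3 →ₗ[ℝ] R3} (hT : T.IsSymmetric)
    (hT0 : ∀ x, inner ℝ (T x) x ≤ 0) {x₀ : R3} {q : ℝ}
    (hrep : ∀ x, u x = logPotential u x + (q + 1 / 2 * inner ℝ (T (x - x₀)) (x - x₀)))
    {c : ℝ} (hc : ∀ x, Δ u x = -(1 / Real.pi ^ 2 * rieszPot (fun y => Real.exp (3 * u y)) x) + c)
    (hTne : T ≠ 0) (a : ℝ) :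
    ∃ᶠ x in cocompact R3, scalarCurvature (conformalMetric u) x < a := by
  have hle : ∀ x, u x ≤ logPotential u x + q := fun x => by
    have := hT0 (x - x₀)
    rw [hrep x]; linarith
  obtain ⟨S, hS⟩ := exists_le_of_le_logPot hu.continuous hV hle
  obtain ⟨e, he⟩ : ∃ e, T e ≠ 0 := by
    by_contra hcon
    push Not at hcon
    exact hTne (LinearMap.ext hcon)
  have hTe : 0 < ‖T e‖ := norm_pos_iff.2 he
  have he0 : e ≠ 0 := by rintro rfl; simp at he
  -- the ray from the maximum of the polynomial in a direction of strict concavity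
  set γ : ℝ → R3 := fun t => x₀ + t • e
  have hγ : Tendsto γ atTop (cocompact R3) := tendsto_ray_cocompact x₀ he0
  set g : R3 → R3 := fun x => ∫ y, Real.exp (3 * u y) • gradKer 0 (x - y)
  have hgrad : ∀ x, HasFDerivAt u (innerSL ℝ (T (x - x₀) - (1 / Real.pi ^ 2) • g x)) x := by
    intro x
    have h1 := ((hasFDerivAt_logPot (f := fun x => Real.exp (3 * u x))
      (Real.continuous_exp.comp (continuous_const.mul hu.continuous)) hV
      (fun y => (Real.exp_pos _).le) x).const_mul (1 / Real.pi ^ 2)).add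
        (fderiv_quadratic hT x₀ q x)
    have h2 : HasFDerivAt u _ x := h1.congr_of_eventuallyEq (Eventually.of_forall fun x => hrep x)
    refine h2.congr_fderiv ?_
    ext y
    simp [g]
    ring
  have hglim : Tendsto (fun t => ‖T (γ t - x₀) - (1 / Real.pi ^ 2) • g (γ t)‖) atTop atTop := by
    have h1 : Tendsto (fun t => ‖(1 / Real.pi ^ 2) • g (γ t)‖) atTop (𝓝 0) := by
      have := (((tendsto_integral_gradKer_cocompact hu.continuous hV hle).const_smul
        (1 / Real.pi ^ 2)).comp hγ).norm
      simpa using this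
    have h2 : Tendsto (fun t : ℝ => t * ‖T e‖) atTop atTop := tendsto_id.atTop_mul_const hTe
    have h3 := h2.atTop_add h1.neg
    refine tendsto_atTop_mono' _ ?_ h3
    filter_upwards [eventually_ge_atTop 0] with t ht
    have h4 := norm_sub_norm_le (T (γ t - x₀)) ((1 / Real.pi ^ 2) • g (γ t))
    have h5 : T (γ t - x₀) = t • T e := by simp [γ]
    rw [h5, norm_smul, Real.norm_of_nonneg ht] at h4
    rw [h5]
    linarith
  have hΔ : Tendsto (fun t => Δ u (γ t)) atTop (𝓝 c) := by
    have h1 := ((tendsto_rieszPot_cocompact hu.continuous hV hle).comp hγ).const_mul (1 / Real.pi ^ 2)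
    have h2 := h1.neg.add_const c
    simp only [mul_zero, neg_zero, zero_add] at h2
    refine h2.congr fun t => ?_
    rw [hc]; rfl
  have hlim : Tendsto (fun t => -4 * Δ u (γ t) - 2 * ‖T (γ t - x₀) - (1 / Real.pi ^ 2) • g (γ t)‖ ^ 2)
      atTop atBot := by
    have h1 : Tendsto (fun t => ‖T (γ t - x₀) - (1 / Real.pi ^ 2) • g (γ t)‖ ^ 2) atTop atTop :=
      (tendsto_pow_atTop two_ne_zero).comp hglim
    have h2 := (hΔ.const_mul (-4)).add_atBot
      (tendsto_neg_atTop_atBot.comp (h1.const_mul_atTop two_pos))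
    refine h2.congr fun t => ?_
    simp [sub_eq_add_neg]
  refine hγ.frequently (Eventually.frequently ?_)
  filter_upwards [hlim.eventually_lt_atBot (-(|a| * Real.exp (2 * S) + 1))] with t ht
  rw [scalarCurvature_conformalMetric hu, sum_partialDeriv_sq (hgrad (γ t))]
  have h1 : Real.exp (-(2 * S)) ≤ Real.exp (-(2 * u (γ t))) :=
    Real.exp_le_exp.2 (by linarith [hS (γ t)])
  have h2 : Real.exp (-(2 * S)) * Real.exp (2 * S) = 1 := by
    rw [← Real.exp_add, neg_add_cancel, Real.exp_zero]
  have h3 : 0 ≤ |a| * Real.exp (2 * S) := by positivity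
  have h4 := Real.exp_pos (-(2 * S))
  set D := -4 * Δ u (γ t) - 2 * ‖T (γ t - x₀) - (1 / Real.pi ^ 2) • g (γ t)‖ ^ 2
  have h5 : Real.exp (-(2 * u (γ t))) * D ≤ Real.exp (-(2 * S)) * D :=
    mul_le_mul_of_nonpos_right h1 (by linarith)
  have h6 : Real.exp (-(2 * S)) * D < Real.exp (-(2 * S)) * -(|a| * Real.exp (2 * S)) :=
    mul_lt_mul_of_pos_left (by linarith) h4
  have h7 : Real.exp (-(2 * S)) * -(|a| * Real.exp (2 * S)) = -|a| := by
    linear_combination (-|a|) * h2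
  linarith [neg_abs_le a]

/-! ### Conformally induced metrics on immersed manifolds -/

section InducedMetric

variable {E : Type*} [NormedAddCommGroup E] [NormedSpace ℝ E] {H : Type*} [TopologicalSpace H]
  {I : ModelWithCorners ℝ E H} {M : Type*} [TopologicalSpace M] [ChartedSpace H M]
  {F : Type*} [NormedAddCommGroup F] [InnerProductSpace ℝ F]

variable (I) in
/-- The pullback of the Euclidean inner product of `F` under the differential of `f : M → F`. -/
def inducedForm (f : M → F) (b : M) : TangentSpace I b →L[ℝ] TangentSpace I b →L[ℝ] ℝ :=
  ContinuousLinearMap.bilinearComp (E' := E) (F' := E) (innerSL ℝ : F →L[ℝ] F →L[ℝ] ℝ)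
    (mvfderiv I f b) (mvfderiv I f b)

theorem inducedForm_apply (f : M → F) (b : M) (X Y : TangentSpace I b) :
    inducedForm I f b X Y = inner ℝ (mvfderiv I f b X) (mvfderiv I f b Y) := rfl

variable [IsManifold I ∞ M]

/-- In a trivialization of the tangent bundle, the differential of a smooth map to a vector space
depends smoothly on the base point. -/
theorem contMDiffAt_mvfderiv_comp_symmL {f : M → F} (hf : ContMDiff I 𝓘(ℝ, F) ∞ f) (b₀ : M) :
    ContMDiffAt I 𝓘(ℝ, E →L[ℝ] F) ∞ (fun b => (mvfderiv I f b).comp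
      ((trivializationAt E (TangentSpace I : M → Type _) b₀).symmL ℝ b)) b₀ := by
  have h := (hf b₀).mfderiv_const (m := ∞) (by norm_cast)
  refine h.congr_of_eventuallyEq (Eventually.of_forall fun b => ?_)
  ext X
  simp [inTangentCoordinates, ContinuousLinearMap.inCoordinates, mvfderiv]
  rfl

/-- The local expression of a bilinear form on the tangent bundle, in the trivialization
at `b₀`. -/
theorem inCoordinates_tangentSpace_bilin_apply {b₀ b : M}
    (hb : b ∈ (trivializationAt E (TangentSpace I : M → Type _) b₀).baseSet)
    (B : TangentSpace I b →L[ℝ] TangentSpace I b →L[ℝ] ℝ) (X Y : E) :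
    ContinuousLinearMap.inCoordinates E (TangentSpace I : M → Type _) (E →L[ℝ] ℝ)
      (fun b : M => TangentSpace I b →L[ℝ] ℝ) b₀ b b₀ b B X Y
      = B ((trivializationAt E (TangentSpace I : M → Type _) b₀).symmL ℝ b X)
          ((trivializationAt E (TangentSpace I : M → Type _) b₀).symmL ℝ b Y) := by
  refine (inCoordinates_apply_eq₂ (E₃ := Bundle.Trivial M ℝ) (F₃ := ℝ) (ϕ := B)
    (v := X) (w := Y) hb hb (by simp)).trans ?_
  simp [Bundle.Trivialization.symmL_apply _ hb]

theorem contMDiff_smul_inducedForm {f : M → F} (hf : ContMDiff I 𝓘(ℝ, F) ∞ f) {c : M → ℝ}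
    (hc : ContMDiff I 𝓘(ℝ) ∞ c) :
    ContMDiff I (I.prod 𝓘(ℝ, E →L[ℝ] E →L[ℝ] ℝ)) ∞
      (fun b => Bundle.TotalSpace.mk' (E →L[ℝ] E →L[ℝ] ℝ)
        (E := fun b : M => TangentSpace I b →L[ℝ] TangentSpace I b →L[ℝ] ℝ) b
        (c b • inducedForm I f b)) := by
  intro b₀
  rw [Bundle.contMDiffAt_section]
  set A : M → E →L[ℝ] F := fun b => (mvfderiv I f b).comp
      ((trivializationAt E (TangentSpace I : M → Type _) b₀).symmL ℝ b) with hA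
  have hAs : ContMDiffAt I 𝓘(ℝ, E →L[ℝ] F) ∞ A b₀ := contMDiffAt_mvfderiv_comp_symmL hf b₀
  set j : F →L[ℝ] F →L[ℝ] ℝ := innerSL ℝ with hj
  have hflip : ContDiff ℝ ∞ (fun T : E →L[ℝ] F →L[ℝ] ℝ => T.flip) :=
    IsBoundedLinearMap.contDiff (𝕜 := ℝ) (f := fun T : E →L[ℝ] F →L[ℝ] ℝ => T.flip)
      ⟨⟨fun _ _ => rfl, fun _ _ => rfl⟩, 1, one_pos, fun T => by
        rw [one_mul, ContinuousLinearMap.opNorm_flip]⟩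
  have h1 : ContMDiffAt I 𝓘(ℝ, E →L[ℝ] F →L[ℝ] ℝ) ∞ (fun b => j.comp (A b)) b₀ :=
    contMDiffAt_const.clm_comp hAs
  have h2 : ContMDiffAt I 𝓘(ℝ, F →L[ℝ] E →L[ℝ] ℝ) ∞
      (fun b => (j.comp (A b)).flip) b₀ :=
    (hflip.contMDiff _).comp b₀ h1
  have h3 : ContMDiffAt I 𝓘(ℝ, E →L[ℝ] E →L[ℝ] ℝ) ∞
      (fun b => c b • ((j.comp (A b)).flip).comp (A b)) b₀ :=
    (hc b₀).smul (h2.clm_comp hAs)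
  refine h3.congr_of_eventuallyEq ?_
  have hb : ∀ᶠ b in 𝓝 b₀, b ∈ (trivializationAt E (TangentSpace I : M → Type _) b₀).baseSet :=
    (trivializationAt E (TangentSpace I : M → Type _) b₀).open_baseSet.mem_nhds
      (FiberBundle.mem_baseSet_trivializationAt' b₀)
  filter_upwards [hb] with b hb
  ext X Y
  rw [hom_trivializationAt_apply, inCoordinates_tangentSpace_bilin_apply hb]
  simp only [_root_.smul_apply, inducedForm_apply, smul_eq_mul]
  exact congrArg (c b * ·) (real_inner_comm _ _)

/-- The metric `c · f^* ⟪·, ·⟫` on `M`, for an immersion `f` of `M` into a Euclidean space and a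
positive function `c`. -/
def conformalInducedMetric [FiniteDimensional ℝ E] {f : M → F} (hf : ContMDiff I 𝓘(ℝ, F) ∞ f)
    (hinj : ∀ b, Function.Injective (mvfderiv I f b)) {c : M → ℝ}
    (hc : ContMDiff I 𝓘(ℝ) ∞ c) (hpos : ∀ b, 0 < c b) :
    Bundle.ContMDiffRiemannianMetric I ∞ E (fun b : M => TangentSpace I b) where
  inner b := c b • inducedForm I f b
  symm b X Y := by
    simp only [_root_.smul_apply, inducedForm_apply, real_inner_comm]
  pos b X hX := by
    have h : mvfderiv I f b X ≠ 0 := fun h => hX (hinj b (h.trans (map_zero _).symm))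
    have h' : 0 < inner ℝ (mvfderiv I f b X) (mvfderiv I f b X) := real_inner_self_pos.2 h
    simpa only [_root_.smul_apply, inducedForm_apply, smul_eq_mul]
      using mul_pos (hpos b) h'
  isVonNBounded b := by
    let A : E →L[ℝ] F := mvfderiv I f b
    obtain ⟨K, hK, hA⟩ := (A : E →ₗ[ℝ] F).exists_antilipschitzWith
      (LinearMap.ker_eq_bot.2 (hinj b))
    have key : Bornology.IsVonNBounded ℝ {X : E | c b * inner ℝ (A X) (A X) < 1} := by
      rw [NormedSpace.isVonNBounded_iff ℝ, isBounded_iff_forall_norm_le]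
      refine ⟨K * √(1 / c b), fun X hX => ?_⟩
      have h1 : ‖A X‖ ^ 2 ≤ 1 / c b := by
        have hX : c b * inner ℝ (A X) (A X) < 1 := hX
        rw [real_inner_self_eq_norm_sq] at hX
        rw [le_div_iff₀ (hpos b)]
        linarith
      have h2 : ‖X‖ ≤ K * ‖A X‖ := by
        simpa using hA.le_mul_norm_sub (x := X) (y := 0)
      exact h2.trans (mul_le_mul_of_nonneg_left (Real.le_sqrt_of_sq_le h1) K.2)
    exact key
  contMDiff := contMDiff_smul_inducedForm hf hc

/-- If a continuous metric is conformal to an induced metric near `b₀`, except possibly at `b₀`, the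
conformal factor has a positive limit at `b₀`: both metrics are evaluated on a nonvanishing local
vector field. -/
theorem exists_tendsto_conformalFactor [Nontrivial E]
    (G : Bundle.ContMDiffRiemannianMetric I ∞ E (fun b : M => TangentSpace I b)) {f : M → F}
    (hf : ContMDiff I 𝓘(ℝ, F) ∞ f) (hinj : ∀ b, Function.Injective (mvfderiv I f b)) {c : M → ℝ}
    {b₀ : M} (h : ∀ b ≠ b₀, ∀ X Y, G.inner b X Y = c b * inducedForm I f b X Y) :
    ∃ L, 0 < L ∧ Tendsto c (𝓝[≠] b₀) (𝓝 L) := by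
  obtain ⟨X, hX⟩ := exists_ne (0 : E)
  set e := trivializationAt E (TangentSpace I : M → Type _) b₀ with he
  have hb₀ : b₀ ∈ e.baseSet := FiberBundle.mem_baseSet_trivializationAt' b₀
  have hb : ∀ᶠ b in 𝓝 b₀, b ∈ e.baseSet := e.open_baseSet.mem_nhds hb₀
  have hσ : ∀ b ∈ e.baseSet, e.symmL ℝ b X ≠ 0 := fun b hb h0 => by
    have h1 : e.symmL ℝ b X = (e.continuousLinearEquivAt ℝ b hb).symm X := by
      rw [Bundle.Trivialization.symm_continuousLinearEquivAt_eq]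
    exact hX ((e.continuousLinearEquivAt ℝ b hb).symm.map_eq_zero_iff.1 (h1.symm.trans h0))
  have hG : ContinuousAt (fun b => G.inner b (e.symmL ℝ b X) (e.symmL ℝ b X)) b₀ := by
    have h1 := ((Bundle.contMDiffAt_section b₀).1 (G.contMDiff b₀)).continuousAt
    refine ((h1.clm_apply (continuousAt_const (y := X))).clm_apply
      (continuousAt_const (y := X))).congr ?_
    filter_upwards [hb] with b hb
    exact inCoordinates_tangentSpace_bilin_apply hb (G.inner b) X X
  have hI : ContinuousAt (fun b => inducedForm I f b (e.symmL ℝ b X) (e.symmL ℝ b X)) b₀ := by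
    have h1 := ((contMDiffAt_mvfderiv_comp_symmL hf b₀).continuousAt.clm_apply
      (continuousAt_const (y := X)))
    exact h1.inner h1
  have hIpos : ∀ b ∈ e.baseSet, 0 < inducedForm I f b (e.symmL ℝ b X) (e.symmL ℝ b X) :=
    fun b hb => real_inner_self_pos.2 fun h0 => hσ b hb (hinj b (h0.trans (map_zero _).symm))
  refine ⟨_, div_pos (G.pos b₀ _ (hσ b₀ hb₀)) (hIpos b₀ hb₀),
    ((hG.div hI (hIpos b₀ hb₀).ne').tendsto.mono_left nhdsWithin_le_nhds).congr' ?_⟩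
  filter_upwards [self_mem_nhdsWithin, nhdsWithin_le_nhds hb] with b hne hb
  rw [Pi.div_apply, h b hne, mul_div_assoc, div_self (hIpos b hb).ne', mul_one]

end InducedMetric

/-! ### The stereographic projection of the three-sphere -/

theorem fact_finrank_R4 : Fact (Module.finrank ℝ (EuclideanSpace ℝ (Fin 4)) = 3 + 1) :=
  ⟨finrank_euclideanSpace_fin⟩

theorem contMDiff_coe_S3 :
    ContMDiff (𝓡 3) 𝓘(ℝ, EuclideanSpace ℝ (Fin 4)) ∞
      ((↑) : S3 → EuclideanSpace ℝ (Fin 4)) :=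
  haveI := fact_finrank_R4
  contMDiff_coe_sphere

theorem inner_mvfderiv_coe_S3 (q : S3) (X : TangentSpace (𝓡 3) q) :
    inner ℝ (q : EuclideanSpace ℝ (Fin 4))
      (mvfderiv (𝓡 3) ((↑) : S3 → EuclideanSpace ℝ (Fin 4)) q X) = 0 := by
  have h : mvfderiv (𝓡 3) ((↑) : S3 → EuclideanSpace ℝ (Fin 4)) q X
      ∈ (mvfderiv (𝓡 3) ((↑) : S3 → EuclideanSpace ℝ (Fin 4)) q).range := ⟨X, rfl⟩
  have := fact_finrank_R4
  rw [range_mvfderiv_subtypeVal] at h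
  exact Submodule.mem_orthogonal_singleton_iff_inner_right.1 h

theorem sum_sq_S3 (q : S3) :
    (q : EuclideanSpace ℝ (Fin 4)) 0 ^ 2 + (q : EuclideanSpace ℝ (Fin 4)) 1 ^ 2
      + (q : EuclideanSpace ℝ (Fin 4)) 2 ^ 2 + (q : EuclideanSpace ℝ (Fin 4)) 3 ^ 2 = 1 := by
  have h : ‖(q : EuclideanSpace ℝ (Fin 4))‖ ^ 2 = 1 := by
    rw [norm_eq_of_mem_sphere q]; norm_num
  rw [EuclideanSpace.norm_sq_eq] at h
  simpa [Fin.sum_univ_four] using h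

theorem one_add_pos_of_ne_southPole {q : S3} (hq : q ≠ southPole) :
    0 < 1 + (q : EuclideanSpace ℝ (Fin 4)) 3 := by
  have h := sum_sq_S3 q
  have h1 : -1 ≤ (q : EuclideanSpace ℝ (Fin 4)) 3 := by nlinarith
  refine lt_of_le_of_ne (by linarith) fun h0 => hq ?_
  have h3 : (q : EuclideanSpace ℝ (Fin 4)) 3 = -1 := by linarith
  rw [h3] at h
  have e0 : (q : EuclideanSpace ℝ (Fin 4)) 0 = 0 := by nlinarith
  have e1 : (q : EuclideanSpace ℝ (Fin 4)) 1 = 0 := by nlinarith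
  have e2 : (q : EuclideanSpace ℝ (Fin 4)) 2 = 0 := by nlinarith
  ext i
  fin_cases i <;> simp [southPole, e0, e1, e2, h3, Fin.last]

/-- The stereographic projection as a map on `ℝ⁴`, singular on the hyperplane `x₄ = -1`. -/
def stereoAmbient (z : EuclideanSpace ℝ (Fin 4)) : R3 :=
  WithLp.toLp 2 fun i : Fin 3 => z i.castSucc / (1 + z 3)

theorem hasFDerivAt_stereoAmbient {z : EuclideanSpace ℝ (Fin 4)} (hz : 1 + z 3 ≠ 0) :
    ∃ D : EuclideanSpace ℝ (Fin 4) →L[ℝ] R3, HasFDerivAt stereoAmbient D z ∧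
      ∀ w i, D w i = w i.castSucc / (1 + z 3) - z i.castSucc * w 3 / (1 + z 3) ^ 2 := by
  have h : ∀ i : Fin 3, HasFDerivAt (fun z : EuclideanSpace ℝ (Fin 4) => z i.castSucc / (1 + z 3))
      (((1 + z 3)⁻¹ : ℝ) • (EuclideanSpace.proj i.castSucc : EuclideanSpace ℝ (Fin 4) →L[ℝ] ℝ)
        - (z i.castSucc / (1 + z 3) ^ 2) • (EuclideanSpace.proj 3 : _ →L[ℝ] ℝ)) z := by
    intro i
    have hi := (EuclideanSpace.proj i.castSucc : EuclideanSpace ℝ (Fin 4) →L[ℝ] ℝ).hasFDerivAt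
      (x := z)
    have h3 := ((EuclideanSpace.proj 3 : EuclideanSpace ℝ (Fin 4) →L[ℝ] ℝ).hasFDerivAt
      (x := z)).const_add 1
    refine (hi.mul ((hasDerivAt_inv hz).comp_hasFDerivAt z h3)).congr_fderiv ?_
    ext w
    simp
    field_simp
    ring
  refine ⟨(EuclideanSpace.equiv (Fin 3) ℝ).symm.toContinuousLinearMap.comp
    (ContinuousLinearMap.pi fun i =>
      ((1 + z 3)⁻¹ : ℝ) • (EuclideanSpace.proj i.castSucc : EuclideanSpace ℝ (Fin 4) →L[ℝ] ℝ)
        - (z i.castSucc / (1 + z 3) ^ 2) • (EuclideanSpace.proj 3 : _ →L[ℝ] ℝ)),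
    (EuclideanSpace.equiv (Fin 3) ℝ).symm.toContinuousLinearMap.hasFDerivAt.comp z
      (hasFDerivAt_pi.2 h), fun w i => ?_⟩
  simp
  ring

/-- The stereographic projection is conformal, with factor `1 / (1 + x₄)`. -/
theorem inner_mfderiv_stereo {q : S3} (hq : q ≠ southPole) (X Y : TangentSpace (𝓡 3) q) :
    inner (E := R3) ℝ (mfderiv (𝓡 3) 𝓘(ℝ, R3) stereo q X)
      (mfderiv (𝓡 3) 𝓘(ℝ, R3) stereo q Y)
      = (1 / (1 + (q : EuclideanSpace ℝ (Fin 4)) 3)) ^ 2 *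
        inducedForm (𝓡 3) ((↑) : S3 → EuclideanSpace ℝ (Fin 4)) q X Y := by
  have hpos := one_add_pos_of_ne_southPole hq
  obtain ⟨D, hD, hDf⟩ := hasFDerivAt_stereoAmbient hpos.ne'
  have hι : HasMFDerivAt (𝓡 3) 𝓘(ℝ, EuclideanSpace ℝ (Fin 4))
      ((↑) : S3 → EuclideanSpace ℝ (Fin 4)) q _ :=
    ((contMDiff_coe_S3 q).mdifferentiableAt (by simp)).hasMFDerivAt
  have hcomp : ∀ X : TangentSpace (𝓡 3) q, mfderiv (𝓡 3) 𝓘(ℝ, R3) stereo q X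
      = D (mvfderiv (𝓡 3) ((↑) : S3 → EuclideanSpace ℝ (Fin 4)) q X) := fun X => by
    have h := (hD.hasMFDerivAt.comp q hι).mfderiv
    exact congrArg (fun L => L X) h
  have oX := inner_mvfderiv_coe_S3 q X
  have oY := inner_mvfderiv_coe_S3 q Y
  rw [hcomp, hcomp, inducedForm_apply]
  set w := mvfderiv (𝓡 3) ((↑) : S3 → EuclideanSpace ℝ (Fin 4)) q X
  set w' := mvfderiv (𝓡 3) ((↑) : S3 → EuclideanSpace ℝ (Fin 4)) q Y
  have hs := sum_sq_S3 q
  set z := (q : EuclideanSpace ℝ (Fin 4))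
  simp only [PiLp.inner_apply, Fin.sum_univ_four, Fin.sum_univ_three, hDf, RCLike.inner_apply,
    conj_trivial] at oX oY ⊢
  simp only [Fin.castSucc_zero, Fin.castSucc_one, show (2 : Fin 3).castSucc = (2 : Fin 4) from rfl]
  field_simp
  linear_combination -(1 + z 3) * w 3 * oY - (1 + z 3) * w' 3 * oX + w 3 * w' 3 * hs

/-- The inverse of the stereographic projection. -/
def stereoInv (x : R3) : S3 :=
  ⟨WithLp.toLp 2 ![2 * x 0 / (1 + ‖x‖ ^ 2), 2 * x 1 / (1 + ‖x‖ ^ 2), 2 * x 2 / (1 + ‖x‖ ^ 2),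
    (1 - ‖x‖ ^ 2) / (1 + ‖x‖ ^ 2)], by
    have h : ‖x‖ ^ 2 = x 0 ^ 2 + x 1 ^ 2 + x 2 ^ 2 := by
      simp [EuclideanSpace.norm_sq_eq, Fin.sum_univ_three]
    have hp : 1 + ‖x‖ ^ 2 ≠ 0 := by positivity
    rw [mem_sphere_zero_iff_norm, ← sq_eq_sq₀ (norm_nonneg _) zero_le_one,
      EuclideanSpace.norm_sq_eq]
    simp [Fin.sum_univ_four]
    field_simp
    linear_combination -4 * h⟩

/-- The inverse of the conformal factor, in the coordinate on `ℝ³`. -/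
theorem one_add_stereoInv (x : R3) :
    1 + (stereoInv x : EuclideanSpace ℝ (Fin 4)) 3 = 2 / (1 + ‖x‖ ^ 2) := by
  have hp : 1 + ‖x‖ ^ 2 ≠ 0 := by positivity
  simp [stereoInv]
  field_simp
  ring

theorem stereo_stereoInv (x : R3) : stereo (stereoInv x) = x := by
  have hp : 1 + ‖x‖ ^ 2 ≠ 0 := by positivity
  ext i
  change (stereoInv x : EuclideanSpace ℝ (Fin 4)) i.castSucc
    / (1 + (stereoInv x : EuclideanSpace ℝ (Fin 4)) 3) = x i
  rw [one_add_stereoInv]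
  fin_cases i <;> simp [stereoInv] <;> field_simp

theorem stereoInv_ne_southPole (x : R3) : stereoInv x ≠ southPole := fun h => by
  have h1 := one_add_stereoInv x
  rw [h] at h1
  have : 0 < 2 / (1 + ‖x‖ ^ 2) := by positivity
  simp [southPole, Fin.last] at h1
  linarith

/-- The point at infinity corresponds to the south pole. -/
theorem tendsto_stereoInv : Tendsto stereoInv (cocompact R3) (𝓝[≠] southPole) := by
  refine tendsto_nhdsWithin_iff.2 ⟨?_, Eventually.of_forall stereoInv_ne_southPole⟩
  rw [tendsto_subtype_rng, tendsto_iff_norm_sub_tendsto_zero]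
  have hs : ∀ x, ‖(stereoInv x : EuclideanSpace ℝ (Fin 4)) - southPole‖
      = √(4 * (1 + ‖x‖ ^ 2)⁻¹) := fun x => by
    have hp : 1 + ‖x‖ ^ 2 ≠ 0 := by positivity
    have h : ‖x‖ ^ 2 = x 0 ^ 2 + x 1 ^ 2 + x 2 ^ 2 := by
      simp [EuclideanSpace.norm_sq_eq, Fin.sum_univ_three]
    rw [EuclideanSpace.norm_eq]
    congr 1
    simp [Fin.sum_univ_four, stereoInv, southPole, Fin.last]
    field_simp
    linear_combination -4 * h
  have hn : Tendsto (fun x : R3 => 1 + ‖x‖ ^ 2) (cocompact R3) atTop :=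
    tendsto_atTop_add_const_left _ _ ((tendsto_pow_atTop two_ne_zero).comp
      tendsto_norm_cocompact_R3)
  simp only [hs]
  simpa using ((hn.inv_tendsto_atTop.const_mul 4).sqrt)

/-- The pullback of `exp (2u) |dx|²` is conformal to the round metric. -/
theorem conformalMetric_stereo (u : R3 → ℝ) {q : S3} (hq : q ≠ southPole)
    (X Y : TangentSpace (𝓡 3) q) :
    conformalMetric u (stereo q) (mfderiv (𝓡 3) 𝓘(ℝ, R3) stereo q X)
        (mfderiv (𝓡 3) 𝓘(ℝ, R3) stereo q Y)
      = Real.exp (2 * u (stereo q)) * (1 / (1 + (q : EuclideanSpace ℝ (Fin 4)) 3)) ^ 2 *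
        inducedForm (𝓡 3) ((↑) : S3 → EuclideanSpace ℝ (Fin 4)) q X Y := by
  rw [mul_assoc, ← inner_mfderiv_stereo hq]
  rfl

/-- If the metric extends to the sphere, then `u + log (1 + |x|²)` has a limit at infinity, because
the conformal factor has a positive limit at the pole. -/
theorem isLittleO_of_pullbackExtends {u : R3 → ℝ} (h : PullbackExtends (conformalMetric u)) :
    u =o[cocompact R3] (fun x => ‖x‖ ^ 2) := by
  obtain ⟨G, hG⟩ := h
  have := fact_finrank_R4
  obtain ⟨L, hL, hlim⟩ := exists_tendsto_conformalFactor G contMDiff_coe_S3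
    injective_mvfderiv_subtypeVal_sphere
    (fun q hq X Y => (hG q hq X Y).trans (conformalMetric_stereo u hq X Y))
  have h1 := (hlim.comp tendsto_stereoInv).log hL.ne'
  have h2 : ∀ x, Real.log (Real.exp (2 * u x) * (1 / (2 / (1 + ‖x‖ ^ 2))) ^ 2)
      = 2 * u x + 2 * Real.log (1 + ‖x‖ ^ 2) - 2 * Real.log 2 := fun x => by
    have hp : 1 + ‖x‖ ^ 2 ≠ 0 := by positivity
    rw [Real.log_mul (Real.exp_pos _).ne' (by positivity), Real.log_exp, Real.log_pow,
      one_div_div, Real.log_div hp two_ne_zero]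
    push_cast
    ring
  simp only [Function.comp_def, one_add_stereoInv, stereo_stereoInv, h2] at h1
  have hn : Tendsto (fun x : R3 => ‖x‖ ^ 2) (cocompact R3) atTop :=
    (tendsto_pow_atTop two_ne_zero).comp tendsto_norm_cocompact_R3
  have hlog : (fun x : R3 => Real.log (1 + ‖x‖ ^ 2)) =o[cocompact R3] (fun x => ‖x‖ ^ 2) := by
    have h3 : (fun x : R3 => Real.log (1 + ‖x‖ ^ 2)) =o[cocompact R3] (fun x => 1 + ‖x‖ ^ 2) :=
      Real.isLittleO_log_id_atTop.comp_tendsto (tendsto_atTop_add_const_left _ 1 hn)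
    refine h3.trans_isBigO (Asymptotics.IsBigO.add ?_ (Asymptotics.isBigO_refl _ _))
    exact (Asymptotics.isLittleO_const_left.2 (Or.inr (tendsto_abs_atTop_atTop.comp hn))).isBigO
  have hb : (fun x => 2 * u x + 2 * Real.log (1 + ‖x‖ ^ 2) - 2 * Real.log 2)
      =o[cocompact R3] (fun x => ‖x‖ ^ 2) :=
    (h1.isBigO_one ℝ).trans_isLittleO
      (Asymptotics.isLittleO_const_left.2 (Or.inr (tendsto_abs_atTop_atTop.comp hn)))
  have hc : (fun _ : R3 => Real.log 2) =o[cocompact R3] (fun x => ‖x‖ ^ 2) :=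
    Asymptotics.isLittleO_const_left.2 (Or.inr (tendsto_abs_atTop_atTop.comp hn))
  refine (((hb.const_mul_left (1 / 2)).sub hlog).add hc).congr_left fun x => ?_
  ring

/-- The metric of a spherical solution is `(2l / D)²` times the round metric, where `D` is an affine
function on `ℝ⁴`, positive on the sphere; this formula makes sense at the pole. -/
theorem IsSpherical.pullbackExtends {u : R3 → ℝ} (hu : IsSpherical u) :
    PullbackExtends (conformalMetric u) := by
  obtain ⟨x₀, l, hl, hu⟩ := hu
  have := fact_finrank_R4
  -- `D = (1 + x₄) (1 + l² |π(x) - x₀|²)`, on the sphere an affine function without zeros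
  set D : EuclideanSpace ℝ (Fin 4) → ℝ := fun z => (1 + z 3) + l ^ 2 * ((1 - z 3)
    - 2 * (z 0 * x₀ 0 + z 1 * x₀ 1 + z 2 * x₀ 2) + ‖x₀‖ ^ 2 * (1 + z 3)) with hD
  have hDs : ContDiff ℝ ∞ D := by
    have hz : ∀ i, ContDiff ℝ ∞ (fun z : EuclideanSpace ℝ (Fin 4) => z i) := fun i =>
      (EuclideanSpace.proj i : EuclideanSpace ℝ (Fin 4) →L[ℝ] ℝ).contDiff
    have := hz 0
    have := hz 1
    have := hz 2
    have := hz 3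
    fun_prop
  have hDeq : ∀ q : S3, q ≠ southPole →
      D q = (1 + (q : EuclideanSpace ℝ (Fin 4)) 3) * (1 + l ^ 2 * ‖stereo q - x₀‖ ^ 2) := by
    intro q hq
    have hp := (one_add_pos_of_ne_southPole hq).ne'
    have hs := sum_sq_S3 q
    rw [EuclideanSpace.norm_sq_eq]
    simp only [hD, EuclideanSpace.norm_sq_eq x₀, Fin.sum_univ_three, PiLp.sub_apply,
      Real.norm_eq_abs, sq_abs, stereo, Fin.castSucc_zero, Fin.castSucc_one,
      show (2 : Fin 3).castSucc = (2 : Fin 4) from rfl, show Fin.last 3 = (3 : Fin 4) from rfl]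
    field_simp
    linear_combination -l ^ 2 * hs
  have hDpos : ∀ q : S3, 0 < D q := by
    intro q
    by_cases hq : q = southPole
    · have h2 : D q = 2 * l ^ 2 := by
        rw [hq]
        simp [hD, southPole, Fin.last]
        ring
      rw [h2]
      positivity
    · rw [hDeq q hq]
      have := one_add_pos_of_ne_southPole hq
      positivity
  have hc : ContMDiff (𝓡 3) 𝓘(ℝ) ∞ (fun q : S3 => (2 * l / D q) ^ 2) := by
    intro q
    have h1 : ContDiffAt ℝ ∞ (fun z => (2 * l / D z) ^ 2) (q : EuclideanSpace ℝ (Fin 4)) :=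
      (contDiffAt_const.div hDs.contDiffAt (hDpos q).ne').pow 2
    exact h1.contMDiffAt.comp q (contMDiff_coe_S3 q)
  refine ⟨conformalInducedMetric contMDiff_coe_S3 injective_mvfderiv_subtypeVal_sphere hc
    fun q => pow_pos (div_pos (by positivity) (hDpos q)) 2, fun q hq X Y => ?_⟩
  rw [conformalMetric_stereo u hq]
  change (2 * l / D q) ^ 2 * _ = _
  congr 1
  have hp := one_add_pos_of_ne_southPole hq
  rw [hu, hDeq q hq, two_mul (Real.log _), Real.exp_add, Real.exp_log (by positivity)]
  field_simp

/-! ### Characterizations of a vanishing quadratic part -/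

section QuadraticPart

variable {u : R3 → ℝ} {T : R3 →ₗ[ℝ] R3} {x₀ : R3} {q : ℝ}

theorem le_logPotential_of_eq (hT0 : ∀ x, inner ℝ (T x) x ≤ 0)
    (hrep : ∀ x, u x = logPotential u x + (q + 1 / 2 * inner ℝ (T (x - x₀)) (x - x₀))) (x : R3) :
    u x ≤ logPotential u x + q := by
  have := hT0 (x - x₀)
  rw [hrep x]
  linarith

/-- The potential is bounded above, so along a line on which the quadratic form is nonzero `u` tends
to `-∞` at a quadratic rate. -/
theorem eq_zero_of_isLittleO (hu : Continuous u) (hV : Integrable fun x => Real.exp (3 * u x))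
    (hT : T.IsSymmetric) (hT0 : ∀ x, inner ℝ (T x) x ≤ 0)
    (hrep : ∀ x, u x = logPotential u x + (q + 1 / 2 * inner ℝ (T (x - x₀)) (x - x₀)))
    (h : u =o[cocompact R3] (fun x => ‖x‖ ^ 2)) : T = 0 := by
  by_contra hne
  obtain ⟨e, he⟩ : ∃ e, T e ≠ 0 := by
    by_contra hcon
    push Not at hcon
    exact hne (LinearMap.ext hcon)
  have hδ : 0 < -inner ℝ (T e) e :=
    neg_pos.2 (lt_of_le_of_ne (hT0 e) fun h0 => he (inner_eq_zero_of_nonpos hT hT0 h0))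
  have he0 : e ≠ 0 := fun h0 => he (by rw [h0, map_zero])
  set δ := -inner ℝ (T e) e with hδdef
  obtain ⟨C, hC⟩ := exists_logPotential_le hu hV (le_logPotential_of_eq hT0 hrep)
    (normalizedMass_pos hV)
  have hepos : 0 < ‖e‖ ^ 2 := by positivity
  have hcpos : 0 < δ / (8 * ‖e‖ ^ 2) := by positivity
  have hray : Tendsto (fun t : ℝ => x₀ + t • e) atTop (cocompact R3) :=
    tendsto_ray_cocompact x₀ he0
  have h1 := hray.eventually (h.def hcpos)
  have h2 : ∀ᶠ t : ℝ in atTop, C + q + δ / (8 * ‖e‖ ^ 2) * (2 * ‖x₀‖ ^ 2) < δ / 4 * t ^ 2 :=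
    ((tendsto_pow_atTop two_ne_zero).const_mul_atTop (by positivity)).eventually_gt_atTop _
  obtain ⟨t, h1, h2⟩ := (h1.and h2).exists
  have h3 : u (x₀ + t • e) ≤ C + q - δ / 2 * t ^ 2 := by
    have h4 := hC (x₀ + t • e)
    rw [sub_self, zero_mul, neg_zero, zero_add] at h4
    rw [hrep, add_sub_cancel_left, map_smul, inner_smul_left, inner_smul_right]
    simp only [conj_trivial]
    nlinarith
  have h5 : ‖x₀ + t • e‖ ^ 2 ≤ 2 * ‖x₀‖ ^ 2 + 2 * (t ^ 2 * ‖e‖ ^ 2) := by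
    have h6 := norm_add_le x₀ (t • e)
    have h7 : ‖t • e‖ ^ 2 = t ^ 2 * ‖e‖ ^ 2 := by rw [norm_smul, mul_pow, Real.norm_eq_abs, sq_abs]
    nlinarith [sq_nonneg (‖x₀‖ - ‖t • e‖), norm_nonneg (x₀ + t • e)]
  rw [Real.norm_eq_abs, Real.norm_of_nonneg (by positivity)] at h1
  have h8 := neg_abs_le (u (x₀ + t • e))
  have h9 := mul_le_mul_of_nonneg_left h5 hcpos.le
  have h10 : δ / (8 * ‖e‖ ^ 2) * (2 * (t ^ 2 * ‖e‖ ^ 2)) = δ / 4 * t ^ 2 := by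
    field_simp
    ring
  rw [mul_add, h10] at h9
  linarith

/-- The polynomial is constant if and only if its quadratic form vanishes: it is centred at its
maximum, so it has no linear part of its own. -/
theorem totalDegree_eq_zero_iff_of_eval_quadratic (hT : T.IsSymmetric)
    (hT0 : ∀ x, inner ℝ (T x) x ≤ 0) {P : MvPolynomial (Fin 3) ℝ}
    (hP : ∀ x : R3, MvPolynomial.eval (fun i => x i) P = q + 1 / 2 * inner ℝ (T (x - x₀)) (x - x₀)) :
    P.totalDegree = 0 ↔ T = 0 := by
  constructor
  · intro h
    rw [MvPolynomial.totalDegree_eq_zero_iff_eq_C] at h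
    have hc : ∀ x : R3, MvPolynomial.coeff 0 P = q + 1 / 2 * inner ℝ (T (x - x₀)) (x - x₀) :=
      fun x => by rw [← hP x, h, MvPolynomial.eval_C, MvPolynomial.coeff_zero_C]
    refine LinearMap.ext fun x => inner_eq_zero_of_nonpos hT hT0 ?_
    have h0 := hc x₀
    have h1 := hc (x₀ + x)
    rw [sub_self, inner_zero_right] at h0
    rw [add_sub_cancel_left] at h1
    linarith
  · rintro rfl
    exact totalDegree_eq_zero_of_eval_const (q := q) fun x => by simp [hP]

/-- The Riesz potential vanishes at infinity, so `Δu` tends to the trace of the quadratic part. -/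
theorem tendsto_laplacian_cocompact (hu : Continuous u)
    (hV : Integrable fun x => Real.exp (3 * u x)) (hT0 : ∀ x, inner ℝ (T x) x ≤ 0)
    (hrep : ∀ x, u x = logPotential u x + (q + 1 / 2 * inner ℝ (T (x - x₀)) (x - x₀)))
    {c : ℝ} (hc : ∀ x, Δ u x = -(1 / Real.pi ^ 2 * rieszPot (fun y => Real.exp (3 * u y)) x) + c) :
    Tendsto (Δ u) (cocompact R3) (𝓝 c) := by
  have h := ((tendsto_rieszPot_cocompact hu hV (le_logPotential_of_eq hT0 hrep)).const_mul
    (1 / Real.pi ^ 2)).neg.add_const c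
  rw [mul_zero, neg_zero, zero_add] at h
  exact h.congr fun x => (hc x).symm

end QuadraticPart

end

end

theorem theorem1p3 (u : R3 → ℝ)
    (hu : IsSmoothSolution u (fun x => 2 * Real.exp (3 * u x)))
    (hV : MeasureTheory.Integrable (fun x : R3 => Real.exp (3 * u x))) :
    ∃ p : MvPolynomial (Fin 3) ℝ,
      (∀ x : R3, u x = logPotential u x + MvPolynomial.eval (fun i => x i) p) ∧
      List.TFAE [
        IsSpherical u,
        p.totalDegree = 0,
        Filter.Tendsto (Δ u) (Filter.cocompact R3) (𝓝 0),
        u =o[Filter.cocompact R3] (fun x => ‖x‖ ^ 2),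
        (⊥ : EReal) < Filter.liminf
          (fun x => ((scalarCurvature (conformalMetric u) x : ℝ) : EReal)) (Filter.cocompact R3),
        PullbackExtends (conformalMetric u)] ∧
      (¬ IsSpherical u →
        ∃ a : ℝ, 0 < a ∧ Filter.Tendsto (Δ u) (Filter.cocompact R3) (𝓝 (-a))) := by
  obtain ⟨T, x₀, q, hT, hT0, hrep, hlap⟩ := exists_decomposition hu hV
  obtain ⟨p, hp⟩ := exists_mvPolynomial_quadratic T x₀ q
  have hs2 : ContDiff ℝ 2 u := contDiff_infty.1 hu.smooth 2
  have hlim := tendsto_laplacian_cocompact hs2.continuous hV hT0 hrep hlap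
  have hdeg := totalDegree_eq_zero_iff_of_eval_quadratic hT hT0 hp
  have htr := eq_zero_of_sum_inner_eq_zero hT hT0
  have hsph : T = 0 → IsSpherical u := fun h =>
    isSpherical_of_eq_logPotential_add_const (hs2.of_le (by norm_num)) hV (q := q) fun x => by
      simpa [h] using hrep x
  refine ⟨p, fun x => by rw [hp, ← hrep], ?_, fun hns => ?_⟩
  -- the extension to the sphere leads back to the polynomial through the growth of `u`; a lower bound
  -- for the scalar curvature is only used to exclude `T ≠ 0`
  · tfae_have 2 → 1 := fun h => hsph (hdeg.1 h)
    tfae_have 1 → 6 := fun h => h.pullbackExtends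
    tfae_have 6 → 4 := isLittleO_of_pullbackExtends
    tfae_have 4 → 2 := fun h => hdeg.2 (eq_zero_of_isLittleO hs2.continuous hV hT hT0 hrep h)
    tfae_have 2 → 3 := fun h => by simpa [hdeg.1 h] using hlim
    tfae_have 3 → 2 := fun h => hdeg.2 (htr (tendsto_nhds_unique hlim h))
    tfae_have 1 → 5 := fun h => by
      simp only [h.scalarCurvature_eq hs2, Filter.liminf_const]
      exact EReal.bot_lt_coe _
    tfae_have 5 → 2 := fun h => by
      refine hdeg.2 (by_contra fun hne => ?_)
      obtain ⟨a, -, ha⟩ := EReal.lt_iff_exists_real_btwn.1 h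
      refine exists_scalarCurvature_lt hs2 hV hT hT0 hrep hlap hne a ?_
      filter_upwards [Filter.eventually_lt_of_lt_liminf ha] with x hx
      exact not_lt.2 (EReal.coe_lt_coe_iff.1 hx).le
    tfae_finish
  · refine ⟨_, neg_pos.2 (lt_of_le_of_ne (Finset.sum_nonpos fun i _ => hT0 _)
      fun h0 => hns (hsph (htr h0))), ?_⟩
    rwa [neg_neg]
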